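/- **Setting.** There are $N$ agents. Agent $i$ has state $x_i\in\mathbb R^{n_i}$, scalar input $u_i$ and decision $w_i=[x_i^T,u_i]^T\in W_i\subseteq\mathbb R^{n_i+1}$; put $w=(w_i)_i$, $W=\prod_iW_i$, $n=\sum_in_i$. Given $w_{-i}$, agent $i$ minimizes $f_i(w_i,w_{-i})$ over $\mathcal D_i(w_{-i})=\{w_i\in W_i: H(w)=0,\ G(w)\le 0\}$, with shared constraints $H:W\to\mathbb R^m$, $G:W\to\mathbb R^l$. Let $\hat{\mathcal D}=\{w\in W:H(w)=0,\ G(w)\le0\}$ and $\nabla F=(\nabla_{w_i}f_i)_i$. A Nash equilibrium is $\tilde w\in W$ such that, for every $i$, $\tilde w_i$ minimizes $f_i(\cdot,\tilde w_{-i})$ over $\mathcal D_i(\tilde w_{-i})$; a variational equilibrium (VE) is a Nash equilibrium $\tilde w\in\hat{\mathcal D}$ with $(w-\tilde w)^T\nabla F(\tilde w)\ge0$ for all $w\in\hat{\mathcal D}$. Assume: 1. $H$ is affine; each $G_j$ is convex and $C^1$ on $W$; each $f_i(\cdot,w_{-i})$ is convex and $C^1$ on $W_i$ for every $w_{-i}\in\prod_{j\ne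 i}W_j$; $\nabla F$ and the $\nabla G_j$ are locally Lipschitz on $W$. 2. Each $W_i$ is closed and convex. 3. (Slater) There is $\bar w\in W$ with $H(\bar w)=0$ and $G_j(\bar w)<0$ for all $j$, such that $\bar w_i$ lies in the relative interior of $W_i$ for every $i$ for which $W_i$ is not polyhedral. 4. $\nabla F$ is strictly monotone on $W$: $(w-w')^T(\nabla F(w)-\nabla F(w'))>0$ for $w\ne w'$ in $W$. 5. A VE exists. The physical system is $\dot x_i=\sum_{j}A_{ij}x_j+B_iu_i$, with every pair $(A_{ii},B_i)$ controllable, and every $w\in\hat{\mathcal D}$ is a steady state: $\sum_jA_{ij}x_j+B_iu_i=0$ for all $i$. **Design.** Let $\hat A_{ii}$ be the $n_i\times n_i$ matrix with ones on the superdiagonal and zeros elsewhere, and $\hat B_i=[0,\dots,0,1]^T$. A design consists, for each $i$, of a nonsingular $\mathcal T_i$ and a row $a_i$ with $\mathcal T_iA_{ii}\mathcal T_i^{-1}=\hat A_{ii}-\hat B_ia_i$ and $\mathcal T_iB_i=\hat B_i$; a row $K_{0i}$ such that $\hat A_{ii}+\hat B_iK_{0i}$ is Hurwitz; and a symmetric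 positive definite $P_{0i}$ with $P_{0i}(\hat A_{ii}+\hat B_iK_{0i})+(\hat A_{ii}+\hat B_iK_{0i})^TP_{0i}=-I$. For $\varepsilon>0$ let $S_i(\varepsilon)=\mathrm{diag}(\varepsilon^{j-1})_{j=1}^{n_i}$, $\bar S_i(\varepsilon)=\mathrm{diag}(\varepsilon^{j-n_i})_{j=1}^{n_i}$, $K_i(\varepsilon)=\frac1\varepsilon K_{0i}\bar S_i(\varepsilon)$, and $\hat A_{ij}=\mathcal T_iA_{ij}\mathcal T_j^{-1}$ for $j\ne i$. Let $\|\cdot\|_1$ be the maximal absolute column sum. **Algorithm.** For a closed convex set $K$, let $\mathrm{Proj}_K$ be the Euclidean projection onto $K$ and $\Pi_K(x,v)=\lim_{\delta\to0^+}(\mathrm{Proj}_K(x+\delta v)-x)/\delta$ for $x\in K$. With $L_i(w,\lambda,\mu)=f_i(w)+\lambda^TH(w)+\mu^TG(w)$, the auxiliary variables $\bar w_i=[\bar x_i^T,\bar u_i]^T$, $\lambda$, $\mu$ start anywhere in $W\times\mathbb R^m\times\mathbb R^l_+$, remain in this set, and satisfy $$\dot{\bar w}_i=\Pi_{W_i}\big(\bar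 w_i,-\nabla_{\bar w_i}L_i(\bar w,\lambda,\mu)\big),\qquad \dot\lambda=H(\bar w),\qquad \dot\mu=\Pi_{\mathbb R^l_+}(\mu,G(\bar w))$$ (locally absolutely continuous solutions on $[0,\infty)$, equations almost everywhere), and the physical system, started at any $x(0)$, is driven by $u_i=(K_i(\varepsilon)+a_i)\mathcal T_i(x_i-\bar x_i)+\bar u_i$ for $t>0$, with $u(0)$ arbitrary. **Theorem.** A design exists, and the VE $(\tilde x,\tilde u)$ is unique. Moreover, for every design and all $\sigma_i>0$ such that $\|S_i(\varepsilon')\hat A_{ij}S_j(\varepsilon')^{-1}\|_1<\sigma_i$ for all $i$, all $j\ne i$ and all $0<\varepsilon'<1$, and for every $\varepsilon>0$ with $$\frac1\varepsilon>2\sqrt n\,(N-1)\max_i\{\sigma_i\|P_{0i}\|_1\}+2,$$ the algorithm has a solution on $[0,\infty)$ from every initial condition, and every solution satisfies $(x(t),u(t))\to(\tilde x,\tilde u)$ as $t\to\infty$. -/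

import Mathlib

open Filter Topology MeasureTheory Set
open scoped Matrix

noncomputable section

namespace LinearVE

/-! ### Projections and projected dynamics -/

section Projection

variable {E : Type*} [NormedAddCommGroup E] [InnerProductSpace ℝ E]

/-- `p` is the point projection of `x` onto `K`: a point of `K` of least distance to `x`
(unique when `K` is convex). -/
def IsPointProj (K : Set E) (x p : E) : Prop :=
  p ∈ K ∧ ∀ z ∈ K, ‖p - x‖ ≤ ‖z - x‖

open Classical in
/-- The point projection `Proj_K`, for closed convex nonempty `K` in finite dimension. -/
def pointProj (K : Set E) (x : E) : E :=
  if h : ∃ p, IsPointProj K x p then h.choose else x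

/-- `d = Π_K(x, v)`, the vector projection of `v` at `x` with respect to `K`:
`d = lim_{δ → 0+} (Proj_K (x + δ v) - x) / δ`. -/
def IsVectorProj (K : Set E) (x v d : E) : Prop :=
  Tendsto (fun δ : ℝ => δ⁻¹ • (pointProj K (x + δ • v) - x)) (𝓝[>] 0) (𝓝 d)

/-- A polyhedral convex set: a finite intersection of closed half-spaces. -/
def IsPolyhedral (K : Set E) : Prop :=
  ∃ (p : ℕ) (a : Fin p → E) (c : Fin p → ℝ), K = {x | ∀ k, inner ℝ (a k) x ≤ c k}

end Projection

/-! ### The game -/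

/-- The decision space `ℝ^{n_i + 1}` of an agent with `k = n_i` states:
`w_i = [x_iᵀ, u_i]ᵀ`. -/
abbrev Dec (k : ℕ) : Type := EuclideanSpace ℝ (Fin (k + 1))

/-- The space of joint decisions `w = (w_i)_i`, with its Euclidean structure. -/
abbrev Joint {N : ℕ} (n : Fin N → ℕ) : Type := PiLp 2 fun i => Dec (n i)

/-- The state part `x_i` of `w_i`. -/
def statePart {k : ℕ} (v : Dec k) : Fin k → ℝ := fun r => v r.castSucc

/-- The input part `u_i` of `w_i`. -/
def inputPart {k : ℕ} (v : Dec k) : ℝ := v (Fin.last k)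

/-- `(v, w_{-i})`: the joint decision `w` with agent `i`'s decision replaced by `v`. -/
def deviate {N : ℕ} {n : Fin N → ℕ} (w : Joint n) (i : Fin N) (v : Dec (n i)) : Joint n :=
  WithLp.toLp 2 (Function.update w.ofLp i v)

/-- The data of a generalized Nash equilibrium problem with shared constraints
`H(w) = 0`, `G(w) ≤ 0` and local constraints `w_i ∈ W_i`. Only the values of `f` and `G` on `∏ W_i`
matter. -/
structure Game {N : ℕ} (n : Fin N → ℕ) (m l : ℕ) where
  /-- local constraint sets -/
  W : ∀ i, Set (Dec (n i))
  /-- objective functions -/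
  f : Fin N → Joint n → ℝ
  /-- shared equality constraints (affine) -/
  H : Joint n →ᵃ[ℝ] EuclideanSpace ℝ (Fin m)
  /-- shared inequality constraints -/
  G : Joint n → EuclideanSpace ℝ (Fin l)

namespace Game

variable {N : ℕ} {n : Fin N → ℕ} {m l : ℕ} (g : Game n m l)

/-- `W = ∏ W_i`. -/
def prodW : Set (Joint n) := {w | ∀ i, w i ∈ g.W i}

/-- The overall feasible set `{w ∈ W : H(w) = 0, G(w) ≤ 0}`. -/
def feasible : Set (Joint n) := {w | w ∈ g.prodW ∧ g.H w = 0 ∧ ∀ j, g.G w j ≤ 0}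

/-- `D_i(w_{-i})`, the feasible set of agent `i` given the decisions of the others. -/
def feasibleAgent (i : Fin N) (w : Joint n) : Set (Dec (n i)) :=
  {v | v ∈ g.W i ∧ g.H (deviate w i v) = 0 ∧ ∀ j, g.G (deviate w i v) j ≤ 0}

/-- Nash equilibrium of the game. -/
def IsNE (w : Joint n) : Prop :=
  w ∈ g.prodW ∧ ∀ i, w i ∈ g.feasibleAgent i w ∧
    ∀ v ∈ g.feasibleAgent i w, g.f i w ≤ g.f i (deviate w i v)

/-- `gF` is the pseudo-gradient `(∇_{w_i} f_i)_i` on `W`. The gradient is taken within `W_i`,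
so that `f_i` need not be given outside `W`; it is the usual gradient at interior points, and it is
determined by `f_i` whenever `W_i` has nonempty interior. -/
def IsPseudoGradient (gF : Joint n → Joint n) : Prop :=
  ∀ w ∈ g.prodW, ∀ i,
    HasGradientWithinAt (fun v => g.f i (deviate w i v)) (gF w i) (g.W i) (w i)

/-- `gG j` is the gradient of `G_j` on `W` (taken within `W`). -/
def IsConstraintGradient (gG : Fin l → Joint n → Joint n) : Prop :=
  ∀ j, ∀ w ∈ g.prodW, HasGradientWithinAt (fun w' => g.G w' j) (gG j w) g.prodW w

/-- Solution of the variational inequality `GVI(Q, Φ)`. -/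
def SolvesGVI (Q : Set (Joint n)) (Φ : Joint n → Joint n) (w : Joint n) : Prop :=
  w ∈ Q ∧ ∀ w' ∈ Q, 0 ≤ inner ℝ (w' - w) (Φ w)

/-- Variational equilibrium: a Nash equilibrium that solves `GVI(feasible set, pseudo-gradient)`. -/
def IsVE (gF : Joint n → Joint n) (w : Joint n) : Prop :=
  g.IsNE w ∧ SolvesGVI g.feasible gF w

/-- Slater's condition. The Slater point has to lie in the relative interior of every local
constraint set that is not polyhedral. -/
def Slater : Prop :=
  ∃ w ∈ g.prodW, g.H w = 0 ∧ (∀ j, g.G w j < 0) ∧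
    ∀ i, IsPolyhedral (g.W i) ∨ w i ∈ intrinsicInterior ℝ (g.W i)

/-- The standing assumptions on the game: smoothness and convexity of the data, closed convex
local constraint sets, Slater's condition, and strict monotonicity of the pseudo-gradient on `W`. -/
structure Regular (gF : Joint n → Joint n) (gG : Fin l → Joint n → Joint n) : Prop where
  closed : ∀ i, IsClosed (g.W i)
  convex : ∀ i, Convex ℝ (g.W i)
  convex_f : ∀ i, ∀ w ∈ g.prodW, ConvexOn ℝ (g.W i) fun v => g.f i (deviate w i v)
  grad_f : g.IsPseudoGradient gF
  lip_f : LocallyLipschitzOn g.prodW gF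
  convex_G : ∀ j, ConvexOn ℝ g.prodW fun w => g.G w j
  grad_G : g.IsConstraintGradient gG
  lip_G : ∀ j, LocallyLipschitzOn g.prodW (gG j)
  slater : g.Slater
  strictMono : ∀ w ∈ g.prodW, ∀ w' ∈ g.prodW, w ≠ w' → 0 < inner ℝ (w - w') (gF w - gF w')

/-- `(∇_{w_i} L_i(w, λ, μ))_i` for the Lagrangians `L_i = f_i + λᵀ H + μᵀ G`. -/
def gradLagrangian (gF : Joint n → Joint n) (gG : Fin l → Joint n → Joint n)
    (w : Joint n) (lam : EuclideanSpace ℝ (Fin m)) (mu : EuclideanSpace ℝ (Fin l)) : Joint n :=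
  gF w + ∑ j, lam j • gradient (fun w' => g.H w' j) w + ∑ j, mu j • gG j w

/-- The nonnegative orthant. -/
def orthant (l : ℕ) : Set (EuclideanSpace ℝ (Fin l)) := {v | ∀ j, 0 ≤ v j}

/-- `(w̄, λ, μ)` solves on `[0, ∞)` the projected primal-dual dynamics
`ẇ_i = Π_{W_i}(w_i, -∇_{w_i} L_i)`, `λ̇ = H(w)`, `μ̇ = Π_{ℝ₊ˡ}(μ, G(w))`: it stays in
`W × ℝᵐ × ℝ₊ˡ`, is absolutely continuous on compact intervals, and satisfies the equations
almost everywhere. -/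
structure IsPrimalDualSolution (gF : Joint n → Joint n) (gG : Fin l → Joint n → Joint n)
    (w : ℝ → Joint n) (lam : ℝ → EuclideanSpace ℝ (Fin m))
    (mu : ℝ → EuclideanSpace ℝ (Fin l)) : Prop where
  mem_W : ∀ t, 0 ≤ t → w t ∈ g.prodW
  mem_orthant : ∀ t, 0 ≤ t → mu t ∈ orthant l
  ac_w : ∀ τ, 0 ≤ τ → AbsolutelyContinuousOnInterval w 0 τ
  ac_lam : ∀ τ, 0 ≤ τ → AbsolutelyContinuousOnInterval lam 0 τ
  ac_mu : ∀ τ, 0 ≤ τ → AbsolutelyContinuousOnInterval mu 0 τ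
  deriv_w : ∀ᵐ t ∂(volume.restrict (Ici (0 : ℝ))), ∀ i, ∃ d,
    HasDerivAt (fun s => w s i) d t ∧
      IsVectorProj (g.W i) (w t i) (-(g.gradLagrangian gF gG (w t) (lam t) (mu t) i)) d
  deriv_lam : ∀ᵐ t ∂(volume.restrict (Ici (0 : ℝ))), HasDerivAt lam (g.H (w t)) t
  deriv_mu : ∀ᵐ t ∂(volume.restrict (Ici (0 : ℝ))), ∃ d,
    HasDerivAt mu d t ∧ IsVectorProj (orthant l) (mu t) (g.G (w t)) d

end Game

/-! ### The linear physical system and the control law -/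

/-- `(A, B)` is controllable: every state can be steered to every other state in finite time by
a continuous input. -/
def Controllable {k : ℕ} (A : Matrix (Fin k) (Fin k) ℝ) (B : Fin k → ℝ) : Prop :=
  ∀ x₀ x₁ : Fin k → ℝ, ∃ τ > 0, ∃ (u : ℝ → ℝ) (x : ℝ → Fin k → ℝ),
    ContinuousOn u (Icc 0 τ) ∧ x 0 = x₀ ∧ x τ = x₁ ∧
    ∀ t ∈ Icc 0 τ, HasDerivWithinAt x (A *ᵥ x t + u t • B) (Icc 0 τ) t

/-- The matrix 1-norm (maximal absolute column sum). -/
def norm1 {p q : ℕ} (M : Matrix (Fin p) (Fin q) ℝ) : ℝ := ⨆ c, ∑ r, |M r c|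

/-- All eigenvalues have negative real part. -/
def IsHurwitz {k : ℕ} (M : Matrix (Fin k) (Fin k) ℝ) : Prop :=
  ∀ z ∈ spectrum ℂ (M.map (fun a => (a : ℂ))), z.re < 0

/-- The column `[0, …, 0, 1]ᵀ`. -/
def lastVec (k : ℕ) : Fin k → ℝ := fun r => if (r : ℕ) + 1 = k then 1 else 0

/-- The matrix with ones on the superdiagonal and zeros elsewhere. -/
def shiftMat (k : ℕ) : Matrix (Fin k) (Fin k) ℝ :=
  Matrix.of fun r c => if (c : ℕ) = (r : ℕ) + 1 then 1 else 0

/-- The controllable canonical form: ones on the superdiagonal, last row `-a`, zeros elsewhere. -/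
def companionMat {k : ℕ} (a : Fin k → ℝ) : Matrix (Fin k) (Fin k) ℝ :=
  Matrix.of fun r c =>
    if (r : ℕ) + 1 = k then -a c else if (c : ℕ) = (r : ℕ) + 1 then 1 else 0

/-- `S(ε) = diag(ε^{j-1})_{j=1}^k`. -/
def scaleS (k : ℕ) (ε : ℝ) : Matrix (Fin k) (Fin k) ℝ :=
  Matrix.diagonal fun j => ε ^ (j : ℕ)

/-- `S̄(ε) = diag(ε^{j-k})_{j=1}^k`. -/
def scaleSbar (k : ℕ) (ε : ℝ) : Matrix (Fin k) (Fin k) ℝ :=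
  Matrix.diagonal fun j => ε ^ (((j : ℕ) : ℤ) + 1 - (k : ℤ))

/-- The interconnected linear system `ẋ_i = ∑_j A_ij x_j + B_i u_i`. -/
structure LinSys {N : ℕ} (n : Fin N → ℕ) where
  A : ∀ i j, Matrix (Fin (n i)) (Fin (n j)) ℝ
  B : ∀ i, Fin (n i) → ℝ

/-- The design parameters of the control law. -/
structure Design {N : ℕ} (n : Fin N → ℕ) where
  T : ∀ i, Matrix (Fin (n i)) (Fin (n i)) ℝ
  a : ∀ i, Fin (n i) → ℝ
  K₀ : ∀ i, Fin (n i) → ℝ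
  P₀ : ∀ i, Matrix (Fin (n i)) (Fin (n i)) ℝ

section System

variable {N : ℕ} {n : Fin N → ℕ}

/-- The right-hand side `∑_j A_ij x_j + B_i u_i`. -/
def LinSys.rhs (sys : LinSys n) (x : ∀ i, Fin (n i) → ℝ) (u : Fin N → ℝ) (i : Fin N) :
    Fin (n i) → ℝ :=
  ∑ j, sys.A i j *ᵥ x j + u i • sys.B i

/-- `T_i` brings `(A_ii, B_i)` to controllable canonical form with coefficient row `a_i`,
`Â_ii + B̂_i K_{0i}` is Hurwitz, and `P_{0i}` is symmetric positive definite and solves the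
Lyapunov equation. -/
structure Design.Admissible (D : Design n) (sys : LinSys n) : Prop where
  nonsing : ∀ i, IsUnit (D.T i).det
  canon_A : ∀ i, D.T i * sys.A i i * (D.T i)⁻¹ = companionMat (D.a i)
  canon_B : ∀ i, D.T i *ᵥ sys.B i = lastVec (n i)
  hurwitz : ∀ i, IsHurwitz (shiftMat (n i) + Matrix.vecMulVec (lastVec (n i)) (D.K₀ i))
  posDef : ∀ i, (D.P₀ i).PosDef
  lyapunov : ∀ i,
    D.P₀ i * (shiftMat (n i) + Matrix.vecMulVec (lastVec (n i)) (D.K₀ i)) +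
      (shiftMat (n i) + Matrix.vecMulVec (lastVec (n i)) (D.K₀ i))ᵀ * D.P₀ i = -1

/-- `Â_ij = T_i A_ij T_j⁻¹` (used for `j ≠ i`). -/
def Design.coupling (D : Design n) (sys : LinSys n) (i j : Fin N) :
    Matrix (Fin (n i)) (Fin (n j)) ℝ :=
  D.T i * sys.A i j * (D.T j)⁻¹

/-- `‖S_i(ε) Â_ij S_j(ε)⁻¹‖₁ < σ_i` for all `j ≠ i` and all `0 < ε < 1`, with `σ_i > 0`. -/
def Design.CouplingBound (D : Design n) (sys : LinSys n) (σ : Fin N → ℝ) : Prop :=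
  (∀ i, 0 < σ i) ∧ ∀ i j, j ≠ i → ∀ ε : ℝ, 0 < ε → ε < 1 →
    norm1 (scaleS (n i) ε * D.coupling sys i j * (scaleS (n j) ε)⁻¹) < σ i

/-- The row `K_i(ε) = ε⁻¹ K_{0i} S̄_i(ε)`. -/
def Design.K (D : Design n) (ε : ℝ) (i : Fin N) : Fin (n i) → ℝ :=
  ε⁻¹ • (D.K₀ i ᵥ* scaleSbar (n i) ε)

/-- The tracking law `(K_i(ε) + a_i) T_i (x_i - x̄_i) + ū_i`, where `w̄_i = [x̄_iᵀ, ū_i]ᵀ`. -/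
def Design.control (D : Design n) (ε : ℝ) (i : Fin N) (x : Fin (n i) → ℝ) (wbar : Dec (n i)) : ℝ :=
  (D.K ε i + D.a i) ⬝ᵥ (D.T i *ᵥ (x - statePart wbar)) + inputPart wbar

/-- A run of the algorithm: the auxiliary variables follow the projected primal-dual dynamics, and
the physical system is driven by the tracking law. The state `x` is continuous on `[0, ∞)`; the
value `u 0` is free. -/
structure IsRun {m l : ℕ} (g : Game n m l) (gF : Joint n → Joint n)
    (gG : Fin l → Joint n → Joint n) (sys : LinSys n) (D : Design n) (ε : ℝ)
    (wbar : ℝ → Joint n) (lam : ℝ → EuclideanSpace ℝ (Fin m)) (mu : ℝ → EuclideanSpace ℝ (Fin l))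
    (x : ℝ → ∀ i, Fin (n i) → ℝ) (u : ℝ → Fin N → ℝ) : Prop where
  aux : g.IsPrimalDualSolution gF gG wbar lam mu
  cont : ContinuousOn x (Ici 0)
  dyn : ∀ t, 0 < t → ∀ i, HasDerivAt (fun s => x s i) (sys.rhs (x t) (u t) i) t
  law : ∀ t, 0 < t → ∀ i, u t i = D.control ε i (x t i) (wbar t i)

end System

end LinearVE

end

/-! The auxiliary dynamics do not depend on the physical state, so the closed loop is a cascade
whose two halves are treated separately.

Auxiliary half. Separation arguments yield multipliers (λ*, μ*), μ* ≥ 0, such that ∇F(w̃)ᵀ(w - w̃) +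
λ*ᵀH(w) + μ*ᵀG(w) ≥ 0 on W (`Game.Regular.exists_multipliers`). Put z = (w̃, λ*, μ*). In the pairing
of y - z with the primal-dual field the bilinear terms cancel up to sign, by convexity of G, and
what remains is at most -⟨w - w̃, ∇F(w) - ∇F(w̃)⟩ (`Game.Regular.inner_sub_pdField_le`). Projection
subtracts a vector normal to the constraint set, which preserves this estimate. Hence ‖y - z‖² never
increases. This has two uses. Solutions stay in a ball, so the field may be truncated to a bounded
Lipschitz one; a solution is then the limit of penalized differential equations
(`exists_sweeping_solution`, `exists_projected_solution`). And since ‖y - z‖² converges, the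
dissipation cannot keep recurring, so strict monotonicity forces w → w̃
(`tendsto_of_projected_solution`); nothing is claimed about the limit of the multipliers.

Physical half. In the coordinates S_i(ε)T_i(x_i - x̃_i) the local feedback becomes 1/ε times a fixed
stable matrix, the coupling stays below σ_i for all ε < 1, and the error of the reference signal is
a forcing term that tends to 0 (`Design.Admissible.scaled_rhs`). The threshold on 1/ε is what the
Lyapunov function Σ z_iᵀP_{0i}z_i needs to dominate the coupling (`lyapunov_deriv_le`).

Uniqueness of the equilibrium follows by adding the two variational inequalities. A design is
obtained from a Krylov matrix (canonical form) and from closed-loop eigenvalues -1, …, -k, for which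
the Lyapunov equation has an explicit solution. -/

namespace LinearVE

/-! ### Point projections and normal cones -/

section Projection

variable {E : Type*} [NormedAddCommGroup E] [InnerProductSpace ℝ E]

theorem exists_isPointProj [CompleteSpace E] {K : Set E} (hne : K.Nonempty) (hcl : IsClosed K)
    (hcv : Convex ℝ K) (x : E) : ∃ p, IsPointProj K x p := by
  obtain ⟨v, hv, hmin⟩ := exists_norm_eq_iInf_of_complete_convex hne hcl.isComplete hcv x
  refine ⟨v, hv, fun z hz => ?_⟩
  rw [norm_sub_rev v, norm_sub_rev z, hmin]
  exact ciInf_le ⟨0, by rintro _ ⟨y, rfl⟩; exact norm_nonneg _⟩ (⟨z, hz⟩ : K)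

theorem IsPointProj.inner_le_zero {K : Set E} (hcv : Convex ℝ K) {x p : E}
    (h : IsPointProj K x p) {z : E} (hz : z ∈ K) : inner ℝ (x - p) (z - p) ≤ 0 := by
  have : Nonempty K := ⟨⟨p, h.1⟩⟩
  refine (norm_eq_iInf_iff_real_inner_le_zero hcv h.1).1 (le_antisymm ?_ ?_) z hz
  · refine le_ciInf fun y => ?_
    rw [norm_sub_rev x, norm_sub_rev x]
    exact h.2 y y.2
  · exact ciInf_le ⟨0, by rintro _ ⟨y, rfl⟩; exact norm_nonneg _⟩ (⟨p, h.1⟩ : K)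

variable [CompleteSpace E] {K : Set E}

theorem isPointProj_pointProj (hne : K.Nonempty) (hcl : IsClosed K) (hcv : Convex ℝ K) (x : E) :
    IsPointProj K x (pointProj K x) := by
  have h := exists_isPointProj hne hcl hcv x
  rw [pointProj, dif_pos h]
  exact h.choose_spec

theorem pointProj_mem (hne : K.Nonempty) (hcl : IsClosed K) (hcv : Convex ℝ K) (x : E) :
    pointProj K x ∈ K :=
  (isPointProj_pointProj hne hcl hcv x).1

theorem inner_sub_pointProj_le_zero (hcl : IsClosed K) (hcv : Convex ℝ K) (x : E) {z : E}
    (hz : z ∈ K) : inner ℝ (x - pointProj K x) (z - pointProj K x) ≤ 0 :=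
  (isPointProj_pointProj ⟨z, hz⟩ hcl hcv x).inner_le_zero hcv hz

/-- Adding the variational inequalities of the two projections gives ‖p - q‖² ≤ ⟨x - y, p - q⟩. -/
theorem norm_pointProj_sub_le (hne : K.Nonempty) (hcl : IsClosed K) (hcv : Convex ℝ K) (x y : E) :
    ‖pointProj K x - pointProj K y‖ ≤ ‖x - y‖ := by
  have h1 := inner_sub_pointProj_le_zero hcl hcv x (pointProj_mem hne hcl hcv y)
  have h2 := inner_sub_pointProj_le_zero hcl hcv y (pointProj_mem hne hcl hcv x)
  set p := pointProj K x
  set q := pointProj K y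
  have h3 : inner ℝ (p - q) (p - q) ≤ inner ℝ (x - y) (p - q) := by
    have e1 : inner ℝ (x - p) (q - p) = - inner ℝ (x - p) (p - q) := by
      rw [← inner_neg_right, neg_sub]
    have e2 : (x - y) = (x - p) + (p - q) - (y - q) := by abel
    rw [e2, inner_sub_left (x - p + (p - q)), inner_add_left (x - p)]
    linarith
  rw [real_inner_self_eq_norm_sq] at h3
  have h4 := h3.trans (real_inner_le_norm _ _)
  by_contra hlt
  push Not at hlt
  nlinarith [norm_nonneg (x - y), norm_nonneg (p - q)]

theorem pointProj_eq_self (hcl : IsClosed K) (hcv : Convex ℝ K) {x : E}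
    (hx : x ∈ K) : pointProj K x = x := by
  have h := (isPointProj_pointProj ⟨x, hx⟩ hcl hcv x).2 x hx
  rw [sub_self, norm_zero] at h
  exact sub_eq_zero.1 (norm_le_zero_iff.1 h)

theorem tendsto_pointProj_add_smul (hcl : IsClosed K) (hcv : Convex ℝ K) {x : E} (hx : x ∈ K)
    (v : E) : Tendsto (fun δ : ℝ => pointProj K (x + δ • v)) (𝓝[>] 0) (𝓝 x) := by
  have hb : ∀ δ : ℝ, dist (pointProj K (x + δ • v)) x ≤ |δ| * ‖v‖ := fun δ => by
    have := norm_pointProj_sub_le ⟨x, hx⟩ hcl hcv (x + δ • v) x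
    rw [pointProj_eq_self hcl hcv hx] at this
    rw [dist_eq_norm]
    simpa [norm_smul] using this
  have h0 : Tendsto (fun δ : ℝ => |δ| * ‖v‖) (𝓝[>] 0) (𝓝 0) := by
    have : Continuous fun δ : ℝ => |δ| * ‖v‖ := by fun_prop
    simpa using (this.tendsto 0).mono_left nhdsWithin_le_nhds
  exact tendsto_iff_dist_tendsto_zero.2 (squeeze_zero (fun _ => dist_nonneg) hb h0)

/-- The residual of a vector projection is normal to the set. -/
theorem IsVectorProj.inner_le_zero (hcl : IsClosed K) (hcv : Convex ℝ K) {x v d : E} (hx : x ∈ K)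
    (h : IsVectorProj K x v d) {z : E} (hz : z ∈ K) : inner ℝ (v - d) (z - x) ≤ 0 := by
  have hlim : Tendsto (fun δ : ℝ => inner ℝ (v - δ⁻¹ • (pointProj K (x + δ • v) - x))
      (z - pointProj K (x + δ • v))) (𝓝[>] 0) (𝓝 (inner ℝ (v - d) (z - x))) :=
    (tendsto_const_nhds.sub h).inner
      (tendsto_const_nhds.sub (tendsto_pointProj_add_smul hcl hcv hx v))
  refine le_of_tendsto hlim ?_
  filter_upwards [self_mem_nhdsWithin] with δ hδ
  have hδ : 0 < δ := hδ
  have := inner_sub_pointProj_le_zero hcl hcv (x + δ • v) hz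
  have e : v - δ⁻¹ • (pointProj K (x + δ • v) - x)
      = δ⁻¹ • (x + δ • v - pointProj K (x + δ • v)) := by
    rw [smul_sub, smul_sub, smul_add, inv_smul_smul₀ hδ.ne']
    abel
  rw [e, real_inner_smul_left]
  exact mul_nonpos_of_nonneg_of_nonpos (by positivity) this

/-- Vector projection does not increase the norm. -/
theorem IsVectorProj.norm_le (hcl : IsClosed K) (hcv : Convex ℝ K) {x v d : E} (hx : x ∈ K)
    (h : IsVectorProj K x v d) : ‖d‖ ≤ ‖v‖ := by
  refine le_of_tendsto h.norm ?_
  filter_upwards [self_mem_nhdsWithin] with δ hδ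
  have hδ : 0 < δ := hδ
  have := norm_pointProj_sub_le ⟨x, hx⟩ hcl hcv (x + δ • v) x
  rw [pointProj_eq_self hcl hcv hx] at this
  rw [norm_smul, norm_inv, Real.norm_of_nonneg hδ.le, inv_mul_le_iff₀ hδ]
  simpa [norm_smul, abs_of_pos hδ] using this

/-- A curve in `K` whose velocity differs from `v` by a normal vector moves with the vector
projection of `v`. -/
theorem isVectorProj_of_hasDerivAt (hcl : IsClosed K) (hcv : Convex ℝ K) {y : ℝ → E} {t : ℝ}
    {v d : E} (hy : ∀ᶠ s in 𝓝 t, y s ∈ K) (hd : HasDerivAt y d t)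
    (hn : ∀ z ∈ K, inner ℝ (v - d) (z - y t) ≤ 0) : IsVectorProj K (y t) v d := by
  have hyt : y t ∈ K := hy.self_of_nhds
  -- two-sided tangency gives orthogonality
  have hslope := hd.tendsto_slope_zero
  have horth : 0 ≤ inner ℝ (v - d) d := by
    have hl : Tendsto (fun s : ℝ => inner ℝ (v - d) (s⁻¹ • (y (t + s) - y t))) (𝓝[<] 0)
        (𝓝 (inner ℝ (v - d) d)) :=
      tendsto_const_nhds.inner (hslope.mono_left (nhdsWithin_mono _ fun s hs => (ne_of_lt hs)))
    refine ge_of_tendsto hl ?_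
    have h1 : Tendsto (fun s : ℝ => t + s) (𝓝[<] 0) (𝓝 t) := by
      have : Continuous fun s : ℝ => t + s := by fun_prop
      simpa using (this.tendsto 0).mono_left nhdsWithin_le_nhds
    filter_upwards [self_mem_nhdsWithin, h1.eventually hy] with s hs hys
    have hs : s < 0 := hs
    rw [real_inner_smul_right]
    exact mul_nonneg_of_nonpos_of_nonpos (inv_nonpos.2 hs.le) (hn _ hys)
  have h1 : Tendsto (fun s : ℝ => t + s) (𝓝[>] 0) (𝓝 t) := by
    have : Continuous fun s : ℝ => t + s := by fun_prop
    simpa using (this.tendsto 0).mono_left nhdsWithin_le_nhds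
  have hsl : Tendsto (fun s : ℝ => s⁻¹ • (y (t + s) - y t)) (𝓝[>] 0) (𝓝 d) :=
    hslope.mono_left (nhdsWithin_mono _ fun s hs => (ne_of_gt hs))
  -- the difference quotients of the projections differ from those of the curve by `o(1)`
  rw [IsVectorProj, tendsto_iff_norm_sub_tendsto_zero]
  have hq : Tendsto (fun s : ℝ => ‖s⁻¹ • (y (t + s) - y t) - d‖) (𝓝[>] 0) (𝓝 0) :=
    tendsto_iff_norm_sub_tendsto_zero.1 hsl
  -- With q and r the errors of the two quotients, normality gives ⟨v - d, r⟩ ≤ 0, and the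
  -- projection inequality becomes ‖r‖² ≤ ⟨r, q⟩ + ⟨v - d, r⟩ - ⟨v - d, q⟩. Young's inequality on
  -- ⟨r, q⟩ then bounds ‖r‖ by this square root.
  have hsq : Tendsto (fun s : ℝ => √(‖s⁻¹ • (y (t + s) - y t) - d‖ ^ 2 +
      2 * ‖v - d‖ * ‖s⁻¹ • (y (t + s) - y t) - d‖)) (𝓝[>] 0) (𝓝 0) := by
    have hc : Continuous fun r : ℝ => √(r ^ 2 + 2 * ‖v - d‖ * r) := by fun_prop
    have := (hc.tendsto 0).comp hq
    simpa [Function.comp_def] using this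
  refine squeeze_zero' (Eventually.of_forall fun _ => norm_nonneg _) ?_ hsq
  filter_upwards [self_mem_nhdsWithin, h1.eventually hy] with δ hδ hys
  have hδ : 0 < δ := hδ
  have hvi := inner_sub_pointProj_le_zero hcl hcv (y t + δ • v) hys
  have hnp := hn _ (pointProj_mem ⟨_, hyt⟩ hcl hcv (y t + δ • v))
  set p := pointProj K (y t + δ • v)
  set q := δ⁻¹ • (y (t + δ) - y t) - d with hqdef
  set r := δ⁻¹ • (p - y t) - d with hrdef
  have ep : p - y t = δ • (r + d) := by
    rw [hrdef, sub_add_cancel, smul_inv_smul₀ hδ.ne']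
  have eq : y (t + δ) - p = δ • (q - r) := by
    rw [hqdef, hrdef, sub_sub_sub_cancel_right, ← smul_sub, smul_inv_smul₀ hδ.ne']
    abel
  have ex : y t + δ • v - p = δ • ((v - d) - r) := by
    have : y t + δ • v - p = δ • v - (p - y t) := by abel
    rw [this, ep, ← smul_sub]
    congr 1
    abel
  rw [eq, ex, real_inner_smul_left, real_inner_smul_right] at hvi
  rw [ep, real_inner_smul_right, inner_add_right] at hnp
  have h2 : inner ℝ ((v - d) - r) (q - r) ≤ 0 := by
    by_contra hc
    push Not at hc
    have : 0 < δ * (δ * inner ℝ ((v - d) - r) (q - r)) := by positivity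
    linarith
  have h3 : inner ℝ (v - d) r ≤ 0 := by
    by_contra hc
    push Not at hc
    have : 0 < δ * (inner ℝ (v - d) r + inner ℝ (v - d) d) := by positivity
    linarith
  have hexp : ∀ a b c : E, inner ℝ (a - b) (c - b)
      = inner ℝ a c - inner ℝ a b - inner ℝ b c + ‖b‖ ^ 2 := fun a b c => by
    rw [inner_sub_left, inner_sub_right, inner_sub_right, real_inner_self_eq_norm_sq]
    ring
  rw [hexp] at h2
  have h4 : |inner ℝ (v - d) q| ≤ ‖v - d‖ * ‖q‖ := abs_real_inner_le_norm _ _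
  have h5 : |inner ℝ r q| ≤ ‖r‖ * ‖q‖ := abs_real_inner_le_norm _ _
  refine Real.le_sqrt_of_sq_le ?_
  have h6 := (abs_le.1 h4).1
  have h7 := (abs_le.1 h5).2
  nlinarith [sq_nonneg (‖r‖ - ‖q‖)]

end Projection


/-! ### Global solutions of Lipschitz differential equations -/

section GlobalODE

open scoped NNReal BoundedContinuousFunction

variable {E : Type*} [NormedAddCommGroup E] [NormedSpace ℝ E]

/-- Integration gains a factor 1/c in the norm weighted by e^{-ct}; this is what makes the Picard
map a contraction on the whole half-line. -/
theorem exp_neg_mul_norm_integral_le {h : ℝ → E} {B c t : ℝ} (hc : 0 < c) (hB : 0 ≤ B)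
    (ht : 0 ≤ t) (hh : ∀ s ∈ Icc 0 t, ‖h s‖ ≤ B * Real.exp (c * s)) :
    Real.exp (-(c * t)) * ‖∫ s in (0 : ℝ)..t, h s‖ ≤ B / c := by
  have h1 : ‖∫ s in (0 : ℝ)..t, h s‖ ≤ ∫ s in (0 : ℝ)..t, B * Real.exp (c * s) := by
    refine intervalIntegral.norm_integral_le_of_norm_le ht (ae_of_all _ fun s hs => ?_)
      (Continuous.intervalIntegrable (by fun_prop) _ _)
    exact hh s ⟨hs.1.le, hs.2⟩
  have h2 : ∫ s in (0 : ℝ)..t, B * Real.exp (c * s)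
      = B / c * Real.exp (c * t) - B / c * Real.exp (c * 0) := by
    refine intervalIntegral.integral_eq_sub_of_hasDerivAt (f := fun s => B / c * Real.exp (c * s))
      (fun s _ => ?_) (Continuous.intervalIntegrable (by fun_prop) _ _)
    have := (((hasDerivAt_id s).const_mul c).exp).const_mul (B / c)
    refine this.congr_deriv ?_
    simp only [id, mul_one]
    field_simp
  rw [h2] at h1
  have hpos : 0 ≤ B / c := by positivity
  have h3 : ‖∫ s in (0 : ℝ)..t, h s‖ ≤ B / c * Real.exp (c * t) := by
    have : 0 ≤ B / c * Real.exp (c * 0) := by positivity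
    linarith
  calc Real.exp (-(c * t)) * ‖∫ s in (0 : ℝ)..t, h s‖
      ≤ Real.exp (-(c * t)) * (B / c * Real.exp (c * t)) := by gcongr
    _ = B / c := by
      rw [mul_left_comm, ← Real.exp_add]
      simp

/-- A globally Lipschitz autonomous differential equation has a solution on `[0, ∞)` from every
initial value. -/
theorem exists_hasDerivAt_of_lipschitzWith [CompleteSpace E] {g : E → E} {K : ℝ≥0}
    (hg : LipschitzWith K g) (x₀ : E) :
    ∃ y : ℝ → E, y 0 = x₀ ∧ ∀ t, 0 ≤ t → HasDerivAt y (g (y t)) t := by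
  -- The unknown is z with y(t) = x₀ + e^{ct} z(t), z bounded. The Picard map then has Lipschitz
  -- constant K / c ≤ 1/2; the summand 1 keeps c positive when K = 0.
  set c : ℝ := 2 * K + 1 with hcdef
  have hc : 0 < c := by positivity
  have hgc : Continuous g := hg.continuous
  have hcg : ∀ z : ℝ →ᵇ E, Continuous fun s : ℝ => g (x₀ + Real.exp (c * s) • z s) := fun z => by
    have := z.continuous
    fun_prop
  -- `max t 0` freezes the map at negative times, so that it acts on bounded continuous functions on
  -- all of ℝ.
  have hcont : ∀ z : ℝ →ᵇ E, Continuous fun t : ℝ => Real.exp (-(c * max t 0)) •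
      ∫ s in (0 : ℝ)..(max t 0), g (x₀ + Real.exp (c * s) • z s) := fun z => by
    have h1 : Continuous fun t : ℝ => ∫ s in (0 : ℝ)..t, g (x₀ + Real.exp (c * s) • z s) :=
      intervalIntegral.continuous_primitive (fun a b => (hcg z).intervalIntegrable a b) 0
    have h2 : Continuous fun t : ℝ => max t (0 : ℝ) := by fun_prop
    exact (by fun_prop : Continuous fun t : ℝ => Real.exp (-(c * max t 0))).smul (h1.comp h2)
  have hbd : ∀ z : ℝ →ᵇ E, ∀ t : ℝ, ‖Real.exp (-(c * max t 0)) •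
      ∫ s in (0 : ℝ)..(max t 0), g (x₀ + Real.exp (c * s) • z s)‖ ≤ (‖g x₀‖ + K * ‖z‖) / c :=
    fun z t => by
      rw [norm_smul, Real.norm_of_nonneg (Real.exp_pos _).le]
      refine exp_neg_mul_norm_integral_le hc (by positivity) (le_max_right _ _) fun s hs => ?_
      have h1 : ‖g (x₀ + Real.exp (c * s) • z s) - g x₀‖ ≤ K * (Real.exp (c * s) * ‖z‖) := by
        refine (hg.norm_sub_le _ _).trans ?_
        rw [add_sub_cancel_left, norm_smul, Real.norm_of_nonneg (Real.exp_pos _).le]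
        gcongr
        exact z.norm_coe_le_norm s
      have h2 : ‖g x₀‖ ≤ ‖g x₀‖ * Real.exp (c * s) :=
        le_mul_of_one_le_right (norm_nonneg _) (Real.one_le_exp (mul_nonneg hc.le hs.1))
      have h3 := norm_le_insert' (g (x₀ + Real.exp (c * s) • z s)) (g x₀)
      nlinarith
  let Γ : (ℝ →ᵇ E) → (ℝ →ᵇ E) := fun z =>
    BoundedContinuousFunction.ofNormedAddCommGroup _ (hcont z) _ (hbd z)
  have hΓ : ∀ z t, Γ z t = Real.exp (-(c * max t 0)) •
      ∫ s in (0 : ℝ)..(max t 0), g (x₀ + Real.exp (c * s) • z s) := fun z t => rfl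
  have hcontr : ContractingWith (1 / 2 : ℝ≥0) Γ := by
    refine ⟨by rw [← NNReal.coe_lt_coe]; norm_num, LipschitzWith.of_dist_le_mul fun z₁ z₂ => ?_⟩
    rw [BoundedContinuousFunction.dist_le (by positivity)]
    intro t
    rw [dist_eq_norm, hΓ, hΓ, ← smul_sub, ← intervalIntegral.integral_sub
      ((hcg z₁).intervalIntegrable _ _) ((hcg z₂).intervalIntegrable _ _), norm_smul,
      Real.norm_of_nonneg (Real.exp_pos _).le]
    refine (exp_neg_mul_norm_integral_le (B := K * dist z₁ z₂) hc (by positivity)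
      (le_max_right _ _) fun s hs => ?_).trans ?_
    · refine (hg.norm_sub_le _ _).trans ?_
      rw [add_sub_add_left_eq_sub, ← smul_sub, norm_smul, Real.norm_of_nonneg (Real.exp_pos _).le,
        mul_assoc, mul_comm (dist z₁ z₂)]
      gcongr
      rw [← dist_eq_norm]
      exact z₁.dist_coe_le_dist s
    · rw [div_le_iff₀ hc]
      have : (0 : ℝ) ≤ dist z₁ z₂ := dist_nonneg
      have : (0 : ℝ) ≤ K := K.2
      rw [hcdef]
      push_cast
      nlinarith
  set z := ContractingWith.fixedPoint Γ hcontr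
  have hz : Γ z = z := hcontr.fixedPoint_isFixedPt
  refine ⟨fun t => x₀ + ∫ s in (0 : ℝ)..t, g (x₀ + Real.exp (c * s) • z s), by simp,
    fun t ht => ?_⟩
  have hzt : x₀ + Real.exp (c * t) • z t
      = x₀ + ∫ s in (0 : ℝ)..t, g (x₀ + Real.exp (c * s) • z s) := by
    conv_lhs => rw [← hz, hΓ, max_eq_left ht, smul_smul, ← Real.exp_add]
    simp
  show HasDerivAt _ (g (x₀ + ∫ s in (0 : ℝ)..t, g (x₀ + Real.exp (c * s) • z s))) t
  rw [← hzt]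
  exact ((hcg z).integral_hasStrictDerivAt 0 t).hasDerivAt.const_add x₀

end GlobalODE

/-- Grönwall: (φ + b/a) e^{-a(r-s)} is nonincreasing. The sign of a is free; a < 0 gives decay
estimates, a > 0 growth estimates. -/
theorem add_div_le_exp_mul_of_deriv_le {φ φ' : ℝ → ℝ} {a b s t : ℝ} (ha : a ≠ 0) (hst : s ≤ t)
    (hc : ContinuousOn φ (Icc s t)) (hd : ∀ r ∈ Ioo s t, HasDerivAt φ (φ' r) r)
    (hle : ∀ r ∈ Ioo s t, φ' r ≤ a * φ r + b) :
    φ t + b / a ≤ Real.exp (a * (t - s)) * (φ s + b / a) := by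
  have hder : ∀ r ∈ Ioo s t, HasDerivAt (fun r => (φ r + b / a) * Real.exp (-a * (r - s)))
      ((φ' r - (a * φ r + b)) * Real.exp (-a * (r - s))) r := fun r hr => by
    have h1 : HasDerivAt (fun r => Real.exp (-a * (r - s)))
        (Real.exp (-a * (r - s)) * (-a * 1)) r :=
      (((hasDerivAt_id r).sub_const s).const_mul (-a)).exp
    refine (((hd r hr).add_const (b / a)).mul h1).congr_deriv ?_
    field_simp
    ring
  have hanti : AntitoneOn (fun r => (φ r + b / a) * Real.exp (-a * (r - s))) (Icc s t) := by
    refine antitoneOn_of_deriv_nonpos (convex_Icc s t) ?_ ?_ ?_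
    · exact (hc.add continuousOn_const).mul (by fun_prop)
    · rw [interior_Icc]
      exact fun r hr => (hder r hr).differentiableAt.differentiableWithinAt
    · rw [interior_Icc]
      intro r hr
      rw [(hder r hr).deriv]
      exact mul_nonpos_of_nonpos_of_nonneg (by linarith [hle r hr]) (Real.exp_pos _).le
  have h := hanti (left_mem_Icc.2 hst) (right_mem_Icc.2 hst) hst
  simp only [sub_self, mul_zero, Real.exp_zero, mul_one] at h
  calc φ t + b / a = Real.exp (a * (t - s)) * ((φ t + b / a) * Real.exp (-a * (t - s))) := by
        rw [mul_left_comm, ← Real.exp_add]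
        simp
    _ ≤ _ := by gcongr


/-! ### Projected dynamics: existence by penalization -/

section Penalization

open scoped NNReal

variable {E : Type*} [NormedAddCommGroup E] [InnerProductSpace ℝ E] [CompleteSpace E] {K : Set E}

/-- The squared distance is differentiable even where the projection is not: testing the minimality
at x and at x + h with the projection of the other point bounds the remainder by a multiple of ‖h‖²
from both sides. -/
theorem hasDerivAt_norm_sub_pointProj_sq (hne : K.Nonempty) (hcl : IsClosed K) (hcv : Convex ℝ K)
    {y : ℝ → E} {y' : E} {t : ℝ} (hy : HasDerivAt y y' t) :
    HasDerivAt (fun s => ‖y s - pointProj K (y s)‖ ^ 2)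
      (2 * inner ℝ (y t - pointProj K (y t)) y') t := by
  have hF : HasFDerivAt (fun x => ‖x - pointProj K x‖ ^ 2)
      ((2 : ℝ) • innerSL ℝ (y t - pointProj K (y t))) (y t) := by
    rw [hasFDerivAt_iff_isLittleO_nhds_zero]
    refine Asymptotics.IsBigO.trans_isLittleO (g := fun h : E => ‖h‖ ^ 2) ?_ ?_
    · refine Asymptotics.IsBigO.of_bound 5 (Eventually.of_forall fun h => ?_)
      set x := y t
      have hexp : ∀ a b : E, ‖a + b‖ ^ 2 = ‖a‖ ^ 2 + 2 * inner ℝ a b + ‖b‖ ^ 2 :=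
        fun a b => norm_add_sq_real a b
      have hmin1 := (isPointProj_pointProj hne hcl hcv (x + h)).2 _ (pointProj_mem hne hcl hcv x)
      have hmin2 := (isPointProj_pointProj hne hcl hcv x).2 _ (pointProj_mem hne hcl hcv (x + h))
      have hlip := norm_pointProj_sub_le hne hcl hcv (x + h) x
      rw [add_sub_cancel_left] at hlip
      set p := pointProj K x
      set q := pointProj K (x + h)
      have e1 : ‖p - (x + h)‖ ^ 2 = ‖x - p‖ ^ 2 + 2 * inner ℝ (x - p) h + ‖h‖ ^ 2 := by
        rw [norm_sub_rev, ← hexp]; congr 2; abel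
      have e2 : ‖q - x‖ ^ 2 = ‖x + h - q‖ ^ 2 + 2 * inner ℝ (x + h - q) (-h) + ‖h‖ ^ 2 := by
        rw [norm_sub_rev, ← norm_neg h, ← hexp]; congr 2; abel
      have m1 : ‖x + h - q‖ ^ 2 ≤ ‖p - (x + h)‖ ^ 2 := by
        rw [norm_sub_rev (x + h)]; gcongr
      have m2 : ‖x - p‖ ^ 2 ≤ ‖q - x‖ ^ 2 := by
        rw [norm_sub_rev x]; gcongr
      have e3 : inner ℝ (x + h - q) (-h) = -inner ℝ (x - p) h - ‖h‖ ^ 2 + inner ℝ (q - p) h := by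
        have : x + h - q = (x - p) + h - (q - p) := by abel
        rw [this, inner_neg_right, inner_sub_left, inner_add_left, real_inner_self_eq_norm_sq]
        ring
      have e4 : |inner ℝ (q - p) h| ≤ ‖h‖ ^ 2 := by
        refine (abs_real_inner_le_norm _ _).trans ?_
        rw [sq]; gcongr
      have e5 := (abs_le.1 e4)
      simp only [_root_.smul_apply, innerSL_apply_apply, smul_eq_mul,
        Real.norm_eq_abs, abs_pow, abs_norm]
      rw [abs_le]
      constructor <;> nlinarith [sq_nonneg ‖h‖]
    · have := (Asymptotics.isLittleO_norm_pow_id (E' := E) (n := 2) (by norm_num))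
      simpa using this
  exact hF.comp_hasDerivAt t hy

/-- The sweeping process `y' ∈ F y - N_K(y)` for a bounded Lipschitz field `F`: existence of a
Lipschitz solution. -/
theorem exists_sweeping_solution (hcl : IsClosed K) (hcv : Convex ℝ K) {F : E → E} {L : ℝ≥0}
    (hF : LipschitzWith L F) {M : ℝ} (hM : ∀ x, ‖F x‖ ≤ M) {y₀ : E} (hy₀ : y₀ ∈ K) :
    ∃ y : ℝ → E, y 0 = y₀ ∧ (∀ t, 0 ≤ t → y t ∈ K) ∧
      (∀ s t, 0 ≤ s → 0 ≤ t → ‖y t - y s‖ ≤ 2 * M * |t - s|) ∧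
      ∀ t, 0 < t → ∀ d, HasDerivAt y d t → ∀ z ∈ K, inner ℝ (F (y t) - d) (z - y t) ≤ 0 := by
  have hne : K.Nonempty := ⟨y₀, hy₀⟩
  have hM0 : 0 ≤ M := (norm_nonneg _).trans (hM y₀)
  set P : E → E := pointProj K with hPdef
  have hPl : LipschitzWith 1 P := LipschitzWith.of_dist_le_mul fun x y => by
    simpa [dist_eq_norm] using norm_pointProj_sub_le hne hcl hcv x y
  -- solutions of the penalized equations
  have hsol : ∀ k : ℕ, ∃ y : ℝ → E, y 0 = y₀ ∧ ∀ t, 0 ≤ t →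
      HasDerivAt y (F (y t) - ((k : ℝ) + 1) • (y t - P (y t))) t := fun k => by
    have : LipschitzWith (L + ‖(k : ℝ) + 1‖₊ * (1 + 1))
        (fun x => F x - ((k : ℝ) + 1) • (x - P x)) :=
      hF.sub ((lipschitzWith_smul ((k : ℝ) + 1)).comp (LipschitzWith.id.sub hPl))
    exact exists_hasDerivAt_of_lipschitzWith this y₀
  choose Y hY0 hY using hsol
  -- the penalty term is bounded by `M`
  have hpen : ∀ (k : ℕ) t, 0 ≤ t → ‖Y k t - P (Y k t)‖ ≤ M / (k + 1) := fun k t ht => by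
    have hk : (0 : ℝ) < k + 1 := by positivity
    have hder : ∀ r : ℝ, 0 ≤ r → _ := fun r hr =>
      hasDerivAt_norm_sub_pointProj_sq hne hcl hcv (hY k r hr)
    -- By Young's inequality the squared distance δ² to K satisfies (δ²)' ≤ -(k+1)δ² + M²/(k+1), and
    -- it starts at 0.
    have h := add_div_le_exp_mul_of_deriv_le (φ := fun s => ‖Y k s - P (Y k s)‖ ^ 2)
      (φ' := fun r => 2 * inner ℝ (Y k r - P (Y k r))
        (F (Y k r) - ((k : ℝ) + 1) • (Y k r - P (Y k r)))) (a := -((k : ℝ) + 1)) (b := M ^ 2 / (k + 1))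
      (neg_ne_zero.2 hk.ne' : -((k : ℝ) + 1) ≠ 0) ht
      (fun r hr => (hder r hr.1).continuousAt.continuousWithinAt) (fun r hr => hder r hr.1.le)
      (fun r hr => by
        rw [inner_sub_right, real_inner_smul_right, real_inner_self_eq_norm_sq]
        have h1 := (real_inner_le_norm (Y k r - P (Y k r)) (F (Y k r))).trans
          (mul_le_mul_of_nonneg_left (hM (Y k r)) (norm_nonneg _))
        set δ := ‖Y k r - P (Y k r)‖
        have h2 : 2 * (δ * M) ≤ (k + 1) * δ ^ 2 + M ^ 2 / (k + 1) := by
          have h3 : (k + 1) * δ ^ 2 + M ^ 2 / (k + 1) - 2 * (δ * M)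
              = ((k + 1) * δ - M) ^ 2 / (k + 1) := by
            field_simp
            ring
          have : 0 ≤ ((k + 1) * δ - M) ^ 2 / ((k : ℝ) + 1) := by positivity
          linarith
        linarith)
    rw [hY0, hPdef, pointProj_eq_self hcl hcv hy₀, sub_self, norm_zero, ← hPdef] at h
    have hb : M ^ 2 / ((k : ℝ) + 1) / -((k : ℝ) + 1) = -(M / (k + 1)) ^ 2 := by
      field_simp
    rw [hb] at h
    have h2 : 0 ≤ Real.exp (-((k : ℝ) + 1) * (t - 0)) * (M / (k + 1)) ^ 2 := by positivity
    refine le_of_pow_le_pow_left₀ two_ne_zero (by positivity) ?_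
    simp only [ne_eq, OfNat.ofNat_ne_zero, not_false_eq_true, zero_pow, zero_add] at h
    linarith
  have hnorm : ∀ (k : ℕ) t, 0 ≤ t → ‖((k : ℝ) + 1) • (Y k t - P (Y k t))‖ ≤ M := fun k t ht => by
    have hk : (0 : ℝ) < k + 1 := by positivity
    rw [norm_smul, Real.norm_of_nonneg hk.le]
    calc ((k : ℝ) + 1) * ‖Y k t - P (Y k t)‖ ≤ (k + 1) * (M / (k + 1)) := by
          gcongr
          exact hpen k t ht
      _ = M := by field_simp
  have hlip : ∀ (k : ℕ) s t, 0 ≤ s → 0 ≤ t → ‖Y k t - Y k s‖ ≤ 2 * M * |t - s| :=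
    fun k s t hs ht => by
      refine Convex.norm_image_sub_le_of_norm_hasDerivWithin_le (s := Ici (0 : ℝ))
        (fun r hr => (hY k r hr).hasDerivWithinAt) (fun r hr => ?_) (convex_Ici 0) hs ht
      refine (norm_sub_le _ _).trans ?_
      linarith [hM (Y k r), hnorm k r hr]
  -- the penalized solutions form a locally uniform Cauchy sequence
  set a : ℝ := 2 * L + 1 with hadef
  have ha : 0 < a := by positivity
  set B : ℝ → ℝ := fun t => 4 * M ^ 2 / a * Real.exp (a * t) with hBdef
  have hBpos : ∀ t, 0 ≤ B t := fun t => by positivity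
  have hcauchy : ∀ (k j : ℕ) t, 0 ≤ t →
      ‖Y k t - Y j t‖ ^ 2 ≤ B t * (1 / ((k : ℝ) + 1) + 1 / ((j : ℝ) + 1)) := fun k j t ht => by
    set η : ℝ := 1 / ((k : ℝ) + 1) + 1 / ((j : ℝ) + 1) with hη
    have hη0 : 0 ≤ η := by positivity
    have hder : ∀ r : ℝ, 0 ≤ r → _ := fun r hr => ((hY k r hr).sub (hY j r hr)).norm_sq
    -- The rate 2L would do for the estimate; a = 2L + 1 also allows division by a when L = 0.
    have h := add_div_le_exp_mul_of_deriv_le (φ := fun s => ‖(Y k - Y j) s‖ ^ 2)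
      (φ' := fun r => 2 * inner ℝ (Y k r - Y j r)
        (F (Y k r) - ((k : ℝ) + 1) • (Y k r - P (Y k r)) -
          (F (Y j r) - ((j : ℝ) + 1) • (Y j r - P (Y j r))))) (a := a) (b := 4 * M ^ 2 * η) ha.ne' ht
      (fun r hr => (hder r hr.1).continuousAt.continuousWithinAt) (fun r hr => hder r hr.1.le)
      (fun r hr => by
        have hr0 := hr.1.le
        simp only [Pi.sub_apply]
        have hFb : inner ℝ (Y k r - Y j r) (F (Y k r) - F (Y j r))
            ≤ L * ‖Y k r - Y j r‖ ^ 2 := by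
          refine (real_inner_le_norm _ _).trans ?_
          have := hF.norm_sub_le (Y k r) (Y j r)
          have h0 := norm_nonneg (Y k r - Y j r)
          nlinarith
        have hk : (0 : ℝ) < k + 1 := by positivity
        have hj : (0 : ℝ) < j + 1 := by positivity
        have n1 := hnorm k r hr0
        have n2 := hnorm j r hr0
        have p1 := hpen k r hr0
        have p2 := hpen j r hr0
        have v1 := inner_sub_pointProj_le_zero hcl hcv (Y k r) (pointProj_mem hne hcl hcv (Y j r))
        have v2 := inner_sub_pointProj_le_zero hcl hcv (Y j r) (pointProj_mem hne hcl hcv (Y k r))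
        rw [← hPdef] at v1 v2
        set p := P (Y k r)
        set q := P (Y j r)
        set x := Y k r
        set y := Y j r
        set nk := ((k : ℝ) + 1) • (x - p) with hnk
        set nj := ((j : ℝ) + 1) • (y - q) with hnj
        -- The penalties nk, nj do not become small, only bounded. They are normal to K at p and q,
        -- so they act monotonically on p - q; the rest of x - y is of size M(1/(k+1) + 1/(j+1)).
        have w1 : 0 ≤ inner ℝ (p - q) nk := by
          rw [hnk, real_inner_smul_right, real_inner_comm, ← neg_sub q p, inner_neg_right]
          exact mul_nonneg hk.le (by linarith)
        have w2 : inner ℝ (p - q) nj ≤ 0 := by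
          rw [hnj, real_inner_smul_right, real_inner_comm]
          exact mul_nonpos_of_nonneg_of_nonpos hj.le v2
        have w3 : -(2 * M ^ 2 * η) ≤ inner ℝ ((x - p) - (y - q)) (nk - nj) := by
          have := abs_real_inner_le_norm ((x - p) - (y - q)) (nk - nj)
          have b1 : ‖(x - p) - (y - q)‖ ≤ M * η := by
            refine (norm_sub_le _ _).trans ((add_le_add p1 p2).trans (le_of_eq ?_))
            rw [hη]; ring
          have b2 : ‖nk - nj‖ ≤ 2 * M := (norm_sub_le _ _).trans (by linarith)
          have b3 : ‖(x - p) - (y - q)‖ * ‖nk - nj‖ ≤ (M * η) * (2 * M) := by gcongr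
          have := (abs_le.1 this).1
          nlinarith
        have hsplit : inner ℝ (x - y) (F x - nk - (F y - nj)) = inner ℝ (x - y) (F x - F y)
            - inner ℝ (p - q) nk + inner ℝ (p - q) nj
            - inner ℝ ((x - p) - (y - q)) (nk - nj) := by
          have e1 : F x - nk - (F y - nj) = (F x - F y) - (nk - nj) := by abel
          have e2 : inner ℝ (x - y) (nk - nj)
              = inner ℝ (p - q) (nk - nj) + inner ℝ ((x - p) - (y - q)) (nk - nj) := by
            rw [← inner_add_left]; congr 1; abel
          rw [e1, inner_sub_right, e2, inner_sub_right (p - q)]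
          ring
        rw [hsplit, hadef]
        nlinarith [sq_nonneg ‖x - y‖])
    simp only [Pi.sub_apply, hY0, sub_self, norm_zero] at h
    have h2 : (4 * M ^ 2 * η) / a * Real.exp (a * t) = B t * η := by
      rw [hBdef]; ring
    have h3 : 0 ≤ 4 * M ^ 2 * η / a := by positivity
    rw [sub_zero] at h
    nlinarith
  have hlim : ∀ t, ∃ ℓ, 0 ≤ t → Tendsto (fun k => Y k t) atTop (𝓝 ℓ) := fun t => by
    by_cases ht : 0 ≤ t
    · have hC : CauchySeq fun k => Y k t := by
        refine cauchySeq_of_le_tendsto_0 (fun k : ℕ => √(2 * B t * (1 / ((k : ℝ) + 1)))) ?_ ?_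
        · intro k j i hk hj
          rw [dist_eq_norm]
          refine Real.le_sqrt_of_sq_le ((hcauchy k j t ht).trans ?_)
          have h1 : 1 / ((k : ℝ) + 1) ≤ 1 / ((i : ℝ) + 1) := by gcongr
          have h2 : 1 / ((j : ℝ) + 1) ≤ 1 / ((i : ℝ) + 1) := by gcongr
          nlinarith [hBpos t]
        · have h1 := (tendsto_one_div_add_atTop_nhds_zero_nat (𝕜 := ℝ)).const_mul (2 * B t)
          simpa using h1.sqrt
      obtain ⟨ℓ, hℓ⟩ := cauchySeq_tendsto_of_complete hC
      exact ⟨ℓ, fun _ => hℓ⟩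
    · exact ⟨0, fun h => absurd h ht⟩
  choose y hy using hlim
  have hunif : ∀ (k : ℕ) t T, 0 ≤ t → t ≤ T →
      ‖Y k t - y t‖ ^ 2 ≤ B T * (1 / ((k : ℝ) + 1)) := fun k t T ht htT => by
    have h1 : Tendsto (fun j => ‖Y k t - Y j t‖ ^ 2) atTop (𝓝 (‖Y k t - y t‖ ^ 2)) :=
      ((tendsto_const_nhds.sub (hy t ht)).norm).pow 2
    have h2 : Tendsto (fun j : ℕ => B t * (1 / ((k : ℝ) + 1) + 1 / ((j : ℝ) + 1))) atTop
        (𝓝 (B t * (1 / ((k : ℝ) + 1) + 0))) :=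
      (tendsto_const_nhds.add tendsto_one_div_add_atTop_nhds_zero_nat).const_mul _
    have h3 := le_of_tendsto_of_tendsto' h1 h2 fun j => hcauchy k j t ht
    rw [add_zero] at h3
    refine h3.trans ?_
    have : B t ≤ B T := by
      rw [hBdef]
      show 4 * M ^ 2 / a * Real.exp (a * t) ≤ 4 * M ^ 2 / a * Real.exp (a * T)
      gcongr
    gcongr
  have hylip : ∀ s t, 0 ≤ s → 0 ≤ t → ‖y t - y s‖ ≤ 2 * M * |t - s| := fun s t hs ht =>
    le_of_tendsto' ((hy t ht).sub (hy s hs)).norm fun k => hlip k s t hs ht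
  refine ⟨y, ?_, fun t ht => ?_, hylip, fun t ht d hd z hz => ?_⟩
  · refine tendsto_nhds_unique (hy 0 le_rfl) ?_
    simp only [hY0]
    exact tendsto_const_nhds
  · have h1 : Tendsto (fun k => Y k t - P (Y k t)) atTop (𝓝 0) := by
      refine squeeze_zero_norm (fun k => hpen k t ht) ?_
      have := (tendsto_one_div_add_atTop_nhds_zero_nat (𝕜 := ℝ)).const_mul M
      simpa [div_eq_mul_inv] using this
    have h2 : Tendsto (fun k => P (Y k t)) atTop (𝓝 (y t)) := by
      simpa using (hy t ht).sub h1
    exact hcl.mem_of_tendsto h2 (Eventually.of_forall fun k => pointProj_mem hne hcl hcv _)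
  · -- pass to the limit in the inequality for `‖Y k - z‖²`
    have hkey : ∀ c, inner ℝ (y t - z) (F (y t)) < c →
        ∀ᶠ s in 𝓝[>] t, ‖y s - z‖ ^ 2 - ‖y t - z‖ ^ 2 ≤ 2 * c * (s - t) := fun c hc => by
      have hcont : ContinuousAt (fun x => inner ℝ (x - z) (F x)) (y t) := by
        have := hF.continuous
        fun_prop
      obtain ⟨ρ, hρ, hball⟩ := Metric.eventually_nhds_iff.1 (hcont.eventually (gt_mem_nhds hc))
      -- During this time y moves by at most ρ/2, and for large k the curve Y k is within ρ/2 of y,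
      -- so `hball` applies along Y k. The penalty contributes to the derivative of ‖Y k - z‖² with
      -- the favourable sign.
      have hδ : 0 < ρ / (2 * (2 * M + 1)) := by positivity
      filter_upwards [Ioo_mem_nhdsGT (show t < t + ρ / (2 * (2 * M + 1)) by linarith)] with s hs
      have hT : Tendsto (fun k : ℕ => B s * (1 / ((k : ℝ) + 1))) atTop (𝓝 0) := by
        simpa using (tendsto_one_div_add_atTop_nhds_zero_nat (𝕜 := ℝ)).const_mul (B s)
      have hev := hT.eventually (gt_mem_nhds (show 0 < (ρ / 2) ^ 2 by positivity))
      have hs0 : 0 ≤ s := ht.le.trans hs.1.le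
      refine le_of_tendsto ((((hy s hs0).sub_const z).norm.pow 2).sub
        (((hy t ht.le).sub_const z).norm.pow 2)) ?_
      filter_upwards [hev] with k hk
      have hmv := Convex.image_sub_le_mul_sub_of_deriv_le (convex_Icc t s)
        (f := fun r => ‖Y k r - z‖ ^ 2) (C := 2 * c)
        (fun r hr => ((hY k r (ht.le.trans hr.1)).sub_const z).norm_sq.continuousAt.continuousWithinAt)
        (fun r hr => by
          rw [interior_Icc] at hr
          exact ((hY k r (ht.le.trans hr.1.le)).sub_const z).norm_sq.differentiableAt.differentiableWithinAt)
        (fun r hr => by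
          rw [interior_Icc] at hr
          have hr0 := ht.le.trans hr.1.le
          rw [((hY k r hr0).sub_const z).norm_sq.deriv]
          have hdist : dist (Y k r) (y t) < ρ := by
            have d1 : ‖Y k r - y r‖ < ρ / 2 :=
              lt_of_pow_lt_pow_left₀ 2 (by positivity) ((hunif k r s hr0 hr.2.le).trans_lt hk)
            have d2 := hylip t r ht.le hr0
            have d3 : 2 * M * |r - t| ≤ ρ / 2 := by
              rw [abs_of_pos (by linarith [hr.1])]
              have h1 : r - t ≤ ρ / (2 * (2 * M + 1)) := by linarith [hr.2, hs.2]
              have h2 : (2 * M + 1) * (ρ / (2 * (2 * M + 1))) = ρ / 2 := by field_simp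
              nlinarith [hr.1]
            have d4 := dist_triangle (Y k r) (y r) (y t)
            rw [dist_eq_norm (Y k r) (y r), dist_eq_norm (y r) (y t)] at d4
            linarith
          have hlt := hball hdist
          have hn : 0 ≤ inner ℝ (Y k r - z) (((k : ℝ) + 1) • (Y k r - P (Y k r))) := by
            rw [real_inner_smul_right]
            refine mul_nonneg (by positivity) ?_
            have v := inner_sub_pointProj_le_zero hcl hcv (Y k r) hz
            have e : Y k r - z = (Y k r - P (Y k r)) - (z - P (Y k r)) := by abel
            rw [e, inner_sub_left, real_inner_self_eq_norm_sq, real_inner_comm]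
            rw [← hPdef] at v
            nlinarith [sq_nonneg ‖Y k r - P (Y k r)‖]
          rw [inner_sub_right]
          linarith)
        t (left_mem_Icc.2 hs.1.le) s (right_mem_Icc.2 hs.1.le) hs.1.le
      exact hmv
    have hderiv := (hd.sub_const z).norm_sq
    -- Only right difference quotients are needed: they give ⟨y - z, d⟩ ≤ c for every c > ⟨y - z, F
    -- y⟩, which is the claim.
    have hslope := (hasDerivAt_iff_tendsto_slope.1 hderiv).mono_left
      (nhdsWithin_mono t fun s (hs : s ∈ Ioi t) => (ne_of_gt hs))
    have hle : ∀ c, inner ℝ (y t - z) (F (y t)) < c → inner ℝ (y t - z) d ≤ c := fun c hc => by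
      have : 2 * inner ℝ (y t - z) d ≤ 2 * c := by
        refine le_of_tendsto hslope ?_
        filter_upwards [hkey c hc, self_mem_nhdsWithin] with s hs hst
        have hst : 0 < s - t := sub_pos.2 hst
        rw [slope_def_field, div_le_iff₀ hst]
        exact hs
      linarith
    have hfin := le_of_forall_gt_imp_ge_of_dense hle
    rw [← neg_sub (y t) z, inner_neg_right, inner_sub_left, real_inner_comm, real_inner_comm _ d]
    linarith

end Penalization


/-! ### Absolutely continuous curves and almost everywhere velocity bounds -/

section AbsolutelyContinuous

open scoped NNReal

theorem _root_.LipschitzWith.comp_absolutelyContinuousOnInterval {X Y : Type*}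
    [PseudoMetricSpace X] [PseudoMetricSpace Y] {C : ℝ≥0} {g : X → Y} (hg : LipschitzWith C g)
    {f : ℝ → X} {a b : ℝ} (hf : AbsolutelyContinuousOnInterval f a b) :
    AbsolutelyContinuousOnInterval (fun t => g (f t)) a b := by
  have h0 := Tendsto.const_mul (C : ℝ) hf
  rw [mul_zero] at h0
  refine squeeze_zero (fun I => Finset.sum_nonneg fun i _ => dist_nonneg) (fun I => ?_) h0
  rw [Finset.mul_sum]
  exact Finset.sum_le_sum fun i _ => hg.dist_le_mul _ _

theorem absolutelyContinuousOnInterval_norm_sub_sq {E : Type*} [NormedAddCommGroup E]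
    {f : ℝ → E} {a b : ℝ} (hf : AbsolutelyContinuousOnInterval f a b) (z : E) :
    AbsolutelyContinuousOnInterval (fun t => ‖f t - z‖ ^ 2) a b := by
  have h1 : LipschitzWith 1 fun x : E => ‖x - z‖ :=
    LipschitzWith.of_dist_le_mul fun x y => by
      rw [Real.dist_eq, dist_eq_norm]
      simpa using abs_norm_sub_norm_le (x - z) (y - z)
  have h2 := h1.comp_absolutelyContinuousOnInterval hf
  simpa [sq] using h2.fun_mul h2

/-- The hypothesis speaks of every derivative that may exist at r; almost everywhere existence is
supplied by absolute continuity, so callers need not prove it for φ. -/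
theorem sub_le_mul_sub_of_ae_deriv_le {φ : ℝ → ℝ} {s t c : ℝ} (hst : s ≤ t)
    (hac : AbsolutelyContinuousOnInterval φ s t)
    (h : ∀ᵐ r, r ∈ Ioo s t → ∀ d, HasDerivAt φ d r → d ≤ c) : φ t - φ s ≤ c * (t - s) := by
  rw [← hac.integral_deriv_eq_sub]
  have hc : ∫ _ in s..t, c = c * (t - s) := by simp [mul_comm]
  rw [← hc]
  refine intervalIntegral.integral_mono_ae_restrict hst hac.intervalIntegrable_deriv
    intervalIntegrable_const ?_
  rw [← restrict_Ioo_eq_restrict_Icc, Filter.EventuallyLE, ae_restrict_iff' measurableSet_Ioo]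
  filter_upwards [h, hac.ae_differentiableAt] with r hr hdiff hmem
  refine hr hmem _ (hdiff ?_).hasDerivAt
  rw [uIcc_of_le hst]
  exact Ioo_subset_Icc_self hmem

/-- The scalar bound is applied to the component of y along y t - y s. If that vector is zero, c ≥ 0
still has to be extracted from a point where the velocity exists, which there is because the
interval has positive measure. -/
theorem norm_sub_le_of_ae_norm_deriv_le {E : Type*} [NormedAddCommGroup E]
    [InnerProductSpace ℝ E] {y : ℝ → E} {s t c : ℝ} (hst : s ≤ t)
    (hac : AbsolutelyContinuousOnInterval y s t)
    (h : ∀ᵐ r, r ∈ Ioo s t → ∃ d, HasDerivAt y d r ∧ ‖d‖ ≤ c) : ‖y t - y s‖ ≤ c * (t - s) := by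
  rcases eq_or_ne (y t - y s) 0 with h0 | h0
  · rw [h0, norm_zero]
    rcases hst.eq_or_lt with rfl | hlt
    · simp
    · have : (volume (Ioo s t)) ≠ 0 := by
        rw [Real.volume_Ioo]
        simpa using hlt
      obtain ⟨r, hr⟩ : ∃ r ∈ Ioo s t, ∃ d, HasDerivAt y d r ∧ ‖d‖ ≤ c := by
        by_contra hcon
        push Not at hcon
        refine this (measure_mono_null (fun r hr => ?_) (ae_iff.1 h))
        intro hh
        obtain ⟨d, hd, hdc⟩ := hh hr
        exact absurd hdc (not_le.2 (hcon r hr d hd))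
      obtain ⟨-, d, -, hd⟩ := hr
      exact mul_nonneg ((norm_nonneg _).trans hd) (by linarith)
  · set e := y t - y s with he
    have hpos : 0 < ‖e‖ := norm_pos_iff.2 h0
    have h1 := (innerSL ℝ e).lipschitz.comp_absolutelyContinuousOnInterval hac
    have h2 := sub_le_mul_sub_of_ae_deriv_le (c := ‖e‖ * c) hst h1 (by
      filter_upwards [h] with r hr hmem d hd
      obtain ⟨d', hd', hc⟩ := hr hmem
      have h3 := ((innerSL ℝ e).hasFDerivAt.comp_hasDerivAt r hd')
      rw [hd.unique h3]
      refine (real_inner_le_norm e d').trans ?_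
      gcongr)
    have h3 : innerSL ℝ e (y t) - innerSL ℝ e (y s) = ‖e‖ ^ 2 := by
      rw [← map_sub, ← he, innerSL_apply_apply, real_inner_self_eq_norm_sq]
    rw [h3, sq, mul_assoc] at h2
    exact le_of_mul_le_mul_left h2 hpos

end AbsolutelyContinuous

/-! ### Existence and convergence for dissipative projected flows -/

section ProjectedFlow

open scoped NNReal

variable {E : Type*} [NormedAddCommGroup E] [InnerProductSpace ℝ E] [FiniteDimensional ℝ E]
  {K : Set E}

/-- Projected dynamics with a rest point towards which the field never moves away have Lipschitz
solutions on `[0, ∞)` from every initial value. -/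
theorem exists_projected_solution (hcl : IsClosed K) (hcv : Convex ℝ K) {f : E → E} {z : E}
    (hz : z ∈ K) (hlip : ∀ R : ℝ, ∃ L, LipschitzOnWith L f (K ∩ Metric.closedBall z R))
    (hdiss : ∀ y ∈ K, inner ℝ (y - z) (f y) ≤ 0) {y₀ : E} (hy₀ : y₀ ∈ K) :
    ∃ (y : ℝ → E) (C : ℝ≥0), y 0 = y₀ ∧ (∀ t, y t ∈ K) ∧ LipschitzWith C y ∧
      ∀ᵐ t ∂(volume.restrict (Ici (0 : ℝ))), 0 < t ∧ ∃ d, HasDerivAt y d t ∧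
        ∀ x ∈ K, inner ℝ (f (y t) - d) (x - y t) ≤ 0 := by
  have : CompleteSpace E := FiniteDimensional.complete ℝ E
  -- The solution will never leave the ball of radius ‖y₀ - z‖. The margin 1 keeps it away from the
  -- boundary of the larger ball, so the truncation to D adds no normal vectors of its own.
  set R : ℝ := ‖y₀ - z‖ + 1 with hR
  obtain ⟨L, hL⟩ := hlip R
  set D := K ∩ Metric.closedBall z R with hD
  have hzD : z ∈ D := ⟨hz, Metric.mem_closedBall_self (by positivity)⟩
  have hyD : y₀ ∈ D := ⟨hy₀, by rw [Metric.mem_closedBall, dist_eq_norm]; linarith⟩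
  have hDcl : IsClosed D := hcl.inter Metric.isClosed_closedBall
  have hDcv : Convex ℝ D := hcv.inter (convex_closedBall z R)
  have hPD : ∀ x, pointProj D x ∈ D := pointProj_mem ⟨z, hzD⟩ hDcl hDcv
  have hF : LipschitzWith L fun x => f (pointProj D x) := LipschitzWith.of_dist_le_mul fun x y => by
    refine (hL.dist_le_mul _ (hPD x) _ (hPD y)).trans ?_
    gcongr
    simpa [dist_eq_norm] using norm_pointProj_sub_le ⟨z, hzD⟩ hDcl hDcv x y
  have hM : ∀ x, ‖f (pointProj D x)‖ ≤ ‖f z‖ + L * R := fun x => by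
    have h1 := hL.dist_le_mul _ (hPD x) _ hzD
    have h2 : dist (pointProj D x) z ≤ R := (hPD x).2
    rw [dist_eq_norm] at h1
    have h3 := norm_le_insert' (f (pointProj D x)) (f z)
    have h4 : (L : ℝ) * dist (pointProj D x) z ≤ L * R := by gcongr
    linarith
  obtain ⟨y, hy0, hymem, hylip, hyvi⟩ := exists_sweeping_solution hDcl hDcv hF hM hyD
  set M := ‖f z‖ + L * R
  have hM0 : 0 ≤ M := by positivity
  set C : ℝ≥0 := ⟨2 * M, by positivity⟩
  -- The constant extension to negative times is Lipschitz on ℝ, hence differentiable almost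
  -- everywhere.
  set w : ℝ → E := fun t => y (max t 0) with hw
  have hwlip : LipschitzWith C w := LipschitzWith.of_dist_le_mul fun s t => by
    rw [dist_eq_norm]
    refine (hylip _ _ (le_max_right _ _) (le_max_right _ _)).trans ?_
    show 2 * M * |max s 0 - max t 0| ≤ 2 * M * dist s t
    rw [Real.dist_eq]
    exact mul_le_mul_of_nonneg_left (abs_max_sub_max_le_abs s t 0) (by positivity)
  have hwD : ∀ t, w t ∈ D := fun t => hymem _ (le_max_right _ _)
  have hwy : ∀ t, 0 < t → w t = y t ∧ w =ᶠ[𝓝 t] y := fun t ht => by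
    have h : ∀ s, 0 < s → w s = y s := fun s hs => by rw [hw]; simp only [max_eq_left hs.le]
    exact ⟨h t ht, by filter_upwards [Ioi_mem_nhds ht] with s hs using h s hs⟩
  have hvi : ∀ t, 0 < t → ∀ d, HasDerivAt w d t → ∀ x ∈ D,
      inner ℝ (f (w t) - d) (x - w t) ≤ 0 := fun t ht d hd x hx => by
    obtain ⟨h1, h2⟩ := hwy t ht
    have h3 := hyvi t ht d (hd.congr_of_eventuallyEq h2.symm) x hx
    rw [← h1, pointProj_eq_self hDcl hDcv (hwD t)] at h3
    exact h3
  have hw0 : w 0 = y₀ := by rw [hw]; simpa using hy0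
  have hball : ∀ t, 0 ≤ t → ‖w t - z‖ ≤ ‖y₀ - z‖ := fun t ht => by
    have hac := absolutelyContinuousOnInterval_norm_sub_sq
      ((hwlip.lipschitzOnWith (s := uIcc 0 t)).absolutelyContinuousOnInterval) z
    have h := sub_le_mul_sub_of_ae_deriv_le (c := 0) ht hac (by
      filter_upwards [hwlip.ae_differentiableAt_real] with r hr hmem d hd
      have h1 := hr.hasDerivAt
      rw [hd.unique (h1.sub_const z).norm_sq]
      have h2 := hvi r hmem.1 _ h1 z hzD
      have h3 := hdiss _ (hwD r).1
      rw [← neg_sub (w r) z, inner_neg_right, inner_sub_left, real_inner_comm] at h2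
      rw [real_inner_comm]
      linarith)
    rw [zero_mul, hw0] at h
    exact le_of_pow_le_pow_left₀ two_ne_zero (norm_nonneg _) (by linarith)
  refine ⟨w, C, hw0, fun t => (hwD t).1, hwlip, ?_⟩
  rw [← restrict_Ioi_eq_restrict_Ici, ae_restrict_iff' measurableSet_Ioi]
  filter_upwards [hwlip.ae_differentiableAt_real] with t hdiff (ht : 0 < t)
  refine ⟨ht, _, hdiff.hasDerivAt, fun x hx => ?_⟩
  have hlt : dist (w t) z < R := by
    rw [dist_eq_norm]
    linarith [hball t ht.le]
  have hcont : ContinuousAt (fun θ : ℝ => w t + θ • (x - w t)) 0 := by fun_prop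
  have hev : ∀ᶠ θ : ℝ in 𝓝[>] 0, dist (w t + θ • (x - w t)) z < R := by
    refine (hcont.eventually (Metric.isOpen_ball.mem_nhds ?_)).filter_mono nhdsWithin_le_nhds
    simpa using hlt
  -- A short step from w t towards any x ∈ K stays in D, so normality with respect to D gives
  -- normality with respect to K.
  obtain ⟨θ, hθ, hθ01⟩ := (hev.and (Ioo_mem_nhdsGT (show (0 : ℝ) < 1 by norm_num))).exists
  have hmem : w t + θ • (x - w t) ∈ D :=
    ⟨hcv.add_smul_sub_mem (hwD t).1 hx ⟨hθ01.1.le, hθ01.2.le⟩, hθ.le⟩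
  have h := hvi t ht _ hdiff.hasDerivAt _ hmem
  rw [add_sub_cancel_left, real_inner_smul_right] at h
  by_contra hcon
  push Not at hcon
  have := mul_pos hθ01.1 hcon
  linarith

/-- Convergence of dissipative projected dynamics: if the field moves towards `z` at rate at least
`ψ`, then `π (y t)` converges to `π z` as soon as `ψ` is positive where `π y ≠ π z`. -/
theorem tendsto_of_projected_solution {F : Type*} [NormedAddCommGroup F] [NormedSpace ℝ F]
    (hcl : IsClosed K) {f : E → E} (hf : ContinuousOn f K) {z : E} {ψ : E → ℝ}
    (hψ : ContinuousOn ψ K) (hψ0 : ∀ y ∈ K, 0 ≤ ψ y)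
    (hdiss : ∀ y ∈ K, inner ℝ (y - z) (f y) ≤ -ψ y) (π : E →L[ℝ] F)
    (hπ : ∀ y ∈ K, π y ≠ π z → 0 < ψ y) (hz : z ∈ K) {y : ℝ → E} (hy : ∀ t, 0 ≤ t → y t ∈ K)
    (hac : ∀ τ, 0 ≤ τ → AbsolutelyContinuousOnInterval y 0 τ)
    (hd : ∀ᵐ t ∂(volume.restrict (Ici (0 : ℝ))), ∃ d, HasDerivAt y d t ∧ ‖d‖ ≤ ‖f (y t)‖ ∧
      ∀ x ∈ K, inner ℝ (f (y t) - d) (x - y t) ≤ 0) :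
    Tendsto (fun t => π (y t)) atTop (𝓝 (π z)) := by
  rw [ae_restrict_iff' measurableSet_Ici] at hd
  have hacI : ∀ s t, 0 ≤ s → s ≤ t → AbsolutelyContinuousOnInterval y s t := fun s t hs hst =>
    (hac t (hs.trans hst)).mono (by
      rw [uIcc_of_le hst, uIcc_of_le (hs.trans hst)]
      exact Icc_subset_Icc_left hs)
  have hdec : ∀ s t c, 0 ≤ s → s ≤ t → (∀ r ∈ Ioo s t, c ≤ ψ (y r)) →
      ‖y t - z‖ ^ 2 - ‖y s - z‖ ^ 2 ≤ -(2 * c) * (t - s) := fun s t c hs hst hc => by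
    refine sub_le_mul_sub_of_ae_deriv_le hst
      (absolutelyContinuousOnInterval_norm_sub_sq (hacI s t hs hst) z) ?_
    filter_upwards [hd] with r hr hmem d' hd'
    have hr0 : 0 ≤ r := hs.trans hmem.1.le
    obtain ⟨d, h1, -, h2⟩ := hr hr0
    rw [hd'.unique (h1.sub_const z).norm_sq]
    have h3 := h2 z hz
    have h4 := hdiss _ (hy r hr0)
    have h5 := hc r hmem
    rw [← neg_sub (y r) z, inner_neg_right, inner_sub_left, real_inner_comm] at h3
    rw [real_inner_comm]
    linarith
  have hanti : ∀ s t, 0 ≤ s → s ≤ t → ‖y t - z‖ ^ 2 ≤ ‖y s - z‖ ^ 2 := fun s t hs hst => by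
    have := hdec s t 0 hs hst fun r hr => hψ0 _ (hy r (hs.trans hr.1.le))
    linarith
  set R := ‖y 0 - z‖
  have hR : ∀ t, 0 ≤ t → ‖y t - z‖ ≤ R := fun t ht =>
    le_of_pow_le_pow_left₀ two_ne_zero (norm_nonneg _) (hanti 0 t le_rfl ht)
  have hcomp : IsCompact (K ∩ Metric.closedBall z R) :=
    (isCompact_closedBall z R).inter_left hcl
  have hyK : ∀ t, 0 ≤ t → y t ∈ K ∩ Metric.closedBall z R := fun t ht =>
    ⟨hy t ht, by rw [Metric.mem_closedBall, dist_eq_norm]; exact hR t ht⟩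
  obtain ⟨M, hM⟩ := hcomp.exists_bound_of_continuousOn (hf.mono inter_subset_left)
  have hM0 : 0 ≤ M := (norm_nonneg _).trans (hM _ (hyK 0 le_rfl))
  have hylip : ∀ s t, 0 ≤ s → s ≤ t → ‖y t - y s‖ ≤ M * (t - s) := fun s t hs hst => by
    refine norm_sub_le_of_ae_norm_deriv_le hst (hacI s t hs hst) ?_
    filter_upwards [hd] with r hr hmem
    have hr0 : 0 ≤ r := hs.trans hmem.1.le
    obtain ⟨d, h1, h2, -⟩ := hr hr0
    exact ⟨d, h1, h2.trans (hM _ (hyK r hr0))⟩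
  -- the squared distance converges
  obtain ⟨ℓ, hℓ⟩ : ∃ ℓ, Tendsto (fun t => ‖y (max t 0) - z‖ ^ 2) atTop (𝓝 ℓ) := by
    refine ⟨_, tendsto_atTop_ciInf (fun s t hst => hanti _ _ (le_max_right _ _)
      (max_le_max_right 0 hst)) ⟨0, ?_⟩⟩
    rintro _ ⟨t, rfl⟩
    positivity
  have hV : Tendsto (fun t => ‖y t - z‖ ^ 2) atTop (𝓝 ℓ) := by
    refine hℓ.congr' ?_
    filter_upwards [eventually_ge_atTop 0] with t ht
    rw [max_eq_left ht]
  rw [Metric.tendsto_atTop]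
  intro η hη
  -- Where π stays η/2 away from its target within the compact trapping region, the dissipation has
  -- a positive minimum.
  obtain ⟨c, hc, hcψ⟩ : ∃ c > 0, ∀ x ∈ K ∩ Metric.closedBall z R, η / 2 ≤ ‖π x - π z‖ →
      c ≤ ψ x := by
    set S := (K ∩ Metric.closedBall z R) ∩ {x | η / 2 ≤ ‖π x - π z‖} with hS
    have hScomp : IsCompact S := hcomp.inter_right (isClosed_le continuous_const (by fun_prop))
    rcases S.eq_empty_or_nonempty with h0 | h0
    · refine ⟨1, one_pos, fun x hx hx' => absurd (?_ : x ∈ S) (by simp [h0])⟩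
      exact ⟨hx, hx'⟩
    · obtain ⟨x₀, hx₀, hmin⟩ := hScomp.exists_isMinOn h0
        (hψ.mono (inter_subset_left.trans inter_subset_left))
      refine ⟨ψ x₀, hπ x₀ hx₀.1.1 fun h => ?_, fun x hx hx' => hmin ⟨hx, hx'⟩⟩
      have : η / 2 ≤ ‖π x₀ - π z‖ := hx₀.2
      rw [h, sub_self, norm_zero] at this
      linarith
  -- In time τ the value of π moves by at most η/2. If it is η away from π z at time t, it stays η/2
  -- away on [t, t + τ], and ‖y - z‖² drops by 2cτ; this happens for no large t because ‖y - z‖²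
  -- converges.
  set τ := η / (2 * (‖π‖ * M + 1)) with hτ
  have hτ0 : 0 < τ := by positivity
  have hτM : ‖π‖ * (M * τ) ≤ η / 2 := by
    have h1 : (‖π‖ * M + 1) * τ = η / 2 := by
      rw [hτ]
      field_simp
    nlinarith
  have hdiff : Tendsto (fun t => ‖y t - z‖ ^ 2 - ‖y (t + τ) - z‖ ^ 2) atTop (𝓝 (ℓ - ℓ)) :=
    hV.sub (hV.comp (tendsto_atTop_add_const_right _ τ tendsto_id))
  rw [sub_self] at hdiff
  have hev := hdiff.eventually (gt_mem_nhds (show 0 < 2 * c * τ by positivity))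
  obtain ⟨T, hT⟩ := (hev.and (eventually_ge_atTop 0)).exists_forall_of_atTop
  refine ⟨T, fun t ht => ?_⟩
  obtain ⟨hlt, ht0⟩ := hT t ht
  by_contra hcon
  push Not at hcon
  rw [dist_eq_norm] at hcon
  have h := hdec t (t + τ) c ht0 (by linarith) fun r hr => by
    have hr0 : 0 ≤ r := ht0.trans hr.1.le
    refine hcψ _ (hyK r hr0) ?_
    have h1 : ‖π (y r) - π (y t)‖ ≤ η / 2 := by
      rw [← map_sub]
      refine (π.le_opNorm _).trans (le_trans ?_ hτM)
      gcongr
      refine (hylip t r ht0 hr.1.le).trans ?_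
      gcongr
      linarith [hr.2]
    have h2 : ‖π (y t) - π z‖ ≤ ‖π (y r) - π z‖ + ‖π (y r) - π (y t)‖ := by
      have : π (y t) - π z = (π (y r) - π z) - (π (y r) - π (y t)) := by abel
      rw [this]
      exact norm_sub_le _ _
    linarith
  rw [add_sub_cancel_left] at h
  linarith

end ProjectedFlow


/-! ### Lagrange multipliers -/

section Farkas

/-- Induction on the number of inequalities. If the last one is needed, some x₀ satisfies the others
with d x₀ > 0 and a_last x₀ > 0. Projecting along x₀ onto the kernel of a_last removes one
inequality, and the signs at x₀ make the coefficient of a_last nonnegative. No topology enters. -/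
theorem farkas_fin {V : Type*} [AddCommGroup V] [Module ℝ V] {p : ℕ} (a : Fin p → V →ₗ[ℝ] ℝ)
    (d : V →ₗ[ℝ] ℝ) (h : ∀ x, (∀ k, a k x ≤ 0) → d x ≤ 0) :
    ∃ ν : Fin p → ℝ, (∀ k, 0 ≤ ν k) ∧ d = ∑ k, ν k • a k := by
  induction p generalizing d with
  | zero =>
    refine ⟨0, by simp, LinearMap.ext fun x => ?_⟩
    have h1 := h x (fun k => k.elim0)
    have h2 := h (-x) (fun k => k.elim0)
    rw [map_neg] at h2
    simpa using le_antisymm h1 (by linarith)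
  | succ p ih =>
    by_cases hd : ∀ x, (∀ k : Fin p, a k.castSucc x ≤ 0) → d x ≤ 0
    · obtain ⟨ν, hν, hdν⟩ := ih _ d hd
      refine ⟨Fin.snoc ν 0, fun k => ?_, ?_⟩
      · refine Fin.lastCases (by simp) (fun k => by simpa using hν k) k
      · rw [Fin.sum_univ_castSucc]
        simpa using hdν
    · push Not at hd
      obtain ⟨x₀, hx₀, hdx₀⟩ := hd
      have hlast : 0 < a (Fin.last p) x₀ := by
        by_contra hcon
        push Not at hcon
        refine absurd (h x₀ fun k => ?_) (not_le.2 hdx₀)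
        exact Fin.lastCases hcon hx₀ k
      set α := a (Fin.last p) x₀
      obtain ⟨ν, hν, hdν⟩ := ih (fun k => a k.castSucc - (a k.castSucc x₀ / α) • a (Fin.last p))
        (d - (d x₀ / α) • a (Fin.last p)) fun x hx => by
          have hy := h (x - (a (Fin.last p) x / α) • x₀) fun k => by
            refine Fin.lastCases ?_ (fun k => ?_) k
            · have : α = a (Fin.last p) x₀ := rfl
              simp only [map_sub, map_smul, smul_eq_mul, ← this]
              rw [div_mul_cancel₀ _ hlast.ne', sub_self]
            · have := hx k
              simp only [LinearMap.sub_apply, LinearMap.smul_apply, smul_eq_mul] at this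
              simp only [map_sub, map_smul, smul_eq_mul]
              refine le_trans (le_of_eq ?_) this
              ring
          simp only [map_sub, map_smul, smul_eq_mul] at hy
          simp only [LinearMap.sub_apply, LinearMap.smul_apply, smul_eq_mul]
          refine le_trans (le_of_eq ?_) hy
          ring
      refine ⟨Fin.snoc ν (d x₀ / α - ∑ k, ν k * (a k.castSucc x₀ / α)), fun k => ?_, ?_⟩
      · refine Fin.lastCases ?_ (fun k => by simpa using hν k) k
        rw [Fin.snoc_last]
        have h1 : ∑ k, ν k * (a k.castSucc x₀ / α) ≤ 0 := Finset.sum_nonpos fun k _ =>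
          mul_nonpos_of_nonneg_of_nonpos (hν k) (div_nonpos_of_nonpos_of_nonneg (hx₀ k) hlast.le)
        have h2 : 0 < d x₀ / α := by positivity
        linarith
      · rw [Fin.sum_univ_castSucc]
        simp only [Fin.snoc_castSucc, Fin.snoc_last]
        refine LinearMap.ext fun x => ?_
        have hx := LinearMap.congr_fun hdν x
        simp only [LinearMap.sub_apply, LinearMap.smul_apply, LinearMap.sum_apply, smul_eq_mul,
          mul_sub, Finset.sum_sub_distrib, ← mul_assoc, ← Finset.sum_mul] at hx
        simp only [LinearMap.add_apply, LinearMap.smul_apply, LinearMap.sum_apply, smul_eq_mul]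
        linarith

/-- **Farkas' lemma** for finitely many linear inequalities. -/
theorem farkas {V ι : Type*} [AddCommGroup V] [Module ℝ V] [Fintype ι] (a : ι → V →ₗ[ℝ] ℝ)
    (d : V →ₗ[ℝ] ℝ) (h : ∀ x, (∀ k, a k x ≤ 0) → d x ≤ 0) :
    ∃ ν : ι → ℝ, (∀ k, 0 ≤ ν k) ∧ d = ∑ k, ν k • a k := by
  let e := Fintype.equivFin ι
  obtain ⟨ν, hν, hd⟩ := farkas_fin (fun k => a (e.symm k)) d fun x hx => h x fun k => by
    simpa using hx (e k)
  refine ⟨fun k => ν (e k), fun k => hν _, hd.trans ?_⟩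
  rw [← e.sum_comp]
  simp

end Farkas

section Separation

variable {E : Type*} [NormedAddCommGroup E] [NormedSpace ℝ E] [FiniteDimensional ℝ E]

/-- In finite dimension a point outside a convex set can be separated from it, whether or not the
set is open or closed. -/
theorem exists_ne_zero_forall_nonneg {A : Set E} (hA : Convex ℝ A) (hne : A.Nonempty)
    (h0 : (0 : E) ∉ A) : ∃ f : E →ₗ[ℝ] ℝ, f ≠ 0 ∧ ∀ a ∈ A, 0 ≤ f a := by
  by_cases hspan : affineSpan ℝ A = ⊤
  · obtain ⟨f, hf, hfa⟩ := geometric_hahn_banach_of_nonempty_interior_point hA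
      (fun h => h0 (interior_subset h)) (hA.interior_nonempty_iff_affineSpan_eq_top.2 hspan)
    refine ⟨-f.toLinearMap, fun h => hf ?_, fun a ha => ?_⟩
    · ext x
      have := LinearMap.congr_fun h x
      simpa using this
    · have := hfa a ha
      simpa using this
  -- Without interior, A lies in a translate of a proper subspace; a nonzero functional that
  -- vanishes on that subspace is constant on A and only its sign has to be chosen.
  · have hdir : vectorSpan ℝ A ≠ ⊤ := by
      rw [← direction_affineSpan, Ne,
        AffineSubspace.direction_eq_top_iff_of_nonempty (hne.affineSpan ℝ)]
      exact hspan
    obtain ⟨f, hf, hker⟩ := Submodule.exists_le_ker_of_lt_top _ (lt_top_iff_ne_top.2 hdir)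
    obtain ⟨a₀, ha₀⟩ := hne
    have hconst : ∀ a ∈ A, f a = f a₀ := fun a ha => by
      have : f (a - a₀) = 0 := hker (vsub_mem_vectorSpan ℝ ha ha₀)
      rw [map_sub] at this
      linarith
    rcases le_total 0 (f a₀) with h | h
    · exact ⟨f, hf, fun a ha => by rw [hconst a ha]; exact h⟩
    · refine ⟨-f, neg_ne_zero.2 hf, fun a ha => ?_⟩
      rw [LinearMap.neg_apply, hconst a ha]
      linarith

end Separation

section Slater

/-- Multipliers for strictly feasible convex inequality constraints. -/
theorem exists_multipliers_of_slater {E : Type*} [AddCommGroup E] [Module ℝ E] {l : ℕ} {X : Set E}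
    {ℓ : E → ℝ} {G : E → Fin l → ℝ} (hℓ : ConvexOn ℝ X ℓ) (hG : ∀ j, ConvexOn ℝ X fun x => G x j)
    {xs : E} (hxs : xs ∈ X) (hs : ∀ j, G xs j < 0)
    (hmin : ∀ x ∈ X, (∀ j, G x j ≤ 0) → 0 ≤ ℓ x) :
    ∃ μ : Fin l → ℝ, (∀ j, 0 ≤ μ j) ∧ ∀ x ∈ X, 0 ≤ ℓ x + ∑ j, μ j * G x j := by
  -- The strict inequality in the first coordinate keeps 0 out of A. Separation takes place in this
  -- finite-dimensional image space, so E needs no topology.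
  set A : Set (ℝ × (Fin l → ℝ)) := {q | ∃ x ∈ X, ℓ x < q.1 ∧ ∀ j, G x j ≤ q.2 j} with hAdef
  have hA : Convex ℝ A := by
    rintro ⟨r, v⟩ ⟨x, hx, hxr, hxv⟩ ⟨r', v'⟩ ⟨x', hx', hxr', hxv'⟩ s t hs ht hst
    refine ⟨s • x + t • x', hℓ.1 hx hx' hs ht hst, ?_, fun j => ?_⟩
    · refine (hℓ.2 hx hx' hs ht hst).trans_lt ?_
      simp only [smul_eq_mul, Prod.fst_add, Prod.smul_fst]
      simp only at hxr hxr'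
      rcases hs.eq_or_lt with rfl | hs
      · have : t = 1 := by linarith
        subst this
        linarith
      · nlinarith
    · refine ((hG j).2 hx hx' hs ht hst).trans ?_
      simp only [smul_eq_mul, Prod.snd_add, Prod.smul_snd, Pi.add_apply, Pi.smul_apply]
      have := hxv j
      have := hxv' j
      gcongr
  have hmem : ∀ x ∈ X, ∀ r, ℓ x < r → ((r, G x) : ℝ × (Fin l → ℝ)) ∈ A := fun x hx r hr =>
    ⟨x, hx, hr, fun j => le_rfl⟩
  have h0 : (0 : ℝ × (Fin l → ℝ)) ∉ A := by
    rintro ⟨x, hx, hlt, hle⟩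
    exact absurd (hmin x hx hle) (not_le.2 hlt)
  obtain ⟨f, hf, hfA⟩ := exists_ne_zero_forall_nonneg hA
    ⟨_, hmem xs hxs (ℓ xs + 1) (by linarith)⟩ h0
  set α := f (1, 0)
  set β : Fin l → ℝ := fun j => f (0, Pi.single j 1)
  have hfe : ∀ r v, f (r, v) = r * α + ∑ j, v j * β j := fun r v => by
    have h1 : ((r, v) : ℝ × (Fin l → ℝ))
        = r • ((1, 0) : ℝ × (Fin l → ℝ)) + ∑ j, v j • ((0, Pi.single j 1) : ℝ × (Fin l → ℝ)) := by
      ext k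
      · simp [Prod.fst_sum]
      · simp [Prod.snd_sum, Finset.sum_apply, Pi.single_apply]
    rw [h1, map_add, map_smul, map_sum]
    simp only [map_smul, smul_eq_mul]
    rfl
  -- the coefficients are nonnegative because `A` recedes in the positive directions
  have hα : 0 ≤ α := by
    by_contra hcon
    push Not at hcon
    obtain ⟨N, hN⟩ := exists_nat_gt (f (ℓ xs + 1, G xs) / -α)
    have h1 := hfA _ (hmem xs hxs (ℓ xs + 1 + N) (by linarith [N.cast_nonneg (α := ℝ)]))
    rw [hfe] at h1
    rw [hfe, div_lt_iff₀ (by linarith)] at hN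
    nlinarith
  have hβ : ∀ j, 0 ≤ β j := fun j => by
    by_contra hcon
    push Not at hcon
    obtain ⟨N, hN⟩ := exists_nat_gt (f (ℓ xs + 1, G xs) / -β j)
    have h1 := hfA (ℓ xs + 1, G xs + Pi.single j (N : ℝ)) ⟨xs, hxs, by simp, fun k => by
      show G xs k ≤ G xs k + (Pi.single j (N : ℝ) : Fin l → ℝ) k
      have : 0 ≤ (Pi.single j (N : ℝ) : Fin l → ℝ) k := by
        rw [Pi.single_apply]
        split_ifs <;> positivity
      linarith⟩
    have h2 : f (ℓ xs + 1, G xs + Pi.single j (N : ℝ)) = f (ℓ xs + 1, G xs) + N * β j := by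
      rw [hfe, hfe]
      simp [add_mul, Finset.sum_add_distrib, Pi.single_apply, add_assoc]
    rw [h2] at h1
    rw [div_lt_iff₀ (by linarith)] at hN
    linarith
  have hX : ∀ x ∈ X, 0 ≤ ℓ x * α + ∑ j, G x j * β j := fun x hx => by
    by_contra hcon
    push Not at hcon
    set s := ℓ x * α + ∑ j, G x j * β j
    have hpos : 0 < -s / (α + 1) := by
      have : 0 < -s := by linarith
      positivity
    have h1 := hfA _ (hmem x hx (ℓ x + -s / (α + 1)) (by linarith))
    rw [hfe] at h1
    have h2 : -s / (α + 1) * (α + 1) = -s := by field_simp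
    have h3 : (ℓ x + -s / (α + 1)) * α + ∑ j, G x j * β j = s + -s / (α + 1) * α := by
      simp only [s]; ring
    rw [h3] at h1
    nlinarith
  -- This is the role of strict feasibility: if α = 0, the inequality at xs leaves only terms
  -- G_j(xs) β_j ≤ 0, so every β_j vanishes and f = 0.
  have hαpos : 0 < α := by
    refine lt_of_le_of_ne hα fun h => hf ?_
    have h1 := hX xs hxs
    rw [← h, mul_zero, zero_add] at h1
    have h2 : ∀ j, β j = 0 := by
      have h3 : ∀ j ∈ Finset.univ, G xs j * β j ≤ 0 := fun j _ =>
        mul_nonpos_of_nonpos_of_nonneg (hs j).le (hβ j)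
      have h4 := (Finset.sum_eq_zero_iff_of_nonpos h3).1
        (le_antisymm (Finset.sum_nonpos h3) h1)
      exact fun j => (mul_eq_zero.1 (h4 j (Finset.mem_univ j))).resolve_left (hs j).ne
    refine LinearMap.ext fun ⟨r, v⟩ => ?_
    rw [hfe, ← h]
    simp [h2]
  refine ⟨fun j => β j / α, fun j => div_nonneg (hβ j) hα, fun x hx => ?_⟩
  have h1 : ℓ x + ∑ j, β j / α * G x j = (ℓ x * α + ∑ j, G x j * β j) / α := by
    rw [add_div, mul_div_cancel_right₀ _ hαpos.ne', Finset.sum_div]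
    congr 1
    exact Finset.sum_congr rfl fun j _ => by ring
  rw [h1]
  exact div_nonneg (hX x hx) hα

end Slater

section LinearMultipliers

variable {E F : Type*} [NormedAddCommGroup E] [NormedSpace ℝ E] [FiniteDimensional ℝ E]

/-- Splitting of a linear functional that is nonnegative on the intersection of a convex set `P`
and a convex set `Q` whose relative interior meets `P`. -/
theorem exists_split_of_nonneg_inter {P Q : Set E} (hP : Convex ℝ P) (hQ : Convex ℝ Q) {ws wt : E}
    (hwsP : ws ∈ P) (hwsQ : ws ∈ Q) (hri : ∀ q ∈ Q, ∀ᶠ t : ℝ in 𝓝[>] 0, ws + t • (ws - q) ∈ Q)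
    (hspan : ∀ w ∈ P, w - ws ∈ Submodule.span ℝ ((fun q => q - ws) '' Q))
    (hwtP : wt ∈ P) (hwtQ : wt ∈ Q) {c : E →ₗ[ℝ] ℝ} (hc : ∀ w ∈ P, w ∈ Q → 0 ≤ c (w - wt)) :
    ∃ η : E →ₗ[ℝ] ℝ, (∀ w ∈ P, 0 ≤ c (w - wt) + η (w - wt)) ∧ ∀ q ∈ Q, η (q - wt) ≤ 0 := by
  set V := Submodule.span ℝ ((fun q => q - ws) '' Q) with hV
  have hQV : ∀ q ∈ Q, q - ws ∈ V := fun q hq => Submodule.subset_span ⟨q, hq, rfl⟩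
  -- Enlarging P - Q by a complement V' of the span of Q - ws forces the separating functional to
  -- vanish on V', so only its values on V remain to be controlled. The origin is still avoided
  -- because P - ws and Q - ws lie in V.
  obtain ⟨V', hVV'⟩ := Submodule.exists_isCompl V
  set A : Set (E × ℝ) := {x | ∃ w ∈ P, ∃ q ∈ Q, ∃ v ∈ V', x.1 = w - q + v ∧ c (w - wt) < x.2}
    with hAdef
  have hA : Convex ℝ A := by
    rintro ⟨x, r⟩ ⟨w, hw, q, hq, v, hv, hx, hr⟩ ⟨x', r'⟩ ⟨w', hw', q', hq', v', hv', hx', hr'⟩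
      s t hs ht hst
    refine ⟨s • w + t • w', hP hw hw' hs ht hst, s • q + t • q', hQ hq hq' hs ht hst,
      s • v + t • v', V'.add_mem (V'.smul_mem _ hv) (V'.smul_mem _ hv'), ?_, ?_⟩
    · simp only at hx hx'
      simp only [Prod.fst_add, Prod.smul_fst, hx, hx', smul_add, smul_sub]
      abel
    · simp only at hr hr'
      have e : c (s • w + t • w' - wt) = s * c (w - wt) + t * c (w' - wt) := by
        have : s • w + t • w' - wt = s • (w - wt) + t • (w' - wt) := by
          rw [smul_sub, smul_sub, sub_add_sub_comm, ← add_smul, hst, one_smul]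
        rw [this]
        simp
      rw [e]
      simp only [Prod.snd_add, Prod.smul_snd, smul_eq_mul]
      rcases hs.eq_or_lt with rfl | hs
      · have : t = 1 := by linarith
        subst this
        linarith
      · nlinarith
  have h0 : (0 : E × ℝ) ∉ A := by
    rintro ⟨w, hw, q, hq, v, hv, hx, hr⟩
    have hx : 0 = w - q + v := hx
    have hr : c (w - wt) < 0 := hr
    have hvV : v ∈ V := by
      have h1 : v = (q - ws) - (w - ws) := by
        rw [eq_comm, add_eq_zero_iff_eq_neg'] at hx
        rw [hx]; abel
      rw [h1]
      exact V.sub_mem (hQV q hq) (hspan w hw)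
    have hv0 : v = 0 := Submodule.disjoint_def.1 hVV'.disjoint v hvV hv
    rw [hv0, add_zero, eq_comm, sub_eq_zero] at hx
    rw [← hx] at hq
    exact absurd (hc w hw hq) (not_le.2 hr)
  obtain ⟨f, hf, hfA⟩ := exists_ne_zero_forall_nonneg hA
    ⟨(ws - ws + 0, c (ws - wt) + 1), ws, hwsP, ws, hwsQ, 0, V'.zero_mem, rfl, by simp⟩ h0
  set η : E →ₗ[ℝ] ℝ := f ∘ₗ LinearMap.inl ℝ E ℝ
  set α := f (0, 1)
  have hfe : ∀ x r, f (x, r) = η x + r * α := fun x r => by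
    have : ((x, r) : E × ℝ) = (x, 0) + r • (0, 1) := by simp
    rw [this, map_add, map_smul]
    rfl
  have hineq : ∀ w ∈ P, ∀ q ∈ Q, ∀ v ∈ V', ∀ r, 0 < r →
      0 ≤ η (w - q) + η v + (c (w - wt) + r) * α := fun w hw q hq v hv r hr => by
    have := hfA (w - q + v, c (w - wt) + r) ⟨w, hw, q, hq, v, hv, rfl, by simpa using hr⟩
    rwa [hfe, map_add] at this
  have hα : 0 ≤ α := by
    by_contra hcon
    push Not at hcon
    obtain ⟨N, hN⟩ := exists_nat_gt (c (ws - wt) * α / -α)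
    have h1 := hineq ws hwsP ws hwsQ 0 V'.zero_mem (N + 1) (by positivity)
    rw [div_lt_iff₀ (by linarith)] at hN
    rw [sub_self, map_zero, zero_add, zero_add] at h1
    nlinarith
  have hηV' : ∀ v ∈ V', η v = 0 := by
    have key : ∀ v ∈ V', 0 ≤ η v := fun v hv => by
      by_contra hcon
      push Not at hcon
      obtain ⟨N, hN⟩ := exists_nat_gt ((c (ws - wt) + 1) * α / -η v)
      have h1 := hineq ws hwsP ws hwsQ ((N : ℝ) • v) (V'.smul_mem _ hv) 1 one_pos
      rw [div_lt_iff₀ (by linarith)] at hN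
      rw [sub_self, map_zero, zero_add, map_smul, smul_eq_mul] at h1
      linarith
    intro v hv
    have h1 := key v hv
    have h2 := key (-v) (V'.neg_mem hv)
    rw [map_neg] at h2
    linarith
  have hPQ : ∀ w ∈ P, ∀ q ∈ Q, 0 ≤ η (w - q) + c (w - wt) * α := fun w hw q hq => by
    by_contra hcon
    push Not at hcon
    set s := η (w - q) + c (w - wt) * α with hs
    have hpos : 0 < -s / (α + 1) := by
      have : 0 < -s := by linarith
      positivity
    have h1 := hineq w hw q hq 0 V'.zero_mem _ hpos
    have h2 : -s / (α + 1) * (α + 1) = -s := by field_simp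
    rw [map_zero, add_zero, add_mul, ← add_assoc, ← hs] at h1
    nlinarith
  -- If α = 0, then η ≤ 0 on Q - ws. Since ws can be left in the direction opposite to each q, η
  -- vanishes there, hence on V; it vanishes on V' too, so f would be 0.
  have hαpos : 0 < α := by
    refine lt_of_le_of_ne hα fun h => hf ?_
    have h1 : ∀ q ∈ Q, η (q - ws) = 0 := fun q hq => by
      have h2 := hPQ ws hwsP q hq
      obtain ⟨t, ht, ht0⟩ := ((hri q hq).and self_mem_nhdsWithin).exists
      have ht0 : 0 < t := ht0
      have h3 := hPQ ws hwsP _ ht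
      rw [← h, mul_zero, add_zero] at h2 h3
      have e : ws - (ws + t • (ws - q)) = t • (q - ws) := by
        rw [sub_add_cancel_left, ← smul_neg, neg_sub]
      rw [e, map_smul, smul_eq_mul] at h3
      have h4 := nonneg_of_mul_nonneg_right h3 ht0
      rw [← neg_sub, map_neg] at h2
      linarith
    have h2 : ∀ x ∈ V, η x = 0 := fun x hx => by
      have : V ≤ LinearMap.ker η := Submodule.span_le.2 (by
        rintro _ ⟨q, hq, rfl⟩
        exact h1 q hq)
      exact this hx
    refine LinearMap.ext fun ⟨x, r⟩ => ?_
    rw [hfe, ← h, mul_zero, add_zero]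
    obtain ⟨x₁, hx₁, x₂, hx₂, rfl⟩ := Submodule.mem_sup.1
      (hVV'.sup_eq_top ▸ Submodule.mem_top : x ∈ V ⊔ V')
    rw [map_add, h2 _ hx₁, hηV' _ hx₂]
    simp
  refine ⟨α⁻¹ • η, fun w hw => ?_, fun q hq => ?_⟩
  · have h1 := hPQ w hw wt hwtQ
    have h2 : c (w - wt) + (α⁻¹ • η) (w - wt) = α⁻¹ * (η (w - wt) + c (w - wt) * α) := by
      rw [LinearMap.smul_apply, smul_eq_mul]
      field_simp
      ring
    rw [h2]
    positivity
  · have h1 := hPQ wt hwtP q hq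
    rw [sub_self, map_zero, zero_mul, add_zero, ← neg_sub, map_neg] at h1
    rw [LinearMap.smul_apply, smul_eq_mul]
    exact mul_nonpos_of_nonneg_of_nonpos (by positivity) (by linarith)

variable [AddCommGroup F] [Module ℝ F]

/-- Multipliers for affine equality constraints over the intersection of a polyhedron and a convex
set, when some feasible point lies in the relative interior of the latter. -/
theorem exists_linear_multiplier {ι : Type*} [Fintype ι] {Q : Set E} (hQ : Convex ℝ Q)
    (a : ι → E →ₗ[ℝ] ℝ) (b : ι → ℝ) (H : E →ᵃ[ℝ] F) {ws wt : E}
    (hwsQ : ws ∈ Q) (hwsa : ∀ k, a k ws ≤ b k) (hwsH : H ws = 0)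
    (hri : ∀ q ∈ Q, ∀ᶠ t : ℝ in 𝓝[>] 0, ws + t • (ws - q) ∈ Q)
    (hwtQ : wt ∈ Q) (hwta : ∀ k, a k wt ≤ b k) (hwtH : H wt = 0) {c : E →ₗ[ℝ] ℝ}
    (hc : ∀ w ∈ Q, (∀ k, a k w ≤ b k) → H w = 0 → 0 ≤ c (w - wt)) :
    ∃ lam : F →ₗ[ℝ] ℝ, ∀ w ∈ Q, (∀ k, a k w ≤ b k) → 0 ≤ c (w - wt) + lam (H w) := by
  classical
  set V := Submodule.span ℝ ((fun q => q - ws) '' Q) with hV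
  have hQV : ∀ q ∈ Q, q - ws ∈ V := fun q hq => Submodule.subset_span ⟨q, hq, rfl⟩
  have hQV' : ∀ q ∈ Q, q - wt ∈ V := fun q hq => by
    have : q - wt = (q - ws) - (wt - ws) := by abel
    rw [this]
    exact V.sub_mem (hQV q hq) (hQV wt hwtQ)
  have hHlin : ∀ w v, H (w + v) = H w + H.linear v := fun w v => by
    have := H.map_vadd w v
    simp only [vadd_eq_add] at this
    rw [add_comm, this, add_comm]
  -- The affine hull ws + V of Q is made part of P, as the splitting lemma requires. The linear
  -- constraints collected in P need no interior point; relative interiority is asked of Q alone.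
  set P : Set E := {w | (∀ k, a k w ≤ b k) ∧ H w = 0 ∧ w - ws ∈ V} with hPdef
  have hP : Convex ℝ P := by
    rintro w ⟨h1, h2, h3⟩ w' ⟨h1', h2', h3'⟩ s t hs ht hst
    refine ⟨fun k => ?_, ?_, ?_⟩
    · rw [map_add, map_smul, map_smul, smul_eq_mul, smul_eq_mul]
      calc s * a k w + t * a k w' ≤ s * b k + t * b k := by
            have := h1 k
            have := h1' k
            gcongr
        _ = b k := by rw [← add_mul, hst, one_mul]
    · rw [Convex.combo_affine_apply hst, h2, h2']
      simp
    · have : s • w + t • w' - ws = s • (w - ws) + t • (w' - ws) := by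
        rw [smul_sub, smul_sub, sub_add_sub_comm, ← add_smul, hst, one_smul]
      rw [this]
      exact V.add_mem (V.smul_mem _ h3) (V.smul_mem _ h3')
  obtain ⟨η, hηP, hηQ⟩ := exists_split_of_nonneg_inter hP hQ
    ⟨hwsa, hwsH, by simp⟩ hwsQ hri (fun w hw => hw.2.2) ⟨hwta, hwtH, hQV wt hwtQ⟩ hwtQ
    (fun w hw hwQ => hc w hwQ hw.1 hw.2.1)
  -- Farkas' lemma for the active constraints on the subspace `V ∩ ker H`
  set a' : ι → E →ₗ[ℝ] ℝ := fun k => if a k wt = b k then a k else 0 with ha'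
  have ha'le : ∀ k w, a k w ≤ b k → a' k (w - wt) ≤ 0 := fun k w hw => by
    simp only [ha']
    split_ifs with h
    · rw [map_sub, h]
      linarith
    · simp
  set S := V ⊓ LinearMap.ker H.linear with hS
  obtain ⟨ν, hν, hνd⟩ := farkas (fun k => (a' k) ∘ₗ S.subtype) (-(c + η) ∘ₗ S.subtype)
    fun ⟨x, hxV, hxH⟩ hx => by
      have hx' : ∀ k, a' k x ≤ 0 := hx
      have hxH : H.linear x = 0 := hxH
      -- A direction that respects the active constraints can be followed for a short time: inactive
      -- constraints have slack at wt.
      have hev : ∀ᶠ t : ℝ in 𝓝[>] 0, wt + t • x ∈ P := by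
        have h1 : ∀ᶠ t : ℝ in 𝓝[>] 0, ∀ k, a k (wt + t • x) ≤ b k := by
          rw [eventually_all]
          intro k
          by_cases hk : a k wt = b k
          · filter_upwards [self_mem_nhdsWithin] with t ht
            have := hx' k
            simp only [ha', if_pos hk] at this
            rw [map_add, map_smul, hk, smul_eq_mul]
            have := mul_nonpos_of_nonneg_of_nonpos (le_of_lt ht) this
            linarith
          · have hlt : a k wt < b k := lt_of_le_of_ne (hwta k) hk
            have hcont : ContinuousAt (fun t : ℝ => a k (wt + t • x)) 0 := by
              simp only [map_add, map_smul]
              fun_prop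
            refine ((hcont.eventually (gt_mem_nhds ?_)).mono fun t ht => le_of_lt ht).filter_mono
              nhdsWithin_le_nhds
            simpa using hlt
        filter_upwards [h1] with t ht
        refine ⟨ht, ?_, ?_⟩
        · rw [hHlin, hwtH, map_smul, hxH, smul_zero, zero_add]
        · have : wt + t • x - ws = (wt - ws) + t • x := by abel
          rw [this]
          exact V.add_mem (hQV wt hwtQ) (V.smul_mem _ hxV)
      obtain ⟨t, htP, ht⟩ := (hev.and self_mem_nhdsWithin).exists
      have ht : 0 < t := ht
      have h2 := hηP _ htP
      rw [add_sub_cancel_left, map_smul, map_smul, smul_eq_mul, smul_eq_mul, ← mul_add] at h2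
      have h3 := nonneg_of_mul_nonneg_right h2 ht
      simp only [LinearMap.neg_apply, LinearMap.comp_apply,
        Submodule.subtype_apply, LinearMap.add_apply]
      linarith
  -- the resulting functional vanishes on `V ∩ ker H`, so on `V` it factors through `H`
  set φ : E →ₗ[ℝ] ℝ := c + η + ∑ k, ν k • a' k with hφ
  have hφS : ∀ x ∈ V, H.linear x = 0 → φ x = 0 := fun x hxV hxH => by
    have := LinearMap.congr_fun hνd ⟨x, hxV, hxH⟩
    simp only [LinearMap.neg_apply, LinearMap.comp_apply,
      Submodule.subtype_apply, LinearMap.add_apply, LinearMap.sum_apply,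
      LinearMap.smul_apply] at this
    simp only [hφ, LinearMap.add_apply, LinearMap.sum_apply, LinearMap.smul_apply]
    linarith
  have hfac : φ ∘ₗ V.subtype ∈ LinearMap.range (H.linear ∘ₗ V.subtype).dualMap := by
    rw [LinearMap.range_dualMap_eq_dualAnnihilator_ker, Submodule.mem_dualAnnihilator]
    rintro ⟨x, hxV⟩ hx
    exact hφS x hxV hx
  obtain ⟨κ, hκ⟩ := hfac
  refine ⟨-κ, fun w hwQ hwa => ?_⟩
  have h1 : φ (w - wt) = κ (H w) := by
    have h2 := LinearMap.congr_fun hκ ⟨w - wt, hQV' w hwQ⟩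
    have h3 : H w = H.linear (w - wt) := by
      have := hHlin wt (w - wt)
      rwa [add_sub_cancel, hwtH, zero_add] at this
    rw [h3]
    exact h2.symm
  have h2 : ∑ k, ν k * a' k (w - wt) ≤ 0 := Finset.sum_nonpos fun k _ =>
    mul_nonpos_of_nonneg_of_nonpos (hν k) (ha'le k w (hwa k))
  have h3 := hηQ w hwQ
  simp only [hφ, LinearMap.add_apply, LinearMap.sum_apply, LinearMap.smul_apply,
    smul_eq_mul] at h1
  rw [LinearMap.neg_apply]
  linarith

end LinearMultipliers

/-- A point of the relative interior can be left in the direction opposite to any point of the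
set. -/
theorem eventually_add_smul_mem_of_mem_intrinsicInterior {E : Type*} [NormedAddCommGroup E]
    [NormedSpace ℝ E] {K : Set E} {x : E} (hx : x ∈ intrinsicInterior ℝ K) {q : E} (hq : q ∈ K) :
    ∀ᶠ t : ℝ in 𝓝[>] 0, x + t • (x - q) ∈ K := by
  obtain ⟨⟨y, hyA⟩, hy, rfl⟩ := mem_intrinsicInterior.1 hx
  have hqA : q ∈ affineSpan ℝ K := subset_affineSpan ℝ K hq
  have hmem : ∀ t : ℝ, y + t • (y - q) ∈ affineSpan ℝ K := fun t => by
    have h1 := AffineMap.lineMap_mem (-t) hyA hqA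
    have h2 : AffineMap.lineMap y q (-t) = y + t • (y - q) := by
      rw [AffineMap.lineMap_apply, vsub_eq_sub, vadd_eq_add, neg_smul, ← smul_neg, neg_sub, add_comm]
    rwa [h2] at h1
  have hcont : Continuous fun t : ℝ => (⟨y + t • (y - q), hmem t⟩ : affineSpan ℝ K) := by
    fun_prop
  have hev : ∀ᶠ t : ℝ in 𝓝 0, (⟨y + t • (y - q), hmem t⟩ : affineSpan ℝ K) ∈
      ((↑) ⁻¹' K : Set (affineSpan ℝ K)) := by
    refine (hcont.tendsto 0).eventually_mem ?_
    have : (⟨y + (0 : ℝ) • (y - q), hmem 0⟩ : affineSpan ℝ K) = ⟨y, hyA⟩ := by simp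
    rw [this]
    exact mem_interior_iff_mem_nhds.1 hy
  exact hev.filter_mono nhdsWithin_le_nhds


/-! ### First-order conditions within convex sets -/

section FirstOrder

variable {E : Type*} [NormedAddCommGroup E] [InnerProductSpace ℝ E] [CompleteSpace E]

/-- Convexity keeps the segment from x to y inside K, so the gradient within K determines the right
derivative along it even if x is a boundary point. -/
theorem tendsto_slope_of_hasGradientWithinAt {K : Set E} (hK : Convex ℝ K) {f : E → ℝ} {f' x y : E}
    (hx : x ∈ K) (hy : y ∈ K) (hf : HasGradientWithinAt f f' K x) :
    Tendsto (fun t : ℝ => t⁻¹ * (f (x + t • (y - x)) - f x)) (𝓝[>] 0)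
      (𝓝 (inner ℝ f' (y - x))) := by
  have h1 : HasDerivWithinAt (fun t : ℝ => x + t • (y - x)) (y - x) (Icc 0 1) 0 := by
    have := (((hasDerivAt_id (0 : ℝ)).smul_const (y - x)).const_add x).hasDerivWithinAt
      (s := Icc (0 : ℝ) 1)
    simpa using this
  have h2 : HasFDerivWithinAt f ((InnerProductSpace.toDual ℝ E) f') K (x + (0 : ℝ) • (y - x)) := by
    simpa using hf.hasFDerivWithinAt
  have h3 := h2.comp_hasDerivWithinAt (0 : ℝ) h1 fun t ht => hK.add_smul_sub_mem hx hy ht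
  rw [hasDerivWithinAt_iff_tendsto_slope] at h3
  have h4 : 𝓝[>] (0 : ℝ) ≤ 𝓝[Icc 0 1 \ {0}] 0 := by
    rw [← nhdsWithin_Ioo_eq_nhdsGT (show (0 : ℝ) < 1 by norm_num)]
    exact nhdsWithin_mono _ fun t ht => ⟨⟨ht.1.le, ht.2.le⟩, ht.1.ne'⟩
  refine (h3.mono_left h4).congr fun t => ?_
  simp [slope_def_field, div_eq_inv_mul]

theorem _root_.ConvexOn.add_inner_le_of_hasGradientWithinAt {K : Set E} {f : E → ℝ} (hf : ConvexOn ℝ K f)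
    {f' x y : E} (hx : x ∈ K) (hy : y ∈ K) (hf' : HasGradientWithinAt f f' K x) :
    f x + inner ℝ f' (y - x) ≤ f y := by
  have h := le_of_tendsto (tendsto_slope_of_hasGradientWithinAt hf.1 hx hy hf')
    (b := f y - f x) (by
      filter_upwards [Ioo_mem_nhdsGT (show (0 : ℝ) < 1 by norm_num)] with t ht
      rw [inv_mul_le_iff₀ ht.1]
      have h1 := hf.2 hx hy (sub_nonneg.2 ht.2.le) ht.1.le (by ring)
      have h2 : (1 - t) • x + t • y = x + t • (y - x) := by
        rw [sub_smul, one_smul, smul_sub]; abel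
      rw [h2, smul_eq_mul, smul_eq_mul] at h1
      linarith)
  linarith

end FirstOrder

/-! ### The constraint sets of the game and its Karush-Kuhn-Tucker system -/

namespace Game

variable {N : ℕ} {n : Fin N → ℕ} {m l : ℕ} {g : Game n m l} {gF : Joint n → Joint n}
  {gG : Fin l → Joint n → Joint n}

theorem Regular.isClosed_prodW (hg : g.Regular gF gG) : IsClosed g.prodW := by
  have : g.prodW = ⋂ i, (fun w : Joint n => w i) ⁻¹' g.W i := by
    ext w
    simp [prodW]
  rw [this]
  exact isClosed_iInter fun i => (hg.closed i).preimage (by fun_prop)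

theorem Regular.convex_prodW (hg : g.Regular gF gG) : Convex ℝ g.prodW :=
  fun _ hw _ hw' _ _ hs ht hst i => hg.convex i (hw i) (hw' i) hs ht hst

theorem convex_orthant (l : ℕ) : Convex ℝ (orthant l) :=
  fun v hv v' hv' s t hs ht _ j => by
    have h1 : 0 ≤ s * v j := mul_nonneg hs (hv j)
    have h2 : 0 ≤ t * v' j := mul_nonneg ht (hv' j)
    simpa using add_nonneg h1 h2

theorem isClosed_orthant (l : ℕ) : IsClosed (orthant l) := by
  have : orthant l = ⋂ j, {v : EuclideanSpace ℝ (Fin l) | 0 ≤ v j} := by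
    ext v
    simp [orthant]
  rw [this]
  exact isClosed_iInter fun j => isClosed_le continuous_const (by fun_prop)

theorem H_add (w v : Joint n) : g.H (w + v) = g.H w + g.H.linear v := by
  have := g.H.map_vadd w v
  simp only [vadd_eq_add] at this
  rw [add_comm, this, add_comm]

/-- Lagrange multipliers of a solution of the variational inequality over the feasible set. -/
theorem Regular.exists_multipliers (hg : g.Regular gF gG) {wt : Joint n}
    (hwt : SolvesGVI g.feasible gF wt) :
    ∃ (lam : EuclideanSpace ℝ (Fin m)) (mu : EuclideanSpace ℝ (Fin l)), mu ∈ orthant l ∧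
      ∀ w ∈ g.prodW, 0 ≤ inner ℝ (gF wt) (w - wt) + ∑ j, lam j * g.H w j + ∑ j, mu j * g.G w j := by
  classical
  obtain ⟨⟨hwtW, hwtH, hwtG⟩, hvi⟩ := hwt
  obtain ⟨ws, hwsW, hwsH, hwsG, hwsri⟩ := hg.slater
  set X : Set (Joint n) := {w | w ∈ g.prodW ∧ g.H w = 0} with hX
  have hXcv : Convex ℝ X := fun w hw w' hw' s t hs ht hst => by
    refine ⟨hg.convex_prodW hw.1 hw'.1 hs ht hst, ?_⟩
    rw [Convex.combo_affine_apply hst, hw.2, hw'.2]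
    simp
  have hXsub : X ⊆ g.prodW := fun w hw => hw.1
  have hℓ : ConvexOn ℝ X fun w => inner ℝ (gF wt) (w - wt) := by
    refine ⟨hXcv, fun w _ w' _ s t _ _ hst => le_of_eq ?_⟩
    have : s • w + t • w' - wt = s • (w - wt) + t • (w' - wt) := by
      rw [smul_sub, smul_sub, sub_add_sub_comm, ← add_smul, hst, one_smul]
    simp only [this, inner_add_right, real_inner_smul_right, smul_eq_mul]
  -- The inequality constraints are removed first, over W ∩ {H = 0}. Linearizing at wt afterwards
  -- leaves a linear objective, for which the equality constraints can be treated by polyhedral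
  -- duality.
  obtain ⟨mu, hmu, hL⟩ := exists_multipliers_of_slater (G := fun w j => g.G w j) hℓ
    (fun j => (hg.convex_G j).subset hXsub hXcv) ⟨hwsW, hwsH⟩ hwsG
    (fun w hw hwG => by
      rw [real_inner_comm]
      exact hvi w ⟨hw.1, hw.2, hwG⟩)
  have hcompl : ∑ j, mu j * g.G wt j = 0 := by
    have h1 := hL wt ⟨hwtW, hwtH⟩
    rw [sub_self, inner_zero_right, zero_add] at h1
    exact le_antisymm (Finset.sum_nonpos fun j _ =>
      mul_nonpos_of_nonneg_of_nonpos (hmu j) (hwtG j)) h1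
  -- first-order condition at `wt` over `W ∩ {H = 0}`
  set c : Joint n := gF wt + ∑ j, mu j • gG j wt with hcdef
  have hcinner : ∀ v, inner ℝ c v = inner ℝ (gF wt) v + ∑ j, mu j * inner ℝ (gG j wt) v :=
    fun v => by
      rw [hcdef, inner_add_left, sum_inner]
      simp only [real_inner_smul_left]
  have hfirst : ∀ w ∈ X, 0 ≤ inner ℝ c (w - wt) := fun w hw => by
    have hlim : Tendsto (fun t : ℝ => inner ℝ (gF wt) (w - wt) +
        ∑ j, mu j * (t⁻¹ * (g.G (wt + t • (w - wt)) j - g.G wt j))) (𝓝[>] 0)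
        (𝓝 (inner ℝ c (w - wt))) := by
      rw [hcinner]
      exact tendsto_const_nhds.add (tendsto_finsetSum _ fun j _ =>
        (tendsto_slope_of_hasGradientWithinAt hg.convex_prodW hwtW hw.1
          (hg.grad_G j wt hwtW)).const_mul _)
    refine ge_of_tendsto hlim ?_
    filter_upwards [Ioo_mem_nhdsGT (show (0 : ℝ) < 1 by norm_num)] with t ht
    have h1 := hL _ (hXcv.add_smul_sub_mem ⟨hwtW, hwtH⟩ hw ⟨ht.1.le, ht.2.le⟩)
    rw [add_sub_cancel_left, real_inner_smul_right] at h1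
    have h2 : inner ℝ (gF wt) (w - wt) +
        ∑ j, mu j * (t⁻¹ * (g.G (wt + t • (w - wt)) j - g.G wt j)) =
        t⁻¹ * (t * inner ℝ (gF wt) (w - wt) + ∑ j, mu j * g.G (wt + t • (w - wt)) j
          - ∑ j, mu j * g.G wt j) := by
      have ht0 := ht.1.ne'
      rw [add_sub_assoc, mul_add, inv_mul_cancel_left₀ ht0, ← Finset.sum_sub_distrib,
        Finset.mul_sum]
      congr 1
      exact Finset.sum_congr rfl fun j _ => by ring
    rw [h2, hcompl, sub_zero]
    exact mul_nonneg (inv_nonneg.2 ht.1.le) h1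
  -- multipliers for the affine constraints
  let I := {i : Fin N // IsPolyhedral (g.W i)}
  have hpoly : ∀ i : I, ∃ (p : ℕ) (a : Fin p → Dec (n i)) (b : Fin p → ℝ),
      g.W i = {x | ∀ k, inner ℝ (a k) x ≤ b k} := fun i => i.2
  choose p a b hab using hpoly
  -- The non-polyhedral factors form Q; the half-spaces of the polyhedral factors become the
  -- constraints a, b. Thus the Slater point may lie on the boundary of a polyhedral factor.
  set Q : Set (Joint n) := {w | ∀ i, ¬ IsPolyhedral (g.W i) → w i ∈ g.W i} with hQdef
  have hWQ : ∀ w, w ∈ g.prodW ↔ w ∈ Q ∧ ∀ k : Σ i : I, Fin (p i),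
      ((innerₗ (Dec (n k.1)) (a k.1 k.2)) ∘ₗ (PiLp.projₗ 2 (𝕜 := ℝ) (fun i => Dec (n i)) k.1)) w
        ≤ b k.1 k.2 := fun w => by
    constructor
    · intro hw
      refine ⟨fun i _ => hw i, fun ⟨i, k⟩ => ?_⟩
      have := hw i
      rw [hab i] at this
      exact this k
    · rintro ⟨h1, h2⟩ i
      by_cases hi : IsPolyhedral (g.W i)
      · have : w i ∈ g.W (⟨i, hi⟩ : I).1 := by
          rw [hab ⟨i, hi⟩]
          exact fun k => h2 ⟨⟨i, hi⟩, k⟩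
        exact this
      · exact h1 i hi
  have hQcv : Convex ℝ Q := fun w hw w' hw' s t hs ht hst i hi =>
    hg.convex i (hw i hi) (hw' i hi) hs ht hst
  have hri : ∀ q ∈ Q, ∀ᶠ t : ℝ in 𝓝[>] 0, ws + t • (ws - q) ∈ Q := fun q hq => by
    have : ∀ᶠ t : ℝ in 𝓝[>] 0, ∀ i, ¬ IsPolyhedral (g.W i) →
        ws i + t • (ws i - q i) ∈ g.W i := by
      rw [eventually_all]
      intro i
      by_cases hi : IsPolyhedral (g.W i)
      · exact Eventually.of_forall fun t h => absurd hi h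
      · filter_upwards [eventually_add_smul_mem_of_mem_intrinsicInterior
          ((hwsri i).resolve_left hi) (hq i hi)] with t ht _ using ht
    filter_upwards [this] with t ht i hi using ht i hi
  obtain ⟨hwsQ, hwsa⟩ := (hWQ ws).1 hwsW
  obtain ⟨hwtQ, hwta⟩ := (hWQ wt).1 hwtW
  obtain ⟨κ, hκ⟩ := exists_linear_multiplier hQcv _ _ g.H hwsQ hwsa hwsH hri hwtQ hwta hwtH
    (c := innerₗ (Joint n) c) fun w hwQ hwa hwH => hfirst w ⟨(hWQ w).2 ⟨hwQ, hwa⟩, hwH⟩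
  refine ⟨WithLp.toLp 2 fun j => κ (EuclideanSpace.single j 1), WithLp.toLp 2 mu, hmu,
    fun w hw => ?_⟩
  have h1 := hκ w ((hWQ w).1 hw).1 ((hWQ w).1 hw).2
  have h2 : κ (g.H w) = ∑ j, κ (EuclideanSpace.single j 1) * g.H w j := by
    conv_lhs => rw [← (EuclideanSpace.basisFun (Fin m) ℝ).sum_repr (g.H w)]
    rw [map_sum]
    refine Finset.sum_congr rfl fun j _ => ?_
    rw [map_smul, smul_eq_mul, mul_comm]
    simp
  -- Convexity undoes the linearization: the gradient terms are replaced by the values of G, and the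
  -- values at wt cancel by complementarity.
  have h3 : ∀ j, mu j * g.G wt j + mu j * inner ℝ (gG j wt) (w - wt) ≤ mu j * g.G w j :=
    fun j => by
      rw [← mul_add]
      exact mul_le_mul_of_nonneg_left
        ((hg.convex_G j).add_inner_le_of_hasGradientWithinAt hwtW hw
          (hg.grad_G j wt hwtW)) (hmu j)
  have h4 := Finset.sum_le_sum fun j (_ : j ∈ Finset.univ) => h3 j
  rw [Finset.sum_add_distrib, hcompl, zero_add] at h4
  rw [innerₗ_apply_apply, hcinner, h2] at h1
  show 0 ≤ inner ℝ (gF wt) (w - wt) + ∑ j, κ (EuclideanSpace.single j 1) * g.H w j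
    + ∑ j, mu j * g.G w j
  linarith

end Game

end LinearVE

noncomputable section

namespace LinearVE

/-! ### Sums and products of Lipschitz maps on compact sets -/

section LipschitzOn

open scoped NNReal

variable {X E : Type*} [PseudoMetricSpace X] [NormedAddCommGroup E] {S : Set X}

theorem exists_lipschitzOnWith_sum {ι : Type*} {s : Finset ι} {f : ι → X → E}
    (h : ∀ i ∈ s, ∃ L, LipschitzOnWith L (f i) S) :
    ∃ L, LipschitzOnWith L (fun x => ∑ i ∈ s, f i x) S := by
  classical
  induction s using Finset.induction_on with
  | empty => exact ⟨0, by simp⟩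
  | insert i s hi ih =>
    obtain ⟨L₁, h₁⟩ := h i (Finset.mem_insert_self i s)
    obtain ⟨L₂, h₂⟩ := ih fun j hj => h j (Finset.mem_insert_of_mem hj)
    refine ⟨L₁ + L₂, ?_⟩
    simp only [Finset.sum_insert hi]
    exact h₁.add h₂

theorem exists_lipschitzOnWith_smul [NormedSpace ℝ E] (hS : IsCompact S) {a : X → ℝ} {v : X → E}
    (ha : ∃ L, LipschitzOnWith L a S) (hv : ∃ L, LipschitzOnWith L v S) :
    ∃ L, LipschitzOnWith L (fun x => a x • v x) S := by
  obtain ⟨La, ha⟩ := ha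
  obtain ⟨Lv, hv⟩ := hv
  obtain ⟨Ba, hBa⟩ := hS.exists_bound_of_continuousOn ha.continuousOn
  obtain ⟨Bv, hBv⟩ := hS.exists_bound_of_continuousOn hv.continuousOn
  refine ⟨Real.toNNReal (Ba * Lv + La * Bv), LipschitzOnWith.of_dist_le_mul fun x hx y hy => ?_⟩
  have h1 : dist (a x • v x) (a y • v y) ≤ (Ba * Lv + La * Bv) * dist x y := by
    rw [dist_eq_norm]
    have e : a x • v x - a y • v y = a x • (v x - v y) + (a x - a y) • v y := by
      rw [smul_sub, sub_smul]; abel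
    rw [e]
    refine (norm_add_le _ _).trans ?_
    rw [norm_smul, norm_smul, add_mul]
    have h2 := ha.dist_le_mul x hx y hy
    have h3 := hv.dist_le_mul x hx y hy
    rw [dist_eq_norm] at h2 h3
    refine add_le_add ?_ ?_
    · rw [mul_assoc]
      exact mul_le_mul (hBa x hx) h3 (norm_nonneg _) ((norm_nonneg _).trans (hBa x hx))
    · calc ‖a x - a y‖ * ‖v y‖ ≤ (La * dist x y) * Bv :=
            mul_le_mul h2 (hBv y hy) (norm_nonneg _) (by positivity)
        _ = La * Bv * dist x y := by ring
  refine h1.trans ?_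
  gcongr
  exact Real.le_coe_toNNReal _

end LipschitzOn

/-! ### The primal-dual variables and their vector field -/

namespace Game

variable {N : ℕ} {n : Fin N → ℕ} {m l : ℕ} {g : Game n m l} {gF : Joint n → Joint n}
  {gG : Fin l → Joint n → Joint n}

/-- The space of primal-dual variables `(w, λ, μ)` with its Euclidean structure. -/
abbrev PrimalDual (n : Fin N → ℕ) (m l : ℕ) : Type :=
  WithLp 2 (Joint n × WithLp 2 (EuclideanSpace ℝ (Fin m) × EuclideanSpace ℝ (Fin l)))

/-- `(w, λ, μ)` as a primal-dual variable. -/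
def mkPD (w : Joint n) (lam : EuclideanSpace ℝ (Fin m)) (mu : EuclideanSpace ℝ (Fin l)) :
    PrimalDual n m l :=
  WithLp.toLp 2 (w, WithLp.toLp 2 (lam, mu))

@[simp] theorem mkPD_fst (w : Joint n) (lam : EuclideanSpace ℝ (Fin m))
    (mu : EuclideanSpace ℝ (Fin l)) : (mkPD w lam mu).fst = w := rfl

theorem inner_primalDual (x y : PrimalDual n m l) :
    inner ℝ x y = inner ℝ x.fst y.fst + inner ℝ x.snd.fst y.snd.fst
      + inner ℝ x.snd.snd y.snd.snd := by
  rw [WithLp.prod_inner_apply, WithLp.prod_inner_apply, add_assoc]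
  rfl

theorem norm_sq_primalDual (x : PrimalDual n m l) :
    ‖x‖ ^ 2 = ‖x.fst‖ ^ 2 + ‖x.snd.fst‖ ^ 2 + ‖x.snd.snd‖ ^ 2 := by
  rw [WithLp.prod_norm_sq_eq_of_L2, WithLp.prod_norm_sq_eq_of_L2, add_assoc]

/-- Embedding of the primal variables. -/
def inW (n : Fin N → ℕ) (m l : ℕ) : Joint n →L[ℝ] PrimalDual n m l :=
  (WithLp.prodContinuousLinearEquiv 2 ℝ _ _).symm.toContinuousLinearMap ∘L
    ContinuousLinearMap.inl ℝ _ _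

/-- Embedding of the multipliers of the equality constraints. -/
def inLam (n : Fin N → ℕ) (m l : ℕ) : EuclideanSpace ℝ (Fin m) →L[ℝ] PrimalDual n m l :=
  (WithLp.prodContinuousLinearEquiv 2 ℝ _ _).symm.toContinuousLinearMap ∘L
    ContinuousLinearMap.inr ℝ _ _ ∘L
    (WithLp.prodContinuousLinearEquiv 2 ℝ _ _).symm.toContinuousLinearMap ∘L
    ContinuousLinearMap.inl ℝ _ _

/-- Embedding of the multipliers of the inequality constraints. -/
def inMu (n : Fin N → ℕ) (m l : ℕ) : EuclideanSpace ℝ (Fin l) →L[ℝ] PrimalDual n m l :=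
  (WithLp.prodContinuousLinearEquiv 2 ℝ _ _).symm.toContinuousLinearMap ∘L
    ContinuousLinearMap.inr ℝ _ _ ∘L
    (WithLp.prodContinuousLinearEquiv 2 ℝ _ _).symm.toContinuousLinearMap ∘L
    ContinuousLinearMap.inr ℝ _ _

theorem mkPD_eq (w : Joint n) (lam : EuclideanSpace ℝ (Fin m)) (mu : EuclideanSpace ℝ (Fin l)) :
    mkPD w lam mu = inW n m l w + inLam n m l lam + inMu n m l mu := by
  simp only [mkPD, inW, inLam, inMu, ContinuousLinearMap.comp_apply,
    ContinuousLinearMap.inl_apply, ContinuousLinearMap.inr_apply,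
    ContinuousLinearEquiv.coe_coe, WithLp.prodContinuousLinearEquiv_symm_apply,
    ← WithLp.toLp_add, Prod.mk_add_mk, add_zero, zero_add]

variable (g gF gG) in
/-- The unprojected primal-dual field. -/
def pdField (y : PrimalDual n m l) : PrimalDual n m l :=
  mkPD (-(g.gradLagrangian gF gG y.fst y.snd.fst y.snd.snd)) (g.H y.fst) (g.G y.fst)

variable (g) in
/-- `W × ℝᵐ × ℝ₊ˡ`. -/
def pdSet : Set (PrimalDual n m l) := {y | y.fst ∈ g.prodW ∧ y.snd.snd ∈ orthant l}

theorem Regular.isClosed_pdSet (hg : g.Regular gF gG) : IsClosed g.pdSet :=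
  (hg.isClosed_prodW.preimage (WithLp.fstL 2 ℝ _ _).continuous).inter
    ((isClosed_orthant l).preimage
      ((WithLp.sndL 2 ℝ _ _).continuous.comp (WithLp.sndL 2 ℝ _ _).continuous))

theorem Regular.convex_pdSet (hg : g.Regular gF gG) : Convex ℝ g.pdSet :=
  fun _ hy _ hy' _ _ hs ht hst =>
    ⟨hg.convex_prodW hy.1 hy'.1 hs ht hst, convex_orthant l hy.2 hy'.2 hs ht hst⟩

theorem hasGradientAt_H (j : Fin m) (w : Joint n) :
    HasGradientAt (fun w' => g.H w' j) ((InnerProductSpace.toDual ℝ (Joint n)).symm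
      (EuclideanSpace.proj j ∘L LinearMap.toContinuousLinearMap g.H.linear)) w := by
  rw [hasGradientAt_iff_hasFDerivAt, LinearIsometryEquiv.apply_symm_apply]
  have h := ((EuclideanSpace.proj (𝕜 := ℝ) j ∘L
    LinearMap.toContinuousLinearMap g.H.linear).hasFDerivAt (x := w)).add_const (g.H 0 j)
  refine h.congr_of_eventuallyEq (Eventually.of_forall fun w' => ?_)
  have h1 := H_add (g := g) 0 w'
  rw [zero_add] at h1
  simp only [h1]
  simp [add_comm]

theorem inner_gradient_H (j : Fin m) (w v : Joint n) :
    inner ℝ (gradient (fun w' => g.H w' j) w) v = g.H.linear v j := by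
  rw [(hasGradientAt_H j w).gradient, InnerProductSpace.toDual_symm_apply]
  rfl

/-- The primal-dual field points towards every primal-dual solution. -/
theorem Regular.inner_sub_pdField_le (hg : g.Regular gF gG) {wt : Joint n}
    (hwt : wt ∈ g.feasible) {lam : EuclideanSpace ℝ (Fin m)} {mu : EuclideanSpace ℝ (Fin l)}
    (hkkt : ∀ w ∈ g.prodW,
      0 ≤ inner ℝ (gF wt) (w - wt) + ∑ j, lam j * g.H w j + ∑ j, mu j * g.G w j)
    {y : PrimalDual n m l} (hy : y ∈ g.pdSet) :
    inner ℝ (y - mkPD wt lam mu) (pdField g gF gG y) ≤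
      -inner ℝ (y.fst - wt) (gF y.fst - gF wt) := by
  obtain ⟨hwtW, hwtH, hwtG⟩ := hwt
  obtain ⟨hyW, hymu⟩ := hy
  set w := y.fst with hw
  set la := y.snd.fst with hla
  set nu := y.snd.snd with hnu
  have hHw : g.H.linear (w - wt) = g.H w := by
    have := H_add (g := g) wt (w - wt)
    rw [add_sub_cancel, hwtH, zero_add] at this
    exact this.symm
  have e1 : inner ℝ (w - wt) (g.gradLagrangian gF gG w la nu) = inner ℝ (w - wt) (gF w)
      + ∑ j, la j * g.H w j + ∑ j, nu j * inner ℝ (gG j w) (w - wt) := by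
    rw [gradLagrangian, inner_add_right, inner_add_right, inner_sum, inner_sum]
    congr 1
    · congr 1
      refine Finset.sum_congr rfl fun j _ => ?_
      rw [real_inner_smul_right, real_inner_comm, inner_gradient_H, hHw]
    · refine Finset.sum_congr rfl fun j _ => ?_
      rw [real_inner_smul_right, real_inner_comm]
  have e2 : inner ℝ (la - lam) (g.H w) = ∑ j, la j * g.H w j - ∑ j, lam j * g.H w j := by
    rw [inner_sub_left, PiLp.inner_apply, PiLp.inner_apply]
    simp [mul_comm]
  have e3 : inner ℝ (nu - mu) (g.G w) = ∑ j, nu j * g.G w j - ∑ j, mu j * g.G w j := by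
    rw [inner_sub_left, PiLp.inner_apply, PiLp.inner_apply]
    simp [mul_comm]
  -- Convexity and G(wt) ≤ 0 give G_j(w) ≤ ⟨∇G_j(w), w - wt⟩, and the weights nu are nonnegative.
  -- The terms in la cancel exactly, and the multiplier inequality `hkkt` at w absorbs those in lam
  -- and mu.
  have e4 : ∑ j, nu j * g.G w j ≤ ∑ j, nu j * inner ℝ (gG j w) (w - wt) := by
    refine Finset.sum_le_sum fun j _ => ?_
    have h1 := (hg.convex_G j).add_inner_le_of_hasGradientWithinAt hyW hwtW (hg.grad_G j w hyW)
    rw [← neg_sub w wt, inner_neg_right] at h1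
    exact mul_le_mul_of_nonneg_left (by linarith [hwtG j]) (hymu j)
  have h5 := hkkt w hyW
  rw [inner_primalDual]
  have e5 : inner ℝ (y - mkPD wt lam mu).fst (pdField g gF gG y).fst
      = -inner ℝ (w - wt) (g.gradLagrangian gF gG w la nu) := by
    rw [← inner_neg_right]
    rfl
  have e6 : inner ℝ (y - mkPD wt lam mu).snd.fst (pdField g gF gG y).snd.fst
      = inner ℝ (la - lam) (g.H w) := rfl
  have e7 : inner ℝ (y - mkPD wt lam mu).snd.snd (pdField g gF gG y).snd.snd
      = inner ℝ (nu - mu) (g.G w) := rfl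
  rw [e5, e6, e7, e1, e2, e3, inner_sub_right, real_inner_comm (gF wt)]
  rw [real_inner_comm] at h5
  rw [real_inner_comm (w - wt) (gF wt)]
  linarith

theorem Regular.exists_lipschitzOnWith_pdField (hg : g.Regular gF gG) (z : PrimalDual n m l)
    (R : ℝ) : ∃ L, LipschitzOnWith L (pdField g gF gG) (g.pdSet ∩ Metric.closedBall z R) := by
  set S := g.pdSet ∩ Metric.closedBall z R with hS
  have hcomp : IsCompact S := (isCompact_closedBall z R).inter_left hg.isClosed_pdSet
  set S₁ : Set (Joint n) := WithLp.fst '' S with hS₁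
  have hcomp₁ : IsCompact S₁ := hcomp.image (WithLp.fstL 2 ℝ _ _).continuous
  have hS₁W : S₁ ⊆ g.prodW := by
    rintro _ ⟨y, hy, rfl⟩
    exact hy.1.1
  have hfst : LipschitzWith 1 (WithLp.fst : PrimalDual n m l → Joint n) :=
    LipschitzWith.of_dist_le_mul fun x y => by simpa using WithLp.dist_fst_le x y
  have hpull : ∀ {F : Type} [NormedAddCommGroup F] [NormedSpace ℝ F] {φ : Joint n → F},
      (∃ L, LipschitzOnWith L φ S₁) → ∃ L, LipschitzOnWith L (fun y => φ y.fst) S := by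
    rintro F _ _ φ ⟨L, hL⟩
    exact ⟨L * 1, hL.comp (hfst.lipschitzOnWith (s := S)) (mapsTo_image _ _)⟩
  have hgF : ∃ L, LipschitzOnWith L (fun y : PrimalDual n m l => gF y.fst) S :=
    hpull ((hg.lip_f.mono hS₁W).exists_lipschitzOnWith_of_compact hcomp₁)
  have hgG : ∀ j, ∃ L, LipschitzOnWith L (gG j) S₁ := fun j =>
    ((hg.lip_G j).mono hS₁W).exists_lipschitzOnWith_of_compact hcomp₁
  have hG : ∀ j, ∃ L, LipschitzOnWith L (fun w => g.G w j) S₁ := fun j => by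
    obtain ⟨L, hL⟩ := hgG j
    obtain ⟨B, hB⟩ := hcomp₁.exists_bound_of_continuousOn hL.continuousOn
    refine ⟨Real.toNNReal B, LipschitzOnWith.of_dist_le_mul fun x hx y hy => ?_⟩
    rw [Real.coe_toNNReal _ ((norm_nonneg _).trans (hB x hx)), Real.dist_eq, abs_le]
    -- The gradient inequality used from both endpoints turns a bound on the gradient into a
    -- Lipschitz constant for G_j.
    have key : ∀ x ∈ S₁, ∀ y ∈ S₁, g.G x j - g.G y j ≤ B * dist x y := fun x hx y hy => by
      have h1 := (hg.convex_G j).add_inner_le_of_hasGradientWithinAt (hS₁W hx) (hS₁W hy)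
        (hg.grad_G j x (hS₁W hx))
      have h2 := (abs_le.1 (abs_real_inner_le_norm (gG j x) (y - x))).1
      have h3 : ‖gG j x‖ * ‖y - x‖ ≤ B * dist x y := by
        rw [dist_comm, dist_eq_norm]
        exact mul_le_mul_of_nonneg_right (hB x hx) (norm_nonneg _)
      linarith
    have h1 := key x hx y hy
    have h2 := key y hy x hx
    rw [dist_comm] at h2
    constructor <;> linarith
  have hlam : ∀ j, ∃ L, LipschitzOnWith L (fun y : PrimalDual n m l => y.snd.fst j) S := fun j =>
    ⟨_, ((EuclideanSpace.proj j ∘L WithLp.fstL 2 ℝ _ _ ∘L WithLp.sndL 2 ℝ _ _ :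
      PrimalDual n m l →L[ℝ] ℝ).lipschitz).lipschitzOnWith⟩
  have hmu : ∀ j, ∃ L, LipschitzOnWith L (fun y : PrimalDual n m l => y.snd.snd j) S := fun j =>
    ⟨_, ((EuclideanSpace.proj j ∘L WithLp.sndL 2 ℝ _ _ ∘L WithLp.sndL 2 ℝ _ _ :
      PrimalDual n m l →L[ℝ] ℝ).lipschitz).lipschitzOnWith⟩
  have hL : ∃ L, LipschitzOnWith L
      (fun y : PrimalDual n m l => -(g.gradLagrangian gF gG y.fst y.snd.fst y.snd.snd)) S := by
    obtain ⟨L₁, h₁⟩ := hgF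
    obtain ⟨L₂, h₂⟩ := exists_lipschitzOnWith_sum (s := Finset.univ)
      (f := fun j (y : PrimalDual n m l) => y.snd.fst j •
        gradient (fun w' => g.H w' j) y.fst) fun j _ =>
        exists_lipschitzOnWith_smul hcomp (hlam j) ⟨0, by
          simp only [(hasGradientAt_H _ _).gradient]
          exact (LipschitzWith.const _).lipschitzOnWith⟩
    obtain ⟨L₃, h₃⟩ := exists_lipschitzOnWith_sum (s := Finset.univ)
      (f := fun j (y : PrimalDual n m l) => y.snd.snd j • gG j y.fst) fun j _ =>
        exists_lipschitzOnWith_smul hcomp (hmu j) (hpull (hgG j))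
    exact ⟨_, ((h₁.add h₂).add h₃).neg⟩
  have hHl : ∃ L, LipschitzOnWith L (fun y : PrimalDual n m l => g.H y.fst) S := by
    refine hpull ⟨‖LinearMap.toContinuousLinearMap g.H.linear‖₊,
      LipschitzOnWith.of_dist_le_mul fun x _ y _ => ?_⟩
    have h1 := H_add (g := g) y (x - y)
    rw [add_sub_cancel] at h1
    rw [dist_eq_norm, dist_eq_norm, h1, add_sub_cancel_left]
    exact (LinearMap.toContinuousLinearMap g.H.linear).le_opNorm (x - y)
  have hGl : ∃ L, LipschitzOnWith L (fun y : PrimalDual n m l => g.G y.fst) S := by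
    have h1 := exists_lipschitzOnWith_sum (s := Finset.univ)
      (f := fun j (y : PrimalDual n m l) => g.G y.fst j • EuclideanSpace.single j (1 : ℝ))
      fun j _ => exists_lipschitzOnWith_smul hcomp (hpull (hG j)) ⟨0, (LipschitzWith.const _).lipschitzOnWith⟩
    have h2 : (fun y : PrimalDual n m l => ∑ j, g.G y.fst j • EuclideanSpace.single j (1 : ℝ))
        = fun y => g.G y.fst := by
      ext1 y
      have := (EuclideanSpace.basisFun (Fin l) ℝ).sum_repr (g.G y.fst)
      simpa using this
    rwa [h2] at h1
  obtain ⟨L₁, h₁⟩ := hL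
  obtain ⟨L₂, h₂⟩ := hHl
  obtain ⟨L₃, h₃⟩ := hGl
  have hsum := (((inW n m l).lipschitz.comp_lipschitzOnWith h₁).add
    ((inLam n m l).lipschitz.comp_lipschitzOnWith h₂)).add
    ((inMu n m l).lipschitz.comp_lipschitzOnWith h₃)
  refine ⟨‖inW n m l‖₊ * L₁ + ‖inLam n m l‖₊ * L₂ + ‖inMu n m l‖₊ * L₃, fun x hx y hy => ?_⟩
  have := hsum hx hy
  rw [pdField, pdField, mkPD_eq, mkPD_eq]
  exact this

end Game

end LinearVE

end

namespace LinearVE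

/-! ### Solutions of the projected primal-dual dynamics -/

namespace Game

variable {N : ℕ} {n : Fin N → ℕ} {m l : ℕ} {g : Game n m l} {gF : Joint n → Joint n}
  {gG : Fin l → Joint n → Joint n}

theorem inner_toLp_update_sub (d w : Joint n) (i : Fin N) (v : Dec (n i)) :
    inner ℝ d (deviate w i v - w) = inner ℝ (d i) (v - w i) := by
  classical
  rw [PiLp.inner_apply, Finset.sum_eq_single i]
  · simp [deviate]
  · intro j _ hj
    simp [deviate, hj]
  · simp

/-- The projected primal-dual dynamics have a solution from every initial condition. -/
theorem Regular.exists_isPrimalDualSolution (hg : g.Regular gF gG) {wt : Joint n}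
    (hwt : SolvesGVI g.feasible gF wt) {w₀ : Joint n} (hw₀ : w₀ ∈ g.prodW)
    (lam₀ : EuclideanSpace ℝ (Fin m)) {mu₀ : EuclideanSpace ℝ (Fin l)} (hmu₀ : mu₀ ∈ orthant l) :
    ∃ w lam mu, g.IsPrimalDualSolution gF gG w lam mu ∧ Continuous w ∧
      w 0 = w₀ ∧ lam 0 = lam₀ ∧ mu 0 = mu₀ := by
  obtain ⟨lams, mus, hmus, hkkt⟩ := hg.exists_multipliers hwt
  have hdiss : ∀ y ∈ g.pdSet, inner ℝ (y - mkPD wt lams mus) (pdField g gF gG y) ≤ 0 :=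
    fun y hy => by
      refine (hg.inner_sub_pdField_le hwt.1 hkkt hy).trans ?_
      rcases eq_or_ne y.fst wt with h | h
      · simp [h]
      · linarith [hg.strictMono _ hy.1 _ hwt.1.1 h]
  obtain ⟨y, C, hy0, hymem, hylip, hyae⟩ := exists_projected_solution hg.isClosed_pdSet
    hg.convex_pdSet (z := mkPD wt lams mus) ⟨hwt.1.1, hmus⟩
    (fun R => hg.exists_lipschitzOnWith_pdField _ R) hdiss (y₀ := mkPD w₀ lam₀ mu₀) ⟨hw₀, hmu₀⟩
  let πw : PrimalDual n m l →L[ℝ] Joint n := WithLp.fstL 2 ℝ _ _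
  let πl : PrimalDual n m l →L[ℝ] EuclideanSpace ℝ (Fin m) :=
    WithLp.fstL 2 ℝ _ _ ∘L WithLp.sndL 2 ℝ _ _
  let πm : PrimalDual n m l →L[ℝ] EuclideanSpace ℝ (Fin l) :=
    WithLp.sndL 2 ℝ _ _ ∘L WithLp.sndL 2 ℝ _ _
  have hac : ∀ {F : Type} [NormedAddCommGroup F] [NormedSpace ℝ F] (π : PrimalDual n m l →L[ℝ] F)
      (τ : ℝ), AbsolutelyContinuousOnInterval (fun t => π (y t)) 0 τ := fun π τ =>
    ((π.lipschitz.comp hylip).lipschitzOnWith).absolutelyContinuousOnInterval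
  refine ⟨fun t => πw (y t), fun t => πl (y t), fun t => πm (y t),
    ⟨fun t _ => (hymem t).1, fun t _ => (hymem t).2, fun τ _ => hac πw τ, fun τ _ => hac πl τ,
      fun τ _ => hac πm τ, ?_, ?_, ?_⟩, πw.continuous.comp hylip.continuous, ?_, ?_, ?_⟩
  · filter_upwards [hyae] with t ⟨_, d, hd, hvi⟩ i
    have hdi : HasDerivAt (fun s => πw (y s) i) (d.fst i) t :=
      ((PiLp.proj (𝕜 := ℝ) 2 (fun i => Dec (n i)) i ∘L πw).hasFDerivAt (x := y t)).comp_hasDerivAt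
        t hd
    refine ⟨d.fst i, hdi, isVectorProj_of_hasDerivAt (y := fun s => πw (y s) i) (hg.closed i)
      (hg.convex i) (Eventually.of_forall fun s => (hymem s).1 i) hdi fun v hv => ?_⟩
    -- Testing normality on the product set with a point that differs from y t in one block only
    -- isolates the condition on that block.
    have h := hvi (mkPD (deviate (y t).fst i v) (y t).snd.fst (y t).snd.snd) ⟨fun j => by
      by_cases hj : j = i
      · subst hj
        simpa [deviate] using hv
      · simpa [deviate, hj] using (hymem t).1 j, (hymem t).2⟩
    rw [inner_primalDual] at h
    have e1 : (mkPD (deviate (y t).fst i v) (y t).snd.fst (y t).snd.snd - y t).fst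
        = deviate (y t).fst i v - (y t).fst := rfl
    have e2 : (mkPD (deviate (y t).fst i v) (y t).snd.fst (y t).snd.snd - y t).snd.fst = 0 :=
      sub_self _
    have e3 : (mkPD (deviate (y t).fst i v) (y t).snd.fst (y t).snd.snd - y t).snd.snd = 0 :=
      sub_self _
    rw [e1, e2, e3, inner_zero_right, inner_zero_right, add_zero, add_zero,
      inner_toLp_update_sub] at h
    exact h
  · filter_upwards [hyae] with t ⟨_, d, hd, hvi⟩
    have hdl : HasDerivAt (fun s => πl (y s)) d.snd.fst t :=
      (πl.hasFDerivAt (x := y t)).comp_hasDerivAt t hd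
    -- λ is unconstrained, so the residual H - λ̇ itself is an admissible displacement; normality
    -- says that its square is at most 0.
    have h := hvi (mkPD (y t).fst ((y t).snd.fst + (g.H (y t).fst - d.snd.fst)) (y t).snd.snd)
      ⟨(hymem t).1, (hymem t).2⟩
    rw [inner_primalDual] at h
    have e1 : (mkPD (y t).fst ((y t).snd.fst + (g.H (y t).fst - d.snd.fst)) (y t).snd.snd
        - y t).fst = 0 := sub_self _
    have e2 : (mkPD (y t).fst ((y t).snd.fst + (g.H (y t).fst - d.snd.fst)) (y t).snd.snd
        - y t).snd.fst = g.H (y t).fst - d.snd.fst := add_sub_cancel_left _ _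
    have e3 : (mkPD (y t).fst ((y t).snd.fst + (g.H (y t).fst - d.snd.fst)) (y t).snd.snd
        - y t).snd.snd = 0 := sub_self _
    have e4 : (pdField g gF gG (y t) - d).snd.fst = g.H (y t).fst - d.snd.fst := rfl
    rw [e1, e2, e3, e4, inner_zero_right, inner_zero_right, zero_add, add_zero,
      real_inner_self_eq_norm_sq] at h
    have h0 : g.H (y t).fst - d.snd.fst = 0 := by
      rw [← norm_eq_zero]
      exact pow_eq_zero_iff two_ne_zero |>.1 (le_antisymm h (sq_nonneg _))
    rw [sub_eq_zero] at h0
    show HasDerivAt _ (g.H (y t).fst) t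
    rw [h0]
    exact hdl
  · filter_upwards [hyae] with t ⟨_, d, hd, hvi⟩
    have hdm : HasDerivAt (fun s => πm (y s)) d.snd.snd t :=
      (πm.hasFDerivAt (x := y t)).comp_hasDerivAt t hd
    refine ⟨d.snd.snd, hdm, isVectorProj_of_hasDerivAt (y := fun s => πm (y s))
      (isClosed_orthant l) (convex_orthant l) (Eventually.of_forall fun s => (hymem s).2) hdm
      fun v hv => ?_⟩
    have h := hvi (mkPD (y t).fst (y t).snd.fst v) ⟨(hymem t).1, hv⟩
    rw [inner_primalDual] at h
    have e1 : (mkPD (y t).fst (y t).snd.fst v - y t).fst = 0 := sub_self _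
    have e2 : (mkPD (y t).fst (y t).snd.fst v - y t).snd.fst = 0 := sub_self _
    rw [e1, e2, inner_zero_right, inner_zero_right, zero_add, zero_add] at h
    exact h
  · simp only [hy0]; rfl
  · simp only [hy0]; rfl
  · simp only [hy0]; rfl

/-- The primal variables of the projected primal-dual dynamics converge to the solution of the
variational inequality. -/
theorem Regular.tendsto_of_isPrimalDualSolution (hg : g.Regular gF gG) {wt : Joint n}
    (hwt : SolvesGVI g.feasible gF wt) {w : ℝ → Joint n} {lam : ℝ → EuclideanSpace ℝ (Fin m)}
    {mu : ℝ → EuclideanSpace ℝ (Fin l)} (h : g.IsPrimalDualSolution gF gG w lam mu) :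
    Tendsto w atTop (𝓝 wt) := by
  obtain ⟨lams, mus, hmus, hkkt⟩ := hg.exists_multipliers hwt
  set z := mkPD wt lams mus with hz
  have hzmem : z ∈ g.pdSet := ⟨hwt.1.1, hmus⟩
  have hfc : ContinuousOn (pdField g gF gG) g.pdSet := fun y hy => by
    obtain ⟨L, hL⟩ := hg.exists_lipschitzOnWith_pdField y 1
    refine (hL.continuousOn y ⟨hy, Metric.mem_closedBall_self zero_le_one⟩).mono_of_mem_nhdsWithin ?_
    exact inter_mem self_mem_nhdsWithin
      (mem_nhdsWithin_of_mem_nhds (Metric.closedBall_mem_nhds y one_pos))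
  have hψc : ContinuousOn (fun y : PrimalDual n m l =>
      inner ℝ (y.fst - wt) (gF y.fst - gF wt)) g.pdSet := by
    have h1 : ContinuousOn (fun y : PrimalDual n m l => gF y.fst) g.pdSet :=
      hg.lip_f.continuousOn.comp (WithLp.fstL 2 ℝ _ _).continuous.continuousOn fun y hy => hy.1
    have h2 : ContinuousOn (fun y : PrimalDual n m l => y.fst) g.pdSet :=
      (WithLp.fstL 2 ℝ _ _).continuous.continuousOn
    exact (h2.sub continuousOn_const).inner (h1.sub continuousOn_const)
  have hψpos : ∀ y ∈ g.pdSet, y.fst ≠ wt → 0 < inner ℝ (y.fst - wt) (gF y.fst - gF wt) :=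
    fun y hy hne => hg.strictMono _ hy.1 _ hwt.1.1 hne
  have hψ0 : ∀ y ∈ g.pdSet, 0 ≤ inner ℝ (y.fst - wt) (gF y.fst - gF wt) := fun y hy => by
    rcases eq_or_ne y.fst wt with h | h
    · simp [h]
    · exact (hψpos y hy h).le
  have hmem : ∀ t, 0 ≤ t → mkPD (w t) (lam t) (mu t) ∈ g.pdSet := fun t ht =>
    ⟨h.mem_W t ht, h.mem_orthant t ht⟩
  have hpos : ∀ᵐ t ∂(volume.restrict (Ici (0 : ℝ))), (0 : ℝ) ≤ t :=
    (ae_restrict_iff' measurableSet_Ici).2 (ae_of_all _ fun t ht => ht)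
  -- The dissipation is positive only off w = wt and does not see the multipliers; hence the
  -- convergence statement is applied with π the projection to w.
  refine tendsto_of_projected_solution hg.isClosed_pdSet hfc hψc hψ0
    (fun y hy => hg.inner_sub_pdField_le hwt.1 hkkt hy) (WithLp.fstL 2 ℝ _ _) hψpos hzmem
    (y := fun t => mkPD (w t) (lam t) (mu t)) hmem (fun τ hτ => ?_) ?_
  · simp only [mkPD_eq]
    exact (((inW n m l).lipschitz.comp_absolutelyContinuousOnInterval (h.ac_w τ hτ)).fun_add
      ((inLam n m l).lipschitz.comp_absolutelyContinuousOnInterval (h.ac_lam τ hτ))).fun_add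
      ((inMu n m l).lipschitz.comp_absolutelyContinuousOnInterval (h.ac_mu τ hτ))
  · filter_upwards [h.deriv_w, h.deriv_lam, h.deriv_mu, hpos] with t hw hl ⟨dm, hdm, hpm⟩ ht
    choose dw hdw hpw using hw
    have hW := h.mem_W t ht
    have hM := h.mem_orthant t ht
    have hderw : HasDerivAt w (WithLp.toLp 2 dw) t := by
      have h1 : HasDerivAt (fun s => (w s).ofLp) dw t := hasDerivAt_pi.2 hdw
      exact ((PiLp.continuousLinearEquiv 2 ℝ (fun i => Dec (n i))).symm.hasFDerivAt
        (x := (w t).ofLp)).comp_hasDerivAt t h1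
    refine ⟨mkPD (WithLp.toLp 2 dw) (g.H (w t)) dm, ?_, ?_, ?_⟩
    · simp only [mkPD_eq]
      exact ((((inW n m l).hasFDerivAt (x := w t)).comp_hasDerivAt t hderw).add
        (((inLam n m l).hasFDerivAt (x := lam t)).comp_hasDerivAt t hl)).add
        (((inMu n m l).hasFDerivAt (x := mu t)).comp_hasDerivAt t hdm)
    · refine le_of_pow_le_pow_left₀ two_ne_zero (norm_nonneg _) ?_
      rw [norm_sq_primalDual, norm_sq_primalDual]
      refine add_le_add (add_le_add ?_ le_rfl) ?_
      · rw [PiLp.norm_sq_eq_of_L2, PiLp.norm_sq_eq_of_L2]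
        refine Finset.sum_le_sum fun i _ => ?_
        exact pow_le_pow_left₀ (norm_nonneg _)
          ((hpw i).norm_le (hg.closed i) (hg.convex i) (hW i)) 2
      · exact pow_le_pow_left₀ (norm_nonneg _)
          (hpm.norm_le (isClosed_orthant l) (convex_orthant l) hM) 2
    · intro x hx
      rw [inner_primalDual]
      have e1 : inner ℝ (pdField g gF gG (mkPD (w t) (lam t) (mu t))
          - mkPD (WithLp.toLp 2 dw) (g.H (w t)) dm).fst (x - mkPD (w t) (lam t) (mu t)).fst ≤ 0 := by
        rw [PiLp.inner_apply]
        exact Finset.sum_nonpos fun i _ =>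
          (hpw i).inner_le_zero (hg.closed i) (hg.convex i) (hW i) (hx.1 i)
      have e2 : inner ℝ (pdField g gF gG (mkPD (w t) (lam t) (mu t))
          - mkPD (WithLp.toLp 2 dw) (g.H (w t)) dm).snd.fst
          (x - mkPD (w t) (lam t) (mu t)).snd.fst = 0 := by
        have : (pdField g gF gG (mkPD (w t) (lam t) (mu t))
          - mkPD (WithLp.toLp 2 dw) (g.H (w t)) dm).snd.fst = 0 := sub_self _
        rw [this, inner_zero_left]
      have e3 : inner ℝ (pdField g gF gG (mkPD (w t) (lam t) (mu t))
          - mkPD (WithLp.toLp 2 dw) (g.H (w t)) dm).snd.snd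
          (x - mkPD (w t) (lam t) (mu t)).snd.snd ≤ 0 :=
        hpm.inner_le_zero (isClosed_orthant l) (convex_orthant l) hM hx.2
      linarith

theorem Regular.eq_of_solvesGVI (hg : g.Regular gF gG) {w w' : Joint n}
    (hw : SolvesGVI g.feasible gF w) (hw' : SolvesGVI g.feasible gF w') : w = w' := by
  by_contra hne
  have h1 := hg.strictMono w hw.1.1 w' hw'.1.1 hne
  have h2 := hw.2 w' hw'.1
  have h3 := hw'.2 w hw.1
  rw [← neg_sub, inner_neg_left] at h2
  rw [inner_sub_right] at h1
  linarith

end Game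


/-! ### Existence of the design parameters -/

section Canonical

variable {k : ℕ}

/-- The matrix with rows `q A^r`. -/
def krylov (A : Matrix (Fin k) (Fin k) ℝ) (q : Fin k → ℝ) : Matrix (Fin k) (Fin k) ℝ :=
  Matrix.of fun r => q ᵥ* A ^ (r : ℕ)

theorem pow_eq_neg_sum_charpoly (A : Matrix (Fin k) (Fin k) ℝ) :
    A ^ k = -∑ c : Fin k, A.charpoly.coeff c • A ^ (c : ℕ) := by
  have h := A.aeval_self_charpoly
  rw [Polynomial.aeval_eq_sum_range, A.charpoly_natDegree_eq_dim, Fintype.card_fin,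
    Finset.sum_range_succ, Finset.sum_range] at h
  have h1 : A.charpoly.coeff k = 1 := by
    have := A.charpoly_monic
    rwa [Polynomial.Monic, Polynomial.leadingCoeff, A.charpoly_natDegree_eq_dim,
      Fintype.card_fin] at this
  rw [h1, one_smul] at h
  exact eq_neg_of_add_eq_zero_right h

/-- Right multiplication by A moves each row to the next; Cayley–Hamilton expresses the row after
the last one. -/
theorem krylov_mul (A : Matrix (Fin k) (Fin k) ℝ) (q : Fin k → ℝ) :
    krylov A q * A = companionMat (fun c => A.charpoly.coeff c) * krylov A q := by
  ext r s
  have hl : (krylov A q * A) r s = (q ᵥ* A ^ ((r : ℕ) + 1)) s := by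
    rw [Matrix.mul_apply_eq_vecMul]
    show ((q ᵥ* A ^ (r : ℕ)) ᵥ* A) s = _
    rw [Matrix.vecMul_vecMul, ← pow_succ]
  rw [hl, Matrix.mul_apply]
  by_cases hr : (r : ℕ) + 1 = k
  · have hrow : ∀ c, companionMat (fun c : Fin k => A.charpoly.coeff c) r c
        = -A.charpoly.coeff c := fun c => by
      simp [companionMat, hr]
    simp only [hrow]
    rw [hr, pow_eq_neg_sum_charpoly, Matrix.vecMul_neg, Matrix.vecMul_sum]
    simp only [Pi.neg_apply, Finset.sum_apply, neg_mul, Finset.sum_neg_distrib]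
    congr 1
    refine Finset.sum_congr rfl fun c _ => ?_
    rw [Matrix.vecMul_smul]
    rfl
  · have hlt : (r : ℕ) + 1 < k := by omega
    rw [Finset.sum_eq_single ⟨(r : ℕ) + 1, hlt⟩]
    · simp [companionMat, hr, krylov]
    · intro c _ hc
      have : (c : ℕ) ≠ (r : ℕ) + 1 := fun h => hc (Fin.ext h)
      simp [companionMat, hr, this]
    · simp

theorem krylov_mulVec (A : Matrix (Fin k) (Fin k) ℝ) (q B : Fin k → ℝ) (r : Fin k) :
    (krylov A q *ᵥ B) r = q ⬝ᵥ (A ^ (r : ℕ) *ᵥ B) := by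
  show (q ᵥ* A ^ (r : ℕ)) ⬝ᵥ B = _
  rw [Matrix.dotProduct_mulVec]

/-- No covector annihilates the reachable directions of a controllable pair. -/
theorem Controllable.eq_zero_of_forall_dotProduct {A : Matrix (Fin k) (Fin k) ℝ} {B : Fin k → ℝ}
    (h : Controllable A B) {q : Fin k → ℝ} (hq : ∀ r : Fin k, q ⬝ᵥ (A ^ (r : ℕ) *ᵥ B) = 0) :
    q = 0 := by
  rcases Nat.eq_zero_or_pos k with rfl | hk
  · exact Subsingleton.elim _ _
  -- The state is steered from 0 to q itself. As O B = 0, the input disappears from the equation of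
  -- O x, which is autonomous and starts at 0; the first row of O x(τ) = 0 reads q ⬝ᵥ q = 0.
  obtain ⟨τ, hτ, u, x, -, hx0, hxτ, hx⟩ := h 0 q
  set O := krylov A q
  have hOB : O *ᵥ B = 0 := by
    ext r
    rw [krylov_mulVec]
    exact hq r
  set C := companionMat (fun c : Fin k => A.charpoly.coeff c)
  have hder : ∀ t ∈ Icc 0 τ, HasDerivWithinAt (fun s => O *ᵥ x s) (C *ᵥ (O *ᵥ x t)) (Icc 0 τ) t :=
    fun t ht => by
      have h1 := ((LinearMap.toContinuousLinearMap (Matrix.mulVecLin O)).hasFDerivAt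
        (x := x t)).comp_hasDerivWithinAt t (hx t ht)
      refine h1.congr_deriv ?_
      show O *ᵥ (A *ᵥ x t + u t • B) = _
      rw [Matrix.mulVec_add, Matrix.mulVec_smul, hOB, smul_zero, add_zero, Matrix.mulVec_mulVec,
        Matrix.mulVec_mulVec, krylov_mul]
  have hz := eq_zero_of_abs_deriv_le_mul_abs_self_of_eq_zero_right
    (f := fun s => O *ᵥ x s) (f' := fun t => C *ᵥ (O *ᵥ x t))
    (K := ‖LinearMap.toContinuousLinearMap (Matrix.mulVecLin C)‖)
    (fun t ht => (hder t ht).continuousWithinAt)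
    (fun t ht => (hder t ⟨ht.1, ht.2.le⟩).mono_of_mem_nhdsWithin
      (mem_of_superset (Icc_mem_nhdsGE ht.2) (Icc_subset_Icc_left ht.1)))
    (by simp [hx0]) (fun t _ =>
      (LinearMap.toContinuousLinearMap (Matrix.mulVecLin C)).le_opNorm (O *ᵥ x t))
    τ (right_mem_Icc.2 hτ.le)
  have h0 := congrFun hz ⟨0, hk⟩
  simp only [hxτ] at h0
  rw [krylov_mulVec] at h0
  simpa using h0

/-- A controllable pair can be brought to controllable canonical form. -/
theorem Controllable.exists_canonical {A : Matrix (Fin k) (Fin k) ℝ} {B : Fin k → ℝ}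
    (h : Controllable A B) : ∃ (T : Matrix (Fin k) (Fin k) ℝ) (a : Fin k → ℝ),
      IsUnit T.det ∧ T * A * T⁻¹ = companionMat a ∧ T *ᵥ B = lastVec k := by
  set C : Matrix (Fin k) (Fin k) ℝ := Matrix.of fun r c => (A ^ (c : ℕ) *ᵥ B) r
  have hvC : ∀ q : Fin k → ℝ, ∀ c, (q ᵥ* C) c = q ⬝ᵥ (A ^ (c : ℕ) *ᵥ B) := fun q c => rfl
  have hC : IsUnit C.det := by
    rw [isUnit_iff_ne_zero]
    intro h0
    obtain ⟨q, hq0, hq⟩ := Matrix.exists_vecMul_eq_zero_iff.2 h0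
    refine hq0 (h.eq_zero_of_forall_dotProduct fun r => ?_)
    rw [← hvC, hq]
    rfl
  -- The last row of the inverse controllability matrix: q Aʲ B is 0 for j < k - 1 and 1 for j = k -
  -- 1.
  set q := lastVec k ᵥ* C⁻¹
  have hq : ∀ c : Fin k, q ⬝ᵥ (A ^ (c : ℕ) *ᵥ B) = lastVec k c := fun c => by
    rw [← hvC, Matrix.vecMul_vecMul, Matrix.nonsing_inv_mul _ hC, Matrix.vecMul_one]
  set T := krylov A q
  have hT : IsUnit T.det := by
    rw [isUnit_iff_ne_zero]
    intro h0
    obtain ⟨v, hv0, hv⟩ := Matrix.exists_vecMul_eq_zero_iff.2 h0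
    have hne : (Finset.univ.filter fun r => v r ≠ 0).Nonempty := by
      by_contra hcon
      rw [Finset.not_nonempty_iff_eq_empty, Finset.filter_eq_empty_iff] at hcon
      refine hv0 (funext fun r => ?_)
      have := hcon (Finset.mem_univ r)
      push Not at this
      exact this
    set r := (Finset.univ.filter fun r => v r ≠ 0).max' hne
    have hr : v r ≠ 0 := (Finset.mem_filter.1 (Finset.max'_mem _ hne)).2
    have hmax : ∀ s, v s ≠ 0 → s ≤ r := fun s hs =>
      Finset.le_max' _ s (Finset.mem_filter.2 ⟨Finset.mem_univ s, hs⟩)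
    -- T times the controllability matrix is triangular about the antidiagonal. The column A^p B
    -- picks out the last nonzero entry v r: rows before r give exponents below k - 1.
    set p := k - 1 - (r : ℕ)
    have h1 : v ⬝ᵥ (T *ᵥ (A ^ p *ᵥ B)) = 0 := by
      rw [Matrix.dotProduct_mulVec, hv, zero_dotProduct]
    have h2 : v ⬝ᵥ (T *ᵥ (A ^ p *ᵥ B)) = v r := by
      rw [dotProduct, Finset.sum_eq_single r]
      · rw [krylov_mulVec, Matrix.mulVec_mulVec, ← pow_add]
        have hrp : (r : ℕ) + p = k - 1 := by omega
        have := hq ⟨k - 1, by omega⟩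
        simp only [lastVec] at this
        rw [hrp, this, if_pos (by omega), mul_one]
      · intro s _ hs
        by_cases hvs : v s = 0
        · rw [hvs, zero_mul]
        · have hlt : (s : ℕ) < r := lt_of_le_of_ne (hmax s hvs) fun h => hs (Fin.ext h)
          rw [krylov_mulVec, Matrix.mulVec_mulVec, ← pow_add]
          have := hq ⟨(s : ℕ) + p, by omega⟩
          simp only [lastVec] at this
          rw [this, if_neg (by omega), mul_zero]
      · simp
    exact hr (h2.symm.trans h1)
  refine ⟨T, fun c => A.charpoly.coeff c, hT, ?_, ?_⟩
  · rw [krylov_mul, Matrix.mul_assoc, Matrix.mul_nonsing_inv _ hT, Matrix.mul_one]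
  · ext r
    rw [krylov_mulVec, hq]

end Canonical

/-! ### Pole placement and an explicit Lyapunov matrix -/

section Gain

/-- A stabilizing gain for the chain of integrators, with a solution of the Lyapunov equation. -/
theorem exists_gain_lyapunov (k : ℕ) :
    ∃ (K : Fin k → ℝ) (P : Matrix (Fin k) (Fin k) ℝ),
      IsHurwitz (shiftMat k + Matrix.vecMulVec (lastVec k) K) ∧ P.PosDef ∧
      P * (shiftMat k + Matrix.vecMulVec (lastVec k) K) +
        (shiftMat k + Matrix.vecMulVec (lastVec k) K)ᵀ * P = -1 := by
  -- the closed loop is given the eigenvalues `-1, …, -k`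
  set ev : Fin k → ℝ := fun c => -((c : ℕ) + 1 : ℝ) with hev
  have hinj : Function.Injective ev := fun a b hab => by
    simp only [hev, neg_inj, add_left_inj, Nat.cast_inj] at hab
    exact Fin.ext hab
  have hdet : IsUnit (Matrix.vandermonde ev).det :=
    isUnit_iff_ne_zero.2 (Matrix.det_vandermonde_ne_zero_iff.2 hinj)
  -- The Vandermonde system says that each ev c is a root of X^k - Σ K_s X^s. The columns (1, ev c,
  -- (ev c)², …) of V below are then eigenvectors of the closed loop.
  set K : Fin k → ℝ := (Matrix.vandermonde ev)⁻¹ *ᵥ fun c => ev c ^ k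
  have hK : ∀ c, ∑ s : Fin k, K s * ev c ^ (s : ℕ) = ev c ^ k := fun c => by
    have h1 : Matrix.vandermonde ev *ᵥ K = fun c => ev c ^ k := by
      rw [Matrix.mulVec_mulVec, Matrix.mul_nonsing_inv _ hdet, Matrix.one_mulVec]
    have h2 := congrFun h1 c
    rw [← h2]
    exact Finset.sum_congr rfl fun s _ => mul_comm _ _
  set V : Matrix (Fin k) (Fin k) ℝ := (Matrix.vandermonde ev)ᵀ with hVdef
  have hVdet : IsUnit V.det := by rwa [hVdef, Matrix.det_transpose]
  set M := shiftMat k + Matrix.vecMulVec (lastVec k) K with hMdef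
  have hMV : M * V = V * Matrix.diagonal ev := by
    ext r c
    rw [Matrix.mul_diagonal, Matrix.mul_apply]
    have hVe : ∀ s, V s c = ev c ^ (s : ℕ) := fun s => rfl
    simp only [hMdef, Matrix.add_apply, add_mul, Finset.sum_add_distrib, hVe,
      Matrix.vecMulVec_apply, mul_assoc, ← Finset.mul_sum, hK]
    by_cases hr : (r : ℕ) + 1 = k
    · have h1 : ∀ s : Fin k, shiftMat k r s = 0 := fun s => by
        have : (s : ℕ) ≠ (r : ℕ) + 1 := by omega
        simp [shiftMat, this]
      simp only [h1, zero_mul, Finset.sum_const_zero, zero_add, lastVec, if_pos hr, one_mul]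
      rw [← pow_succ, hr]
    · have hlt : (r : ℕ) + 1 < k := by omega
      rw [Finset.sum_eq_single ⟨(r : ℕ) + 1, hlt⟩]
      · simp [shiftMat, lastVec, hr, pow_succ]
      · intro s _ hs
        have : (s : ℕ) ≠ (r : ℕ) + 1 := fun h => hs (Fin.ext h)
        simp [shiftMat, this]
      · simp
  -- In eigenvector coordinates the Lyapunov equation decouples into scalar equations; the
  -- denominator i + j + 2 is -(ev i + ev j).
  set Q : Matrix (Fin k) (Fin k) ℝ :=
    Matrix.of fun i j => (Vᵀ * V) i j / ((i : ℕ) + (j : ℕ) + 2 : ℝ) with hQdef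
  have hVsymm : ∀ i j, (Vᵀ * V) i j = (Vᵀ * V) j i := fun i j => by
    simp only [Matrix.mul_apply, Matrix.transpose_apply]
    exact Finset.sum_congr rfl fun s _ => mul_comm _ _
  have hQeq : Q * Matrix.diagonal ev + Matrix.diagonal ev * Q = -(Vᵀ * V) := by
    ext i j
    rw [Matrix.add_apply, Matrix.mul_diagonal, Matrix.diagonal_mul, Matrix.neg_apply]
    simp only [hQdef, Matrix.of_apply, hev]
    have : ((i : ℕ) + (j : ℕ) + 2 : ℝ) ≠ 0 := by positivity
    field_simp
    ring
  have hQpos : Q.PosDef := by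
    refine Matrix.PosDef.of_dotProduct_mulVec_pos ?_ fun x hx => ?_
    · ext i j
      simp only [Matrix.conjTranspose_apply, hQdef, Matrix.of_apply, star_trivial]
      rw [hVsymm, add_comm ((j : ℕ) : ℝ)]
    -- Since 1/(i + j + 2) = ∫₀¹ s^{i+j+1} ds, the quadratic form is the integral of s |V(x_i
    -- sⁱ)_i|², and V is nonsingular.
    · have hcg : star x ⬝ᵥ (Q *ᵥ x) = ∫ s in (0 : ℝ)..1,
          (∑ r, (∑ i, V r i * (x i * s ^ (i : ℕ))) ^ 2) * s := by
        have hpoint : ∀ s : ℝ, (∑ r, (∑ i, V r i * (x i * s ^ (i : ℕ))) ^ 2) * s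
            = ∑ i, ∑ j, (x i * x j * (Vᵀ * V) i j) * s ^ ((i : ℕ) + (j : ℕ) + 1) := fun s => by
          simp only [sq, Matrix.mul_apply, Matrix.transpose_apply,
            Finset.mul_sum, Finset.sum_mul]
          rw [Finset.sum_comm]
          refine Finset.sum_congr rfl fun i _ => ?_
          rw [Finset.sum_comm]
          refine Finset.sum_congr rfl fun j _ => Finset.sum_congr rfl fun r _ => ?_
          ring
        simp only [hpoint]
        rw [intervalIntegral.integral_finsetSum fun i _ =>
          Continuous.intervalIntegrable (by fun_prop) _ _]
        simp only [dotProduct, Matrix.mulVec, Finset.mul_sum, star_trivial]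
        refine Finset.sum_congr rfl fun i _ => ?_
        rw [intervalIntegral.integral_finsetSum fun j _ =>
          Continuous.intervalIntegrable (by fun_prop) _ _]
        refine Finset.sum_congr rfl fun j _ => ?_
        rw [intervalIntegral.integral_const_mul, integral_pow]
        simp only [hQdef, Matrix.of_apply]
        push_cast
        have h2 : ((i : ℕ) + (j : ℕ) + 1 + 1 : ℝ) = (i : ℕ) + (j : ℕ) + 2 := by ring
        rw [h2]
        simp
        ring
      rw [hcg]
      refine intervalIntegral.intervalIntegral_pos_of_pos_on
        (Continuous.intervalIntegrable (by fun_prop) _ _) (fun s hs => ?_) one_pos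
      refine mul_pos ?_ hs.1
      by_contra hcon
      push Not at hcon
      have hz := (Finset.sum_eq_zero_iff_of_nonneg fun r _ => sq_nonneg _).1
        (le_antisymm hcon (Finset.sum_nonneg fun r _ => sq_nonneg
          (∑ i, V r i * (x i * s ^ (i : ℕ)))))
      have hVx : V *ᵥ (fun i => x i * s ^ (i : ℕ)) = 0 := funext fun r =>
        pow_eq_zero_iff two_ne_zero |>.1 (hz r (Finset.mem_univ r))
      have hxs := Matrix.eq_zero_of_mulVec_eq_zero (isUnit_iff_ne_zero.1 hVdet) hVx
      refine hx (funext fun i => ?_)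
      have := congrFun hxs i
      exact (mul_eq_zero.1 this).resolve_right (pow_pos hs.1 _).ne'
  have hVU : V * V⁻¹ = 1 := Matrix.mul_nonsing_inv _ hVdet
  have hUV : V⁻¹ * V = 1 := Matrix.nonsing_inv_mul _ hVdet
  have hUM : V⁻¹ * M = Matrix.diagonal ev * V⁻¹ := by
    calc V⁻¹ * M = V⁻¹ * (M * V) * V⁻¹ := by
          rw [Matrix.mul_assoc, Matrix.mul_assoc, hVU, Matrix.mul_one]
      _ = _ := by rw [hMV, ← Matrix.mul_assoc, hUV, Matrix.one_mul]
  refine ⟨K, (V⁻¹)ᵀ * Q * V⁻¹, ?_, ?_, ?_⟩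
  · intro z hz
    rw [spectrum.mem_iff, Matrix.isUnit_iff_isUnit_det, isUnit_iff_ne_zero, not_not] at hz
    obtain ⟨v, hv0, hv⟩ := Matrix.exists_vecMul_eq_zero_iff.2 hz
    set Vc : Matrix (Fin k) (Fin k) ℂ := V.map (fun a => (a : ℂ)) with hVc
    have hVcdet : Vc.det ≠ 0 := by
      have : Vc.det = ((V.det : ℝ) : ℂ) := (RingHom.map_det Complex.ofRealHom V).symm
      rw [this]
      exact_mod_cast isUnit_iff_ne_zero.1 hVdet
    have hMc : M.map (fun a => (a : ℂ)) * Vc = Vc * Matrix.diagonal fun c => (ev c : ℂ) := by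
      have h1 : (M * V).map Complex.ofRealHom = (V * Matrix.diagonal ev).map Complex.ofRealHom := by
        rw [hMV]
      rw [Matrix.map_mul, Matrix.map_mul, Matrix.diagonal_map (by simp)] at h1
      exact h1
    have hy0 : v ᵥ* Vc ≠ 0 := fun h => hv0 (Matrix.eq_zero_of_vecMul_eq_zero hVcdet h)
    have hvM : v ᵥ* M.map (fun a => (a : ℂ)) = z • v := by
      rw [Matrix.vecMul_sub, sub_eq_zero, Algebra.algebraMap_eq_smul_one, Matrix.vecMul_smul,
        Matrix.vecMul_one] at hv
      exact hv.symm
    have hy : (v ᵥ* Vc) ᵥ* Matrix.diagonal (fun c => (ev c : ℂ)) = z • (v ᵥ* Vc) := by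
      rw [Matrix.vecMul_vecMul, ← hMc, ← Matrix.vecMul_vecMul, hvM, Matrix.smul_vecMul]
    obtain ⟨c, hc⟩ := Function.ne_iff.1 hy0
    have h1 := congrFun hy c
    rw [Matrix.vecMul_diagonal, Pi.smul_apply, smul_eq_mul, mul_comm] at h1
    have h2 : (ev c : ℂ) = z := mul_right_cancel₀ hc h1
    rw [← h2, Complex.ofReal_re]
    simp only [hev]
    have : (0 : ℝ) ≤ ((c : ℕ) : ℝ) := Nat.cast_nonneg _
    linarith
  · have h1 := hQpos.conjTranspose_mul_mul_same (B := V⁻¹) (by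
      refine Matrix.mulVec_injective_of_isUnit ?_
      rw [Matrix.isUnit_iff_isUnit_det, Matrix.det_nonsing_inv]
      simpa using hVdet)
    rwa [Matrix.conjTranspose_eq_transpose_of_trivial] at h1
  · have h1 : (V⁻¹)ᵀ * Q * V⁻¹ * M = (V⁻¹)ᵀ * (Q * Matrix.diagonal ev) * V⁻¹ := by
      rw [Matrix.mul_assoc _ V⁻¹ M, hUM]
      simp only [Matrix.mul_assoc]
    have h2 : Mᵀ * ((V⁻¹)ᵀ * Q * V⁻¹) = (V⁻¹)ᵀ * (Matrix.diagonal ev * Q) * V⁻¹ := by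
      have h3 : Mᵀ * (V⁻¹)ᵀ = (V⁻¹)ᵀ * Matrix.diagonal ev := by
        rw [← Matrix.transpose_mul, hUM, Matrix.transpose_mul, Matrix.diagonal_transpose]
      rw [← Matrix.mul_assoc, ← Matrix.mul_assoc, h3]
      simp only [Matrix.mul_assoc]
    rw [h1, h2, ← Matrix.add_mul, ← Matrix.mul_add, hQeq, Matrix.mul_neg, Matrix.neg_mul,
      Matrix.mul_assoc, Matrix.mul_assoc, hVU, Matrix.mul_one, ← Matrix.transpose_mul, hVU,
      Matrix.transpose_one]

/-- Admissible design parameters exist. -/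
theorem exists_admissible_design {N : ℕ} {n : Fin N → ℕ} (sys : LinSys n)
    (hctrl : ∀ i, Controllable (sys.A i i) (sys.B i)) : ∃ D : Design n, D.Admissible sys := by
  choose T a hT hA hB using fun i => (hctrl i).exists_canonical
  choose K P hK hP hL using fun i => exists_gain_lyapunov (n i)
  exact ⟨⟨T, a, K, P⟩, ⟨hT, hA, hB, hK, hP, hL⟩⟩

end Gain


/-! ### Linear differential equations -/

/-- Variation of constants: x(t) = e^{tL}(x₀ + ∫₀ᵗ e^{-sL} b(s) ds). -/
theorem exists_hasDerivAt_linear {E : Type*} [NormedAddCommGroup E] [NormedSpace ℝ E]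
    [CompleteSpace E] (L : E →L[ℝ] E) {b : ℝ → E} (hb : Continuous b) (x₀ : E) :
    ∃ x : ℝ → E, x 0 = x₀ ∧ ∀ t, HasDerivAt x (L (x t) + b t) t := by
  have hexp : ∀ t : ℝ, HasDerivAt (fun s : ℝ => NormedSpace.exp (s • L))
      (L * NormedSpace.exp (t • L)) t := fun t => hasDerivAt_exp_smul_const' L t
  have hcancel : ∀ t : ℝ, NormedSpace.exp (t • L) * NormedSpace.exp ((-t) • L) = 1 := fun t => by
    let _ : NormedAlgebra ℚ (E →L[ℝ] E) := NormedAlgebra.restrictScalars ℚ ℝ (E →L[ℝ] E)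
    rw [← NormedSpace.exp_add_of_commute ((Commute.refl L).smul_left t |>.smul_right (-t)),
      ← add_smul]
    simp
  have hcont : Continuous fun s : ℝ => NormedSpace.exp ((-s) • L) (b s) := by
    have h1 : Continuous fun s : ℝ => NormedSpace.exp (s • L) :=
      continuous_iff_continuousAt.2 fun t => (hexp t).continuousAt
    exact (h1.comp continuous_neg).clm_apply hb
  refine ⟨fun t => NormedSpace.exp (t • L)
    (x₀ + ∫ s in (0 : ℝ)..t, NormedSpace.exp ((-s) • L) (b s)), by simp, fun t => ?_⟩
  have h2 : HasDerivAt (fun t => x₀ + ∫ s in (0 : ℝ)..t, NormedSpace.exp ((-s) • L) (b s))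
      (NormedSpace.exp ((-t) • L) (b t)) t :=
    (hcont.integral_hasStrictDerivAt 0 t).hasDerivAt.const_add x₀
  refine ((hexp t).clm_apply h2).congr_deriv ?_
  have h3 := congrArg (fun M : E →L[ℝ] E => M (b t)) (hcancel t)
  simp only [mul_apply_eq_comp, one_apply_eq_self] at h3
  rw [h3]
  rfl

/-- Once β is below aη/2, Grönwall leaves η/2 plus an exponentially decaying term. -/
theorem tendsto_zero_of_deriv_le {φ φ' β : ℝ → ℝ} {a : ℝ} (ha : 0 < a) (hφ : ∀ t, 0 ≤ φ t)
    (hd : ∀ t, 0 < t → HasDerivAt φ (φ' t) t) (hle : ∀ t, 0 < t → φ' t ≤ -a * φ t + β t)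
    (hβ : Tendsto β atTop (𝓝 0)) : Tendsto φ atTop (𝓝 0) := by
  rw [Metric.tendsto_atTop]
  intro η hη
  have hη2 : 0 < a * (η / 2) := by positivity
  obtain ⟨s, hs⟩ := (((hβ.eventually_lt_const hη2)).and (eventually_gt_atTop 0)).exists_forall_of_atTop
  have hs0 : 0 < s := (hs s le_rfl).2
  have hkey : ∀ t, s ≤ t → φ t ≤ η / 2 + Real.exp (-a * (t - s)) * φ s := fun t hst => by
    have h := add_div_le_exp_mul_of_deriv_le (φ := φ) (φ' := φ') (a := -a) (b := a * (η / 2))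
      (s := s) (t := t) (by linarith) hst
      (fun r hr => (hd r (hs0.trans_le hr.1)).continuousAt.continuousWithinAt)
      (fun r hr => hd r (hs0.trans hr.1))
      (fun r hr => (hle r (hs0.trans hr.1)).trans (by linarith [(hs r hr.1.le).1]))
    have h1 : a * (η / 2) / -a = -(η / 2) := by field_simp
    rw [h1] at h
    nlinarith [Real.exp_pos (-a * (t - s))]
  have hlim : Tendsto (fun t => Real.exp (-a * (t - s)) * φ s) atTop (𝓝 0) := by
    have h1 : Tendsto (fun t : ℝ => -a * (t - s)) atTop atBot :=
      (tendsto_atTop_add_const_right _ (-s) tendsto_id).const_mul_atTop_of_neg (by linarith)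
    simpa using (Real.tendsto_exp_atBot.comp h1).mul_const (φ s)
  obtain ⟨t₀, ht₀⟩ := ((hlim.eventually_lt_const (half_pos hη)).and
    (eventually_ge_atTop s)).exists_forall_of_atTop
  refine ⟨t₀, fun t ht => ?_⟩
  rw [Real.dist_eq, sub_zero, abs_of_nonneg (hφ t)]
  linarith [hkey t (ht₀ t ht).2, (ht₀ t ht).1]

/-! ### The matrix 1-norm and quadratic forms -/

section Norms

variable {p q k : ℕ}

theorem sum_abs_le_norm1 (M : Matrix (Fin p) (Fin q) ℝ) (c : Fin q) :
    ∑ r, |M r c| ≤ norm1 M :=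
  le_ciSup (f := fun c => ∑ r, |M r c|) (Set.finite_range _).bddAbove c

theorem norm1_nonneg (M : Matrix (Fin p) (Fin q) ℝ) : 0 ≤ norm1 M :=
  Real.iSup_nonneg fun _ => Finset.sum_nonneg fun _ _ => abs_nonneg _

theorem sum_abs_mulVec_le (M : Matrix (Fin p) (Fin q) ℝ) (x : Fin q → ℝ) :
    ∑ r, |(M *ᵥ x) r| ≤ norm1 M * ∑ c, |x c| := by
  calc ∑ r, |(M *ᵥ x) r| ≤ ∑ r, ∑ c, |M r c| * |x c| := by
        refine Finset.sum_le_sum fun r _ => ?_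
        simp only [← abs_mul]
        exact Finset.abs_sum_le_sum_abs (fun c => M r c * x c) Finset.univ
    _ = ∑ c, (∑ r, |M r c|) * |x c| := by
        rw [Finset.sum_comm]
        simp [Finset.sum_mul]
    _ ≤ ∑ c, norm1 M * |x c| := by
        gcongr with c
        exact sum_abs_le_norm1 M c
    _ = _ := by rw [Finset.mul_sum]

/-- The Euclidean norm of a coordinate vector. -/
noncomputable def euclNorm (x : Fin q → ℝ) : ℝ := √(x ⬝ᵥ x)

theorem euclNorm_nonneg (x : Fin q → ℝ) : 0 ≤ euclNorm x := Real.sqrt_nonneg _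

theorem dotProduct_self_nonneg' (x : Fin q → ℝ) : 0 ≤ x ⬝ᵥ x :=
  Finset.sum_nonneg fun _ _ => mul_self_nonneg _

theorem euclNorm_sq (x : Fin q → ℝ) : euclNorm x ^ 2 = x ⬝ᵥ x :=
  Real.sq_sqrt (dotProduct_self_nonneg' x)

theorem dotProduct_le_euclNorm_mul (x y : Fin q → ℝ) : x ⬝ᵥ y ≤ euclNorm x * euclNorm y := by
  have h := Real.sum_mul_le_sqrt_mul_sqrt Finset.univ x y
  simp only [sq] at h
  exact h

theorem euclNorm_le_sum_abs (x : Fin q → ℝ) : euclNorm x ≤ ∑ c, |x c| := by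
  refine Real.sqrt_le_iff.2 ⟨Finset.sum_nonneg fun _ _ => abs_nonneg _, ?_⟩
  have h := Finset.sum_sq_le_sq_sum_of_nonneg (s := Finset.univ) (f := fun c => |x c|)
    fun _ _ => abs_nonneg _
  simpa [dotProduct, sq_abs, ← sq] using h

theorem sum_abs_le_sqrt_mul_euclNorm (x : Fin q → ℝ) : ∑ c, |x c| ≤ √q * euclNorm x := by
  rw [euclNorm, ← Real.sqrt_mul (Nat.cast_nonneg q)]
  refine Real.le_sqrt_of_sq_le ?_
  have h := sq_sum_le_card_mul_sum_sq (s := (Finset.univ : Finset (Fin q))) (f := fun c => |x c|)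
  simpa [dotProduct, sq_abs, ← sq] using h

/-- The passage from the 1-norm back to the Euclidean norm is made only once, at y, hence a single
factor √q; it is the source of √n in the threshold. -/
theorem dotProduct_mulVec_mulVec_le (z : Fin p → ℝ) (P : Matrix (Fin p) (Fin p) ℝ)
    (M : Matrix (Fin p) (Fin q) ℝ) (y : Fin q → ℝ) :
    z ⬝ᵥ (P *ᵥ (M *ᵥ y)) ≤ norm1 P * norm1 M * √q * (euclNorm z * euclNorm y) := by
  have h1 : euclNorm (P *ᵥ (M *ᵥ y)) ≤ norm1 P * (norm1 M * (√q * euclNorm y)) := by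
    refine (euclNorm_le_sum_abs _).trans ((sum_abs_mulVec_le _ _).trans ?_)
    refine mul_le_mul_of_nonneg_left ((sum_abs_mulVec_le _ _).trans ?_) (norm1_nonneg P)
    exact mul_le_mul_of_nonneg_left (sum_abs_le_sqrt_mul_euclNorm y) (norm1_nonneg M)
  calc z ⬝ᵥ (P *ᵥ (M *ᵥ y)) ≤ euclNorm z * euclNorm (P *ᵥ (M *ᵥ y)) :=
        dotProduct_le_euclNorm_mul _ _
    _ ≤ euclNorm z * (norm1 P * (norm1 M * (√q * euclNorm y))) :=
        mul_le_mul_of_nonneg_left h1 (euclNorm_nonneg z)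
    _ = _ := by ring

theorem dotProduct_mulVec_le (z : Fin q → ℝ) (P : Matrix (Fin q) (Fin q) ℝ) :
    z ⬝ᵥ (P *ᵥ z) ≤ norm1 P * √q * (z ⬝ᵥ z) := by
  have h1 : euclNorm (P *ᵥ z) ≤ norm1 P * (√q * euclNorm z) :=
    (euclNorm_le_sum_abs _).trans ((sum_abs_mulVec_le _ _).trans
      (mul_le_mul_of_nonneg_left (sum_abs_le_sqrt_mul_euclNorm z) (norm1_nonneg P)))
  rw [← euclNorm_sq]
  calc z ⬝ᵥ (P *ᵥ z) ≤ euclNorm z * euclNorm (P *ᵥ z) := dotProduct_le_euclNorm_mul _ _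
    _ ≤ euclNorm z * (norm1 P * (√q * euclNorm z)) :=
        mul_le_mul_of_nonneg_left h1 (euclNorm_nonneg z)
    _ = _ := by ring

theorem hasDerivAt_mulVec (M : Matrix (Fin p) (Fin q) ℝ) {z : ℝ → Fin q → ℝ}
    {z' : Fin q → ℝ} {t : ℝ} (h : HasDerivAt z z' t) :
    HasDerivAt (fun s => M *ᵥ z s) (M *ᵥ z') t :=
  ((LinearMap.toContinuousLinearMap (Matrix.mulVecLin M)).hasFDerivAt
    (x := z t)).comp_hasDerivAt t h

theorem hasDerivAt_dotProduct {y z : ℝ → Fin q → ℝ} {y' z' : Fin q → ℝ} {t : ℝ}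
    (hy : HasDerivAt y y' t) (hz : HasDerivAt z z' t) :
    HasDerivAt (fun s => y s ⬝ᵥ z s) (y' ⬝ᵥ z t + y t ⬝ᵥ z') t := by
  have h := HasDerivAt.fun_sum (u := Finset.univ) fun c _ =>
    ((hasDerivAt_pi.1 hy c).mul (hasDerivAt_pi.1 hz c))
  refine h.congr_deriv ?_
  rw [Finset.sum_add_distrib]
  rfl

theorem hasDerivAt_quadForm {P : Matrix (Fin q) (Fin q) ℝ} (hP : P.PosDef) {z : ℝ → Fin q → ℝ}
    {z' : Fin q → ℝ} {t : ℝ} (h : HasDerivAt z z' t) :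
    HasDerivAt (fun s => z s ⬝ᵥ (P *ᵥ z s)) (2 * (z t ⬝ᵥ (P *ᵥ z'))) t := by
  refine (hasDerivAt_dotProduct h (hasDerivAt_mulVec P h)).congr_deriv ?_
  have hT : Pᵀ = P := by
    have := hP.1
    rwa [Matrix.IsHermitian, Matrix.conjTranspose_eq_transpose_of_trivial] at this
  rw [dotProduct_comm z', Matrix.dotProduct_mulVec (z t), ← Matrix.mulVec_transpose, hT]
  ring

-- Writing P = BᵀB with B invertible, the form is |Bz|², so it controls every coordinate of Bz and
-- then z.
open scoped MatrixOrder Matrix.Norms.L2Operator in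
theorem tendsto_zero_of_quadForm {α : Type*} {f : Filter α} {P : Matrix (Fin q) (Fin q) ℝ}
    (hP : P.PosDef) {z : α → Fin q → ℝ} (h : Tendsto (fun s => z s ⬝ᵥ (P *ᵥ z s)) f (𝓝 0)) :
    Tendsto z f (𝓝 0) := by
  obtain ⟨B, hB⟩ := CStarAlgebra.nonneg_iff_eq_star_mul_self.1 hP.posSemidef.nonneg
  rw [Matrix.star_eq_conjTranspose, Matrix.conjTranspose_eq_transpose_of_trivial] at hB
  have hdet : IsUnit B.det := by
    have h1 := hP.det_pos
    rw [hB, Matrix.det_mul] at h1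
    exact isUnit_iff_ne_zero.2 (right_ne_zero_of_mul h1.ne')
  have hBz : Tendsto (fun s => B *ᵥ z s) f (𝓝 0) := by
    rw [tendsto_pi_nhds]
    intro r
    refine squeeze_zero_norm (fun s => ?_) (by simpa using h.sqrt)
    refine Real.le_sqrt_of_sq_le ?_
    rw [hB, ← Matrix.mulVec_mulVec, Matrix.dotProduct_mulVec, Matrix.vecMul_transpose,
      Real.norm_eq_abs, sq_abs, sq]
    exact Finset.single_le_sum (f := fun c => (B *ᵥ z s) c * (B *ᵥ z s) c)
      (fun _ _ => mul_self_nonneg _) (Finset.mem_univ r)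
  have h2 := ((LinearMap.toContinuousLinearMap (Matrix.mulVecLin B⁻¹)).continuous.tendsto 0).comp hBz
  rw [map_zero] at h2
  refine h2.congr fun s => ?_
  show B⁻¹ *ᵥ (B *ᵥ z s) = z s
  rw [Matrix.mulVec_mulVec, Matrix.nonsing_inv_mul _ hdet, Matrix.one_mulVec]

end Norms

/-- Cauchy–Schwarz for (Σ r_i)² minus its diagonal; this is where N - 1 in the threshold comes from.
-/
theorem sum_sum_erase_mul_le {N : ℕ} (r : Fin N → ℝ) :
    ∑ i, ∑ j ∈ Finset.univ.erase i, r i * r j ≤ (N - 1) * ∑ i, r i ^ 2 := by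
  have h := sq_sum_le_card_mul_sum_sq (s := (Finset.univ : Finset (Fin N))) (f := r)
  have h1 : ∑ i, ∑ j ∈ Finset.univ.erase i, r i * r j = (∑ i, r i) ^ 2 - ∑ i, r i ^ 2 := by
    rw [sq, Finset.sum_mul_sum, ← Finset.sum_sub_distrib]
    refine Finset.sum_congr rfl fun i _ => ?_
    rw [← Finset.add_sum_erase _ _ (Finset.mem_univ i)]
    ring
  rw [h1]
  simp only [Finset.card_univ, Fintype.card_fin] at h
  linarith


/-! ### The closed loop -/

section Tracking

theorem scaleS_isUnit_det (k : ℕ) {ε : ℝ} (hε : 0 < ε) : IsUnit (scaleS k ε).det := by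
  rw [scaleS, Matrix.det_diagonal, isUnit_iff_ne_zero]
  exact Finset.prod_ne_zero_iff.2 fun j _ => (pow_pos hε _).ne'

/-- The term a of the feedback cancels the last row of the canonical form and leaves a chain of
integrators. -/
theorem companionMat_add_vecMulVec {k : ℕ} (a b : Fin k → ℝ) :
    companionMat a + Matrix.vecMulVec (lastVec k) (b + a)
      = shiftMat k + Matrix.vecMulVec (lastVec k) b := by
  ext r c
  simp only [companionMat, shiftMat, lastVec, Matrix.add_apply, Matrix.of_apply,
    Matrix.vecMulVec_apply, Pi.add_apply]
  by_cases hr : (r : ℕ) + 1 = k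
  · have : (c : ℕ) ≠ (r : ℕ) + 1 := by omega
    simp [hr]
    omega
  · simp [hr]

/-- High gain is a change of time scale: each superdiagonal step gains ε⁻¹ from consecutive powers
in S(ε), and the exponents in `scaleSbar` are chosen so that the last row gains the same factor. -/
theorem scaleS_mul_closedLoop {k : ℕ} {ε : ℝ} (hε : 0 < ε) (K : Fin k → ℝ) :
    scaleS k ε * (shiftMat k + Matrix.vecMulVec (lastVec k) (ε⁻¹ • (K ᵥ* scaleSbar k ε)))
      = ε⁻¹ • ((shiftMat k + Matrix.vecMulVec (lastVec k) K) * scaleS k ε) := by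
  ext r c
  simp only [scaleS, scaleSbar, Matrix.diagonal_mul, Matrix.mul_diagonal, Matrix.smul_apply,
    Matrix.add_apply, Matrix.vecMulVec_apply, Pi.smul_apply, Matrix.vecMul_diagonal, smul_eq_mul,
    shiftMat, lastVec, Matrix.of_apply]
  by_cases hr : (r : ℕ) + 1 = k
  · have hc : (c : ℕ) ≠ (r : ℕ) + 1 := by omega
    have h1 : ε ^ (((c : ℕ) : ℤ) + 1 - (k : ℤ)) * ε ^ (r : ℕ) = ε ^ (c : ℕ) := by
      rw [← zpow_natCast ε r, ← zpow_add₀ hε.ne', ← zpow_natCast ε c]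
      congr 1
      omega
    rw [if_neg hc, if_pos hr, ← h1]
    ring
  · rw [if_neg hr]
    by_cases hc : (c : ℕ) = (r : ℕ) + 1
    · rw [if_pos hc, hc, pow_succ]
      field_simp
      ring
    · simp [hc]

variable {N : ℕ} {n : Fin N → ℕ} {sys : LinSys n} {D : Design n} {ε : ℝ}

theorem LinSys.rhs_sub_rhs (sys : LinSys n) (x y : ∀ i, Fin (n i) → ℝ) (u v : Fin N → ℝ)
    (i : Fin N) :
    sys.rhs x u i - sys.rhs y v i = ∑ j, sys.A i j *ᵥ (x j - y j) + (u i - v i) • sys.B i := by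
  simp only [LinSys.rhs, Matrix.mulVec_sub, Finset.sum_sub_distrib, sub_smul]
  abel

theorem Design.control_eq (D : Design n) (ε : ℝ) (i : Fin N) (x y : Fin (n i) → ℝ)
    (v : Dec (n i)) :
    D.control ε i x v = (D.K ε i + D.a i) ⬝ᵥ (D.T i *ᵥ (x - y)) + D.control ε i y v := by
  have h : x - statePart v = (x - y) + (y - statePart v) := by abel
  simp only [Design.control]
  rw [h, Matrix.mulVec_add, dotProduct_add]
  ring

/-- In the coordinates `z_i = S_i(ε) T_i (x_i - x̃_i)` the closed loop is a perturbation of decoupled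
stable systems. -/
theorem Design.Admissible.scaled_rhs (hD : D.Admissible sys) (hε : 0 < ε)
    {y : ∀ i, Fin (n i) → ℝ} {v : Fin N → ℝ} (hy : ∀ i, sys.rhs y v i = 0)
    (x : ∀ i, Fin (n i) → ℝ) (wb : Joint n) (i : Fin N) :
    (scaleS (n i) ε * D.T i) *ᵥ sys.rhs x (fun i => D.control ε i (x i) (wb i)) i
      = ε⁻¹ • ((shiftMat (n i) + Matrix.vecMulVec (lastVec (n i)) (D.K₀ i)) *ᵥ
          ((scaleS (n i) ε * D.T i) *ᵥ (x i - y i)))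
        + ∑ j ∈ Finset.univ.erase i,
            (scaleS (n i) ε * D.coupling sys i j * (scaleS (n j) ε)⁻¹) *ᵥ
              ((scaleS (n j) ε * D.T j) *ᵥ (x j - y j))
        + (D.control ε i (y i) (wb i) - v i) • (scaleS (n i) ε *ᵥ lastVec (n i)) := by
  set S := scaleS (n i) ε with hS
  have hTi : ∀ j, (D.T j)⁻¹ * D.T j = 1 := fun j => Matrix.nonsing_inv_mul _ (hD.nonsing j)
  have hSi : ∀ j, (scaleS (n j) ε)⁻¹ * scaleS (n j) ε = 1 := fun j =>
    Matrix.nonsing_inv_mul _ (scaleS_isUnit_det _ hε)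
  have hsub := sys.rhs_sub_rhs x y (fun i => D.control ε i (x i) (wb i)) v i
  rw [hy, sub_zero] at hsub
  rw [hsub, ← Finset.add_sum_erase _ _ (Finset.mem_univ i), Matrix.mulVec_add, Matrix.mulVec_add,
    Matrix.mulVec_sum, Matrix.mulVec_smul]
  have hoff : ∀ j, (S * D.coupling sys i j * (scaleS (n j) ε)⁻¹) *ᵥ
      ((scaleS (n j) ε * D.T j) *ᵥ (x j - y j)) = (S * D.T i) *ᵥ (sys.A i j *ᵥ (x j - y j)) :=
    fun j => by
      rw [Matrix.mulVec_mulVec, Matrix.mulVec_mulVec, Design.coupling]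
      congr 1
      calc S * (D.T i * sys.A i j * (D.T j)⁻¹) * (scaleS (n j) ε)⁻¹ * (scaleS (n j) ε * D.T j)
          = S * D.T i * sys.A i j * (D.T j)⁻¹ * ((scaleS (n j) ε)⁻¹ * scaleS (n j) ε) * D.T j := by
            simp only [Matrix.mul_assoc]
        _ = _ := by rw [hSi, Matrix.mul_one, Matrix.mul_assoc _ (D.T j)⁻¹, hTi, Matrix.mul_one]
  simp only [hoff]
  set e := D.T i *ᵥ (x i - y i) with he
  have hB : (S * D.T i) *ᵥ sys.B i = S *ᵥ lastVec (n i) := by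
    rw [← Matrix.mulVec_mulVec, hD.canon_B]
  have hA : (S * D.T i) *ᵥ (sys.A i i *ᵥ (x i - y i)) = S *ᵥ (companionMat (D.a i) *ᵥ e) := by
    rw [he, ← hD.canon_A, Matrix.mulVec_mulVec, Matrix.mulVec_mulVec, Matrix.mulVec_mulVec]
    congr 1
    simp only [Matrix.mul_assoc, hTi, Matrix.mul_one]
  have hmain : S *ᵥ (companionMat (D.a i) *ᵥ e) + ((D.K ε i + D.a i) ⬝ᵥ e) • (S *ᵥ lastVec (n i))
      = ε⁻¹ • ((shiftMat (n i) + Matrix.vecMulVec (lastVec (n i)) (D.K₀ i)) *ᵥ (S *ᵥ e)) := by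
    have h1 : ((D.K ε i + D.a i) ⬝ᵥ e) • lastVec (n i)
        = Matrix.vecMulVec (lastVec (n i)) (D.K ε i + D.a i) *ᵥ e := by
      rw [Matrix.vecMulVec_mulVec, op_smul_eq_smul]
    clear_value e
    rw [← Matrix.mulVec_smul, ← Matrix.mulVec_add, h1, ← Matrix.add_mulVec,
      companionMat_add_vecMulVec, Matrix.mulVec_mulVec, Design.K, hS, scaleS_mul_closedLoop hε,
      Matrix.smul_mulVec, Matrix.mulVec_mulVec]
  rw [hA, hB, ← Matrix.mulVec_mulVec _ S, ← he, ← hmain, D.control_eq ε i (x i) (y i) (wb i), ← he]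
  simp only [add_sub_assoc, add_smul]
  abel

/-- The Lyapunov estimate for interconnected stable systems with weak coupling. -/
theorem lyapunov_deriv_le {P M : ∀ i, Matrix (Fin (n i)) (Fin (n i)) ℝ}
    (hL : ∀ i, P i * M i + (M i)ᵀ * P i = -1) (hP : ∀ i, (P i).PosDef)
    {C : ∀ i j, Matrix (Fin (n i)) (Fin (n j)) ℝ} {σ : Fin N → ℝ} (hσ : ∀ i, 0 < σ i)
    (hC : ∀ i j, j ≠ i → norm1 (C i j) ≤ σ i) {γ : ℝ}
    (hγ : γ > 2 * √((∑ i, n i : ℕ) : ℝ) * ((N : ℝ) - 1) * (⨆ i, σ i * norm1 (P i)) + 2)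
    (z f : ∀ i, Fin (n i) → ℝ) :
    ∑ i, 2 * (z i ⬝ᵥ (P i *ᵥ (γ • (M i *ᵥ z i)
        + ∑ j ∈ Finset.univ.erase i, C i j *ᵥ z j + f i)))
      ≤ -∑ i, z i ⬝ᵥ z i + ∑ i, (P i *ᵥ f i) ⬝ᵥ (P i *ᵥ f i) := by
  set κ := ⨆ i, σ i * norm1 (P i)
  have hκ : ∀ i, σ i * norm1 (P i) ≤ κ := fun i =>
    le_ciSup (f := fun i => σ i * norm1 (P i)) (Set.finite_range _).bddAbove i
  have hquad : ∀ i, 2 * (z i ⬝ᵥ (P i *ᵥ (M i *ᵥ z i))) = -(z i ⬝ᵥ z i) := fun i => by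
    have hT : (P i)ᵀ = P i := by
      have := (hP i).1
      rwa [Matrix.IsHermitian, Matrix.conjTranspose_eq_transpose_of_trivial] at this
    have h1 := congrArg (fun Q => z i ⬝ᵥ (Q *ᵥ z i)) (hL i)
    simp only [Matrix.add_mulVec, dotProduct_add, Matrix.neg_mulVec, Matrix.one_mulVec,
      dotProduct_neg, ← Matrix.mulVec_mulVec] at h1
    have h2 : z i ⬝ᵥ ((M i)ᵀ *ᵥ (P i *ᵥ z i)) = z i ⬝ᵥ (P i *ᵥ (M i *ᵥ z i)) := by
      rw [Matrix.dotProduct_mulVec, Matrix.vecMul_transpose, Matrix.dotProduct_mulVec (z i),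
        ← Matrix.mulVec_transpose (P i), hT, dotProduct_comm]
    rw [h2] at h1
    linarith
  have hcross : ∀ i, ∀ j ∈ Finset.univ.erase i, z i ⬝ᵥ (P i *ᵥ (C i j *ᵥ z j))
      ≤ √((∑ i, n i : ℕ) : ℝ) * κ * (euclNorm (z i) * euclNorm (z j)) := fun i j hj => by
    refine (dotProduct_mulVec_mulVec_le _ _ _ _).trans ?_
    refine mul_le_mul_of_nonneg_right ?_ (mul_nonneg (euclNorm_nonneg _) (euclNorm_nonneg _))
    have h1 : norm1 (P i) * norm1 (C i j) ≤ κ := by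
      refine le_trans ?_ (hκ i)
      rw [mul_comm]
      exact mul_le_mul_of_nonneg_right (hC i j (Finset.ne_of_mem_erase hj)) (norm1_nonneg _)
    have h2 : √((n j : ℕ) : ℝ) ≤ √((∑ i, n i : ℕ) : ℝ) :=
      Real.sqrt_le_sqrt (Nat.cast_le.2
        (Finset.single_le_sum (f := n) (fun _ _ => Nat.zero_le _) (Finset.mem_univ j)))
    rw [mul_comm]
    exact mul_le_mul h2 h1 (mul_nonneg (norm1_nonneg _) (norm1_nonneg _)) (Real.sqrt_nonneg _)
  -- Of the constant 2 in the threshold, one unit pays for this Young inequality and the other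
  -- remains as the decay -|z|².
  have hforce : ∀ i, 2 * (z i ⬝ᵥ (P i *ᵥ f i))
      ≤ z i ⬝ᵥ z i + (P i *ᵥ f i) ⬝ᵥ (P i *ᵥ f i) := fun i => by
    have h := dotProduct_self_nonneg' (z i - P i *ᵥ f i)
    rw [sub_dotProduct, dotProduct_sub, dotProduct_sub, dotProduct_comm (P i *ᵥ f i) (z i)] at h
    linarith
  have hterm : ∀ i, 2 * (z i ⬝ᵥ (P i *ᵥ (γ • (M i *ᵥ z i)
        + ∑ j ∈ Finset.univ.erase i, C i j *ᵥ z j + f i)))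
      ≤ (1 - γ) * euclNorm (z i) ^ 2
        + 2 * (√((∑ i, n i : ℕ) : ℝ) * κ) *
          ∑ j ∈ Finset.univ.erase i, euclNorm (z i) * euclNorm (z j)
        + (P i *ᵥ f i) ⬝ᵥ (P i *ᵥ f i) := fun i => by
    rw [Matrix.mulVec_add, Matrix.mulVec_add, Matrix.mulVec_smul, dotProduct_add, dotProduct_add,
      dotProduct_smul, Matrix.mulVec_sum, dotProduct_sum, smul_eq_mul, euclNorm_sq]
    have h1 := Finset.sum_le_sum (hcross i)
    rw [← Finset.mul_sum] at h1
    have h2 := hquad i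
    have h3 := hforce i
    have h4 : 2 * (γ * (z i ⬝ᵥ (P i *ᵥ (M i *ᵥ z i)))) = -γ * (z i ⬝ᵥ z i) := by
      rw [mul_left_comm, h2]
      ring
    linarith
  refine (Finset.sum_le_sum fun i _ => hterm i).trans ?_
  rw [Finset.sum_add_distrib, Finset.sum_add_distrib, ← Finset.mul_sum, ← Finset.mul_sum]
  simp only [← euclNorm_sq (z _)]
  set R := ∑ i, euclNorm (z i) ^ 2
  have hR : 0 ≤ R := Finset.sum_nonneg fun _ _ => sq_nonneg _
  have hκ0 : 0 ≤ κ := Real.iSup_nonneg fun i => mul_nonneg (hσ i).le (norm1_nonneg _)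
  have h5 := mul_le_mul_of_nonneg_left (sum_sum_erase_mul_le fun i => euclNorm (z i))
    (by positivity : 0 ≤ 2 * (√((∑ i, n i : ℕ) : ℝ) * κ))
  have h6 := mul_le_mul_of_nonneg_right hγ.le hR
  have h7 : 2 * (√((∑ i, n i : ℕ) : ℝ) * κ) * ((N - 1) * R)
      = 2 * √((∑ i, n i : ℕ) : ℝ) * ((N : ℝ) - 1) * κ * R := by ring
  rw [h7] at h5
  linarith

theorem tendsto_mulVec {α : Type*} {f : Filter α} {p q : ℕ} (M : Matrix (Fin p) (Fin q) ℝ)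
    {z : α → Fin q → ℝ} {a : Fin q → ℝ} (h : Tendsto z f (𝓝 a)) :
    Tendsto (fun s => M *ᵥ z s) f (𝓝 (M *ᵥ a)) :=
  ((LinearMap.toContinuousLinearMap (Matrix.mulVecLin M)).continuous.tendsto a).comp h

theorem continuous_control (D : Design n) (ε : ℝ) (i : Fin N) :
    Continuous fun v : (Fin (n i) → ℝ) × Dec (n i) => D.control ε i v.1 v.2 := by
  have h1 : Continuous fun v : (Fin (n i) → ℝ) × Dec (n i) => v.1 - statePart v.2 := by
    refine continuous_pi fun r => ?_
    simp only [Pi.sub_apply, statePart]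
    fun_prop
  have h2 : Continuous fun v : (Fin (n i) → ℝ) × Dec (n i) => inputPart v.2 := by
    simp only [inputPart]
    fun_prop
  simp only [Design.control]
  exact (Continuous.dotProduct continuous_const
    (Continuous.matrix_mulVec continuous_const h1)).add h2

theorem control_self (D : Design n) (ε : ℝ) (i : Fin N) (v : Dec (n i)) :
    D.control ε i (statePart v) v = inputPart v := by
  simp [Design.control]

/-- The tracking law steers the physical system to the steady state that the reference signal
converges to. -/
theorem Design.Admissible.tendsto_of_tracking (hD : D.Admissible sys) {σ : Fin N → ℝ}
    (hσ : D.CouplingBound sys σ) (hε : 0 < ε)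
    (hε' : 1 / ε > 2 * √((∑ i, n i : ℕ) : ℝ) * ((N : ℝ) - 1) *
      (⨆ i, σ i * norm1 (D.P₀ i)) + 2)
    {wt : Joint n}
    (hsteady : ∀ i, sys.rhs (fun j => statePart (wt j)) (fun j => inputPart (wt j)) i = 0)
    {wbar : ℝ → Joint n} (hw : Tendsto wbar atTop (𝓝 wt)) {x : ℝ → ∀ i, Fin (n i) → ℝ}
    {u : ℝ → Fin N → ℝ}
    (hx : ∀ t, 0 < t → ∀ i, HasDerivAt (fun s => x s i) (sys.rhs (x t) (u t) i) t)
    (hu : ∀ t, 0 < t → ∀ i, u t i = D.control ε i (x t i) (wbar t i)) :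
    Tendsto x atTop (𝓝 fun i => statePart (wt i)) ∧
      Tendsto u atTop (𝓝 fun i => inputPart (wt i)) := by
  have hwi : ∀ i, Tendsto (fun t => wbar t i) atTop (𝓝 (wt i)) := fun i =>
    ((PiLp.continuous_apply 2 _ i).tendsto wt).comp hw
  set y : ∀ i, Fin (n i) → ℝ := fun i => statePart (wt i) with hy
  set Q : ∀ i, Matrix (Fin (n i)) (Fin (n i)) ℝ := fun i => scaleS (n i) ε * D.T i with hQ
  have hQdet : ∀ i, IsUnit (Q i).det := fun i => by
    rw [hQ, Matrix.det_mul]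
    exact (scaleS_isUnit_det _ hε).mul (hD.nonsing i)
  set z : ∀ i, ℝ → Fin (n i) → ℝ := fun i t => Q i *ᵥ (x t i - y i) with hz
  -- The reference signal enters only through f, which measures its control at the limiting steady
  -- state. The reference itself need not be feasible or a steady state along the way.
  set f : ∀ i, ℝ → Fin (n i) → ℝ := fun i t =>
    (D.control ε i (y i) (wbar t i) - inputPart (wt i)) • (scaleS (n i) ε *ᵥ lastVec (n i)) with hf
  have hf0 : ∀ i, Tendsto (f i) atTop (𝓝 0) := fun i => by
    have h1 : Tendsto (fun t => D.control ε i (y i) (wbar t i)) atTop (𝓝 (inputPart (wt i))) := by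
      have h2 := ((continuous_control D ε i).tendsto (y i, wt i)).comp
        (tendsto_const_nhds.prodMk_nhds (hwi i))
      rwa [control_self] at h2
    have h3 := (h1.sub_const (inputPart (wt i))).smul_const (scaleS (n i) ε *ᵥ lastVec (n i))
    rwa [sub_self, zero_smul] at h3
  set C : ∀ i j, Matrix (Fin (n i)) (Fin (n j)) ℝ := fun i j =>
    scaleS (n i) ε * D.coupling sys i j * (scaleS (n j) ε)⁻¹ with hC
  set M : ∀ i, Matrix (Fin (n i)) (Fin (n i)) ℝ := fun i =>
    shiftMat (n i) + Matrix.vecMulVec (lastVec (n i)) (D.K₀ i) with hM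
  set z' : ∀ i, ℝ → Fin (n i) → ℝ := fun i t =>
    ε⁻¹ • (M i *ᵥ z i t) + ∑ j ∈ Finset.univ.erase i, C i j *ᵥ z j t + f i t with hz'
  have hzd : ∀ t, 0 < t → ∀ i, HasDerivAt (z i) (z' i t) t := fun t ht i => by
    have h1 := hasDerivAt_mulVec (Q i) ((hx t ht i).sub_const (y i))
    have h2 : u t = fun i => D.control ε i (x t i) (wbar t i) := funext (hu t ht)
    rw [h2] at h1
    exact h1.congr_deriv (hD.scaled_rhs hε hsteady (x t) (wbar t) i)
  -- An index is required so that N ≥ 1 and the threshold is at least 2; ε < 1 then gives access to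
  -- the coupling bound.
  have hε1 : ∀ _ : Fin N, ε < 1 := fun i => by
    have hN : (1 : ℝ) ≤ N := by exact_mod_cast (Fin.pos i)
    have h0 : 0 ≤ 2 * √((∑ i, n i : ℕ) : ℝ) * ((N : ℝ) - 1) * (⨆ i, σ i * norm1 (D.P₀ i)) :=
      mul_nonneg (mul_nonneg (by positivity) (by linarith))
        (Real.iSup_nonneg fun i => mul_nonneg (hσ.1 i).le (norm1_nonneg _))
    have h1 : 1 < 1 / ε := by linarith
    rwa [lt_div_iff₀ hε, one_mul] at h1
  -- Chosen so that V ≤ c |z|², which turns the decay -|z|² into -V/c; the summand 1 guarantees c >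
  -- 0.
  set c : ℝ := ∑ i, norm1 (D.P₀ i) * √(n i) + 1 with hc
  have hcpos : 0 < c := by
    have : 0 ≤ ∑ i, norm1 (D.P₀ i) * √(n i) :=
      Finset.sum_nonneg fun i _ => mul_nonneg (norm1_nonneg _) (Real.sqrt_nonneg _)
    linarith
  set V : ℝ → ℝ := fun t => ∑ i, z i t ⬝ᵥ (D.P₀ i *ᵥ z i t) with hV
  have hVi : ∀ i t, 0 ≤ z i t ⬝ᵥ (D.P₀ i *ᵥ z i t) := fun i t => by
    simpa using (hD.posDef i).posSemidef.dotProduct_mulVec_nonneg (z i t)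
  have hVc : ∀ t, V t ≤ c * ∑ i, z i t ⬝ᵥ z i t := fun t => by
    rw [Finset.mul_sum]
    refine Finset.sum_le_sum fun i _ => (dotProduct_mulVec_le _ _).trans ?_
    refine mul_le_mul_of_nonneg_right ?_ (dotProduct_self_nonneg' _)
    have := Finset.single_le_sum (f := fun i => norm1 (D.P₀ i) * √(n i))
      (fun i _ => mul_nonneg (norm1_nonneg _) (Real.sqrt_nonneg _)) (Finset.mem_univ i)
    linarith
  have hVlim : Tendsto V atTop (𝓝 0) := by
    refine tendsto_zero_of_deriv_le (φ' := fun t => ∑ i, 2 * (z i t ⬝ᵥ (D.P₀ i *ᵥ z' i t)))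
      (β := fun t => ∑ i, (D.P₀ i *ᵥ f i t) ⬝ᵥ (D.P₀ i *ᵥ f i t)) (inv_pos.2 hcpos)
      (fun t => Finset.sum_nonneg fun i _ => hVi i t)
      (fun t ht => HasDerivAt.fun_sum fun i _ => hasDerivAt_quadForm (hD.posDef i) (hzd t ht i))
      (fun t _ => ?_) ?_
    · have h1 := lyapunov_deriv_le (γ := ε⁻¹) hD.lyapunov hD.posDef hσ.1
        (fun i j hij => (hσ.2 i j hij ε hε (hε1 i)).le) (by rwa [one_div] at hε')
        (fun i => z i t) (fun i => f i t)
      refine h1.trans ?_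
      have h2 := (inv_mul_le_iff₀ hcpos).2 (hVc t)
      linarith
    · have h1 : ∀ i, Tendsto (fun t => (D.P₀ i *ᵥ f i t) ⬝ᵥ (D.P₀ i *ᵥ f i t)) atTop (𝓝 0) :=
        fun i => by
          have h2 := tendsto_mulVec (D.P₀ i) (hf0 i)
          rw [Matrix.mulVec_zero] at h2
          have h3 : Continuous fun v : Fin (n i) → ℝ => v ⬝ᵥ v :=
            Continuous.dotProduct continuous_id continuous_id
          have h4 := (h3.tendsto 0).comp h2
          rwa [zero_dotProduct] at h4
      simpa using tendsto_finsetSum Finset.univ fun i _ => h1 i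
  have hzlim : ∀ i, Tendsto (z i) atTop (𝓝 0) := fun i =>
    tendsto_zero_of_quadForm (hD.posDef i) (squeeze_zero (hVi i) (fun t =>
      Finset.single_le_sum (f := fun i => z i t ⬝ᵥ (D.P₀ i *ᵥ z i t)) (fun i _ => hVi i t)
        (Finset.mem_univ i)) hVlim)
  have hxlim : ∀ i, Tendsto (fun t => x t i) atTop (𝓝 (y i)) := fun i => by
    have h1 := (tendsto_mulVec (Q i)⁻¹ (hzlim i)).add_const (y i)
    rw [Matrix.mulVec_zero, zero_add] at h1
    refine h1.congr fun t => ?_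
    rw [hz, Matrix.mulVec_mulVec, Matrix.nonsing_inv_mul _ (hQdet i), Matrix.one_mulVec,
      sub_add_cancel]
  refine ⟨tendsto_pi_nhds.2 hxlim, tendsto_pi_nhds.2 fun i => ?_⟩
  have h2 := ((continuous_control D ε i).tendsto (y i, wt i)).comp
    ((hxlim i).prodMk_nhds (hwi i))
  rw [control_self] at h2
  refine h2.congr' ?_
  filter_upwards [eventually_gt_atTop 0] with t ht
  exact (hu t ht i).symm

/-- The closed loop has a solution for every continuous reference signal. -/
theorem exists_tracking_solution (sys : LinSys n) (D : Design n) (ε : ℝ) {wbar : ℝ → Joint n}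
    (hw : Continuous wbar) (x₀ : ∀ i, Fin (n i) → ℝ) :
    ∃ x : ℝ → ∀ i, Fin (n i) → ℝ, x 0 = x₀ ∧ Continuous x ∧ ∀ t i,
      HasDerivAt (fun s => x s i)
        (sys.rhs (x t) (fun i => D.control ε i (x t i) (wbar t i)) i) t := by
  -- The closed loop is affine in x: L collects the dependence on x, and the control at x = 0
  -- supplies the forcing b.
  let L : (∀ i, Fin (n i) → ℝ) →ₗ[ℝ] (∀ i, Fin (n i) → ℝ) :=
    { toFun := fun x i => ∑ j, sys.A i j *ᵥ x j +
        ((D.K ε i + D.a i) ⬝ᵥ (D.T i *ᵥ x i)) • sys.B i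
      map_add' := fun x y => by
        funext i
        simp only [Pi.add_apply, Matrix.mulVec_add, dotProduct_add, Finset.sum_add_distrib,
          add_smul]
        abel
      map_smul' := fun a x => by
        funext i
        simp only [Pi.smul_apply, Matrix.mulVec_smul, dotProduct_smul, ← Finset.smul_sum,
          smul_add, RingHom.id_apply, smul_assoc] }
  let b : ℝ → ∀ i, Fin (n i) → ℝ := fun t i => D.control ε i 0 (wbar t i) • sys.B i
  have hb : Continuous b := continuous_pi fun i =>
    ((continuous_control D ε i).comp
      (continuous_const.prodMk ((PiLp.continuous_apply 2 _ i).comp hw))).smul continuous_const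
  obtain ⟨x, hx0, hx⟩ := exists_hasDerivAt_linear (LinearMap.toContinuousLinearMap L) hb x₀
  refine ⟨x, hx0, continuous_iff_continuousAt.2 fun t => (hx t).continuousAt, fun t i => ?_⟩
  refine (hasDerivAt_pi.1 (hx t) i).congr_deriv ?_
  show (∑ j, sys.A i j *ᵥ x t j + ((D.K ε i + D.a i) ⬝ᵥ (D.T i *ᵥ x t i)) • sys.B i) +
    D.control ε i 0 (wbar t i) • sys.B i = _
  rw [LinSys.rhs, D.control_eq ε i (x t i) 0, sub_zero, add_smul, add_assoc]

end Tracking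

end LinearVE

theorem theorem1 {N m l : ℕ} (n : Fin N → ℕ)
    (g : LinearVE.Game n m l) (gF : LinearVE.Joint n → LinearVE.Joint n)
    (gG : Fin l → LinearVE.Joint n → LinearVE.Joint n) (hg : g.Regular gF gG)
    (hVE : ∃ w, g.IsVE gF w)
    (sys : LinearVE.LinSys n)
    (hctrl : ∀ i, LinearVE.Controllable (sys.A i i) (sys.B i))
    (hsteady : ∀ w ∈ g.feasible, ∀ i,
      sys.rhs (fun j => LinearVE.statePart (w j)) (fun j => LinearVE.inputPart (w j)) i = 0) :
    -- the design parameters of the control law exist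
    (∃ D : LinearVE.Design n, D.Admissible sys) ∧
    -- there is exactly one variational equilibrium, and the algorithm converges to it
    ∃ wt, g.IsVE gF wt ∧ (∀ w, g.IsVE gF w → w = wt) ∧
      ∀ D : LinearVE.Design n, D.Admissible sys →
      ∀ σ : Fin N → ℝ, D.CouplingBound sys σ →
      ∀ ε : ℝ, 0 < ε →
        1 / ε > 2 * √((∑ i, n i : ℕ) : ℝ) * ((N : ℝ) - 1) *
          (⨆ i, σ i * LinearVE.norm1 (D.P₀ i)) + 2 →
        -- a run exists from every initial condition
        (∀ wbar₀ ∈ g.prodW, ∀ lam₀ : EuclideanSpace ℝ (Fin m),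
          ∀ mu₀ ∈ LinearVE.Game.orthant l, ∀ (x₀ : ∀ i, Fin (n i) → ℝ) (u₀ : Fin N → ℝ),
          ∃ wbar lam mu x u, LinearVE.IsRun g gF gG sys D ε wbar lam mu x u ∧
            wbar 0 = wbar₀ ∧ lam 0 = lam₀ ∧ mu 0 = mu₀ ∧ x 0 = x₀ ∧ u 0 = u₀) ∧
        -- every run converges to the variational equilibrium
        (∀ wbar lam mu x u, LinearVE.IsRun g gF gG sys D ε wbar lam mu x u →
          Tendsto x atTop (𝓝 fun i => LinearVE.statePart (wt i)) ∧
          Tendsto u atTop (𝓝 fun i => LinearVE.inputPart (wt i))) := by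
  refine ⟨LinearVE.exists_admissible_design sys hctrl, ?_⟩
  obtain ⟨wt, hwt⟩ := hVE
  refine ⟨wt, hwt, fun w hw => hg.eq_of_solvesGVI hw.2 hwt.2, fun D hD σ hσ ε hε hε' => ⟨?_, ?_⟩⟩
  · intro w₀ hw₀ lam₀ mu₀ hmu₀ x₀ u₀
    obtain ⟨w, lam, mu, hsol, hwc, hw0, hlam0, hmu0⟩ :=
      hg.exists_isPrimalDualSolution hwt.2 hw₀ lam₀ hmu₀
    obtain ⟨x, hx0, hxc, hx⟩ := LinearVE.exists_tracking_solution sys D ε hwc x₀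
    classical
    -- The law binds u only for t > 0, so u is overwritten at 0 by the prescribed value.
    have hu : ∀ t : ℝ, 0 < t → Function.update
        (fun (t : ℝ) i => D.control ε i (x t i) (w t i)) 0 u₀ t
        = fun i => D.control ε i (x t i) (w t i) :=
      fun t ht => Function.update_of_ne ht.ne' _ _
    refine ⟨w, lam, mu, x, Function.update (fun (t : ℝ) i => D.control ε i (x t i) (w t i)) 0 u₀,
      ⟨hsol, hxc.continuousOn, fun t ht i => ?_, fun t ht i => ?_⟩, hw0, hlam0, hmu0, hx0, ?_⟩
    · rw [hu t ht]
      exact hx t i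
    · rw [hu t ht]
    · exact Function.update_self _ _ _
  · intro w lam mu x u hrun
    exact hD.tendsto_of_tracking hσ hε hε' (hsteady wt hwt.2.1)
      (hg.tendsto_of_isPrimalDualSolution hwt.2 hrun.aux) hrun.dyn hrun.law
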